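/- All vector spaces, Lie algebras and tensor products are over $\mathbb C$. **Setting.** Let $\mathfrak g$ be a finite-dimensional simple Lie algebra with a non-degenerate symmetric invariant bilinear form $(\cdot,\cdot)$, let $n\ge 1$, and let $\sigma_0,\dots,\sigma_n$ be commuting automorphisms of $\mathfrak g$ of finite orders $m_0,\dots,m_n$. Let $\xi_i$ be a primitive $m_i$-th root of unity. For $(k_0,k)\in\mathbb Z\times\mathbb Z^n$, $k=(k_1,\dots,k_n)$, put $$\mathfrak g(\bar k_0,\bar k)=\{X\in\mathfrak g : \sigma_iX=\xi_i^{k_i}X,\ 0\le i\le n\}.$$ Assume that $\mathfrak g(\bar 0,\bar 0)$ is a simple Lie algebra, and fix a Cartan subalgebra $\mathfrak h(0)$ of it and simple roots $\alpha_1,\dots,\alpha_d$ of its root system $\Delta_0^\times$ with respect to $\mathfrak h(0)$. Assume that $LT=\bigoplus_{(k_0,k)}\mathfrak g(\bar k_0,\bar k)\,t_0^{k_0}t^k$ is a centerless Lie torus: as a $\mathfrak g(\bar 0,\bar 0)$-module, each $\mathfrak g(\bar k_0,\bar k)$ is a direct sum $U\oplus V$ with $U$ trivial and $V$ either zero or irreducible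 with highest weight one of: the highest root of $\Delta_0^\times$; the highest short root, if $\Delta_0^\times$ is not simply laced; twice the highest short root, if $\Delta_0^\times$ is of type $B_l$, $l\ge1$ (here $B_1=A_1$, and all roots count as short in the simply laced case). Let $A(m)=\mathbb C[t_1^{\pm m_1},\dots,t_n^{\pm m_n}]$ and $\mathfrak L=LT\oplus (K\otimes A(m))\oplus\mathbb C d_0$, where $K\otimes A(m)$ is central and, with $X(k_0,k)=X\otimes t_0^{k_0}t^k$, $$[X(k_0,k),Y(l_0,l)]=[X,Y](k_0+l_0,k+l)+k_0\,(X,Y)\,\delta_{k_0+l_0,0}\,K\otimes t^{k+l},\qquad [d_0,X(k_0,k)]=k_0X(k_0,k).$$ Put $\tilde{\mathfrak h}(0)=\mathfrak h(0)\oplus\mathbb CK\oplus\mathbb Cd_0$. For $\alpha\in\mathfrak h(0)^*$ let $\mathfrak g(\bar k_0,\bar k,\alpha)$ be the space of vectors of weight $\alpha$ for $\mathfrak h(0)$ in $\mathfrak g(\bar k_0,\bar k)$. Let $$\mathfrak L^0=\bigoplus_{k\in\mathbb Z^n}\mathfrak g(\bar 0,\bar k,0)\,t^k\oplus (K\otimes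 A(m))\oplus\mathbb Cd_0,$$ and let $\mathfrak L^+$ be the sum of all $\bigoplus_{k\in\mathbb Z^n}\mathfrak g(\bar k_0,\bar k,\alpha)\,t_0^{k_0}t^k$ with $k_0>0$, or with $k_0=0$ and $0\ne\alpha\in\bigoplus_{i=1}^d\mathbb N\alpha_i$. For an ideal $I$ of $A(m)$ put $$\mathfrak L^0(I)=\sum_{k\in\mathbb Z^n}\mathfrak g(\bar 0,\bar k,0)\,t^kI\ \oplus\ (K\otimes I).$$ Let $N$ be a finite-dimensional irreducible $\mathfrak L^0$-module, let $\mathfrak L^+$ act on $N$ by zero, and let $V(N)$ be the unique irreducible quotient of the $\mathfrak L$-module $M(N)=U(\mathfrak L)\otimes_{U(\mathfrak L^+\oplus\mathfrak L^0)}N$. **Theorem.** All weight spaces $V(N)_\lambda=\{v\in V(N): hv=\lambda(h)v\ \text{for all } h\in\tilde{\mathfrak h}(0)\}$, $\lambda\in\tilde{\mathfrak h}(0)^*$, are finite-dimensional if and only if there is an ideal $I$ of $A(m)$ with $\dim A(m)/I<\infty$ and $\mathfrak L^0(I)\cdot N=0$. -/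

import Mathlib

/-! ## Multiloop data -/

/-- The data from which a multiloop algebra in `n + 1` variables is built: a non-degenerate
symmetric invariant bilinear form on `𝔤`, commuting automorphisms `σ₀, …, σₙ` of `𝔤` of finite
orders `m₀, …, mₙ`, and primitive `mᵢ`-th roots of unity `ξᵢ`. -/
structure MultiloopDatum (n : ℕ) (𝔤 : Type*) [LieRing 𝔤] [LieAlgebra ℂ 𝔤] where
  /-- the bilinear form `( , )` -/
  form : LinearMap.BilinForm ℂ 𝔤
  form_symm : ∀ x y, form x y = form y x
  form_nondegenerate : form.Nondegenerate
  form_invariant : ∀ x y z, form ⁅x, y⁆ z = form x ⁅y, z⁆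
  /-- the orders of the automorphisms -/
  m : Fin (n + 1) → ℕ
  m_pos : ∀ i, 0 < m i
  /-- the automorphisms -/
  σ : Fin (n + 1) → (𝔤 ≃ₗ⁅ℂ⁆ 𝔤)
  σ_comm : ∀ i j x, σ i (σ j x) = σ j (σ i x)
  σ_order : ∀ i, orderOf (σ i).toLinearEquiv = m i
  /-- the roots of unity -/
  ξ : Fin (n + 1) → ℂ
  ξ_primitive : ∀ i, IsPrimitiveRoot (ξ i) (m i)

namespace MultiloopDatum

/-- The form of a multiloop datum is a multiple of the Killing form, by Schur's lemma. -/
theorem exists_form_eq_killing {n : ℕ} {𝔤 : Type*} [LieRing 𝔤] [LieAlgebra ℂ 𝔤]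
    [FiniteDimensional ℂ 𝔤] [LieAlgebra.IsSimple ℂ 𝔤] (D : MultiloopDatum n 𝔤) :
    ∃ c : ℂ, ∀ x y, D.form x y = c * killingForm ℂ 𝔤 x y := by
  have hnd : (killingForm ℂ 𝔤).Nondegenerate := LieAlgebra.IsKilling.killingForm_nondegenerate ℂ 𝔤
  have hinv : ∀ x y z : 𝔤, killingForm ℂ 𝔤 ⁅x, y⁆ z = killingForm ℂ 𝔤 x ⁅y, z⁆ :=
    fun x y z => LieModule.traceForm_apply_lie_apply ℂ 𝔤 𝔤 x y z
  let e := (killingForm ℂ 𝔤).toDual hnd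
  let φ : Module.End ℂ 𝔤 := e.symm.toLinearMap ∘ₗ D.form
  have hφ : ∀ x y, killingForm ℂ 𝔤 (φ x) y = D.form x y := fun x y =>
    LinearMap.BilinForm.apply_toDual_symm_apply (hB := hnd) (D.form x) y
  have hφlie : ∀ x y : 𝔤, φ ⁅x, y⁆ = ⁅x, φ y⁆ := by
    intro x y
    rw [← sub_eq_zero]
    refine hnd.1 _ fun z => ?_
    rw [map_sub, LinearMap.sub_apply, hφ, ← lie_skew x (φ y), ← lie_skew x y]
    rw [map_neg, map_neg, LinearMap.neg_apply, LinearMap.neg_apply, hinv, hφ, D.form_invariant]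
    simp
  have : Nontrivial 𝔤 := LieModule.nontrivial_of_isIrreducible ℂ 𝔤 𝔤
  obtain ⟨c, hc⟩ := Module.End.exists_eigenvalue φ
  obtain ⟨v, hv⟩ := hc.exists_hasEigenvector
  let I : LieIdeal ℂ 𝔤 :=
    { Module.End.eigenspace φ c with
      lie_mem := by
        intro x y hy
        have hy' : φ y = c • y := Module.End.mem_eigenspace_iff.mp hy
        exact Module.End.mem_eigenspace_iff.mpr (by rw [hφlie, hy', lie_smul]) }
  have hI : I = ⊤ := by
    refine (LieAlgebra.IsSimple.eq_bot_or_eq_top (R := ℂ) I).resolve_left fun h => hv.2 ?_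
    have hvI : v ∈ I := hv.1
    rw [h] at hvI
    simpa using hvI
  refine ⟨c, fun x y => ?_⟩
  have hx : x ∈ I := hI ▸ LieSubmodule.mem_top x
  have hx' : φ x = c • x := Module.End.mem_eigenspace_iff.mp hx
  rw [← hφ, hx', map_smul, LinearMap.smul_apply, smul_eq_mul]

/-- The form is invariant under the automorphisms. -/
theorem form_σ {n : ℕ} {𝔤 : Type*} [LieRing 𝔤] [LieAlgebra ℂ 𝔤]
    [FiniteDimensional ℂ 𝔤] [LieAlgebra.IsSimple ℂ 𝔤] (D : MultiloopDatum n 𝔤)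
    (i : Fin (n + 1)) (x y : 𝔤) : D.form (D.σ i x) (D.σ i y) = D.form x y := by
  obtain ⟨c, hc⟩ := D.exists_form_eq_killing
  rw [hc, hc, LieAlgebra.killingForm_of_equiv_apply]

section Pieces

variable {n : ℕ} {𝔤 : Type*} [LieRing 𝔤] [LieAlgebra ℂ 𝔤] (D : MultiloopDatum n 𝔤)

/-- The simultaneous eigenspace `𝔤(k̄₀, k̄)`, for `(k₀, k) ∈ ℤ × ℤⁿ`. -/
def piece (a : ℤ × (Fin n → ℤ)) : Submodule ℂ 𝔤 where
  carrier := {x | D.σ 0 x = D.ξ 0 ^ a.1 • x ∧ ∀ i : Fin n, D.σ i.succ x = D.ξ i.succ ^ a.2 i • x}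
  zero_mem' := by simp
  add_mem' := by
    rintro x y ⟨h0, h⟩ ⟨h0', h'⟩
    exact ⟨by rw [map_add, h0, h0', smul_add], fun i => by rw [map_add, h, h', smul_add]⟩
  smul_mem' := by
    rintro c x ⟨h0, h⟩
    exact ⟨by rw [map_smul, h0, smul_comm], fun i => by rw [map_smul, h, smul_comm]⟩

theorem ξ_ne_zero (i : Fin (n + 1)) : D.ξ i ≠ 0 := (D.ξ_primitive i).ne_zero (D.m_pos i).ne'

theorem lie_mem_piece {a b : ℤ × (Fin n → ℤ)} {x y : 𝔤} (hx : x ∈ D.piece a)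
    (hy : y ∈ D.piece b) : ⁅x, y⁆ ∈ D.piece (a + b) := by
  refine ⟨?_, fun i => ?_⟩
  · rw [LieEquiv.map_lie, hx.1, hy.1, smul_lie, lie_smul, smul_smul, Prod.fst_add,
      zpow_add₀ (D.ξ_ne_zero 0)]
  · rw [LieEquiv.map_lie, hx.2 i, hy.2 i, smul_lie, lie_smul, smul_smul, Prod.snd_add,
      Pi.add_apply, zpow_add₀ (D.ξ_ne_zero i.succ)]

/-- The fixed subalgebra `𝔤(0̄, 0̄)`. -/
def gZero : LieSubalgebra ℂ 𝔤 where
  __ := D.piece 0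
  lie_mem' := fun {x y} hx hy => by
    have h := D.lie_mem_piece hx hy
    rwa [add_zero] at h

/-- The lattice `Γ = m₁ℤ ⊕ ⋯ ⊕ mₙℤ`. -/
def Γ : AddSubgroup (Fin n → ℤ) where
  carrier := {k | ∀ i : Fin n, (D.m i.succ : ℤ) ∣ k i}
  zero_mem' := fun _ => dvd_zero _
  add_mem' := fun h h' i => dvd_add (h i) (h' i)
  neg_mem' := fun h i => (dvd_neg).mpr (h i)

/-- The ring `A(m) = ℂ[t₁^{±m₁}, …, tₙ^{±mₙ}]` inside `Aₙ = ℂ[t₁^{±1}, …, tₙ^{±1}]`, the latter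
being the group algebra of `ℤⁿ`. -/
def Am : Subalgebra ℂ (AddMonoidAlgebra ℂ (Fin n → ℤ)) where
  carrier := {p | ∀ k, p.coeff k ≠ 0 → k ∈ D.Γ}
  add_mem' := by
    intro p q hp hq k hk
    by_contra hkΓ
    refine hk ?_
    have h1 : p.coeff k = 0 := by_contra fun h => hkΓ (hp k h)
    have h2 : q.coeff k = 0 := by_contra fun h => hkΓ (hq k h)
    simp [h1, h2]
  mul_mem' := by
    classical
    intro p q hp hq k hk
    have hk' := AddMonoidAlgebra.support_coeff_mul_subset p q (Finsupp.mem_support_iff.mpr hk)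
    obtain ⟨a, ha, b, hb, rfl⟩ := Finset.mem_add.mp hk'
    exact add_mem (hp a (Finsupp.mem_support_iff.mp ha)) (hq b (Finsupp.mem_support_iff.mp hb))
  algebraMap_mem' := by
    classical
    intro r k hk
    by_contra hkΓ
    refine hk ?_
    have h0 : k ≠ 0 := fun h => hkΓ (h ▸ D.Γ.zero_mem)
    simp [AddMonoidAlgebra.coe_algebraMap, h0.symm]

theorem add_mem_Γ_of_form_ne_zero [FiniteDimensional ℂ 𝔤] [LieAlgebra.IsSimple ℂ 𝔤]
    {a b : ℤ × (Fin n → ℤ)} {x y : 𝔤} (hx : x ∈ D.piece a)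
    (hy : y ∈ D.piece b) (h : D.form x y ≠ 0) : a.2 + b.2 ∈ D.Γ := by
  intro i
  have h1 := D.form_σ i.succ x y
  rw [hx.2 i, hy.2 i, map_smul, map_smul, LinearMap.smul_apply, smul_smul, smul_eq_mul,
    ← zpow_add₀ (D.ξ_ne_zero i.succ)] at h1
  have h2 : D.ξ i.succ ^ (b.2 i + a.2 i) = 1 := mul_right_cancel₀ h (by rw [h1, one_mul])
  have h3 := ((D.ξ_primitive i.succ).zpow_eq_one_iff_dvd _).mp h2
  rwa [add_comm] at h3

end Pieces

/-! ## The Lie algebra `𝔏` -/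

section Algebra

variable {n : ℕ} {𝔤 : Type*} [LieRing 𝔤] [LieAlgebra ℂ 𝔤]

/-- The bracket of `𝔤 ⊗ A`, elements being finitely supported families of coefficients:
`[X(k₀,k), Y(l₀,l)] = [X,Y](k₀+l₀, k+l)`, where `X(k₀,k)` is `Finsupp.single (k₀,k) X`. -/
noncomputable def loopBracket (n : ℕ) (𝔤 : Type*) [LieRing 𝔤] [LieAlgebra ℂ 𝔤] :
    ((ℤ × (Fin n → ℤ)) →₀ 𝔤) →ₗ[ℂ] ((ℤ × (Fin n → ℤ)) →₀ 𝔤) →ₗ[ℂ]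
      ((ℤ × (Fin n → ℤ)) →₀ 𝔤) :=
  LinearMap.mk₂ ℂ
    (fun f g => f.sum fun a x => g.sum fun b y => Finsupp.single (a + b) ⁅x, y⁆)
    (by
      intro f f' g
      refine Finsupp.sum_add_index' (by simp) fun a x x' => ?_
      simp [Finsupp.sum, ← Finset.sum_add_distrib])
    (by
      intro c f g
      rw [Finsupp.sum_smul_index' (by simp)]
      simp [Finsupp.sum, Finset.smul_sum])
    (by
      intro f g g'
      rw [← Finsupp.sum_add]
      refine Finsupp.sum_congr fun a _ => ?_
      exact Finsupp.sum_add_index' (by simp) fun b y y' => by simp)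
    (by
      intro c f g
      rw [Finsupp.smul_sum]
      refine Finsupp.sum_congr fun a _ => ?_
      rw [Finsupp.sum_smul_index' (by simp), Finsupp.smul_sum]
      simp)

/-- The derivation `d₀` of `𝔤 ⊗ A`: `d₀ X(k₀,k) = k₀ X(k₀,k)`. -/
noncomputable def deg (n : ℕ) (𝔤 : Type*) [LieRing 𝔤] [LieAlgebra ℂ 𝔤] :
    ((ℤ × (Fin n → ℤ)) →₀ 𝔤) →ₗ[ℂ] ((ℤ × (Fin n → ℤ)) →₀ 𝔤) :=
  Finsupp.lsum ℂ fun a => (a.1 : ℂ) • Finsupp.lsingle a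

variable (D : MultiloopDatum n 𝔤)

/-- The central term: `X(k₀,k), Y(l₀,l) ↦ k₀ (X,Y) δ_{k₀+l₀,0} t^{k+l} ∈ Aₙ`. -/
noncomputable def cocycle :
    ((ℤ × (Fin n → ℤ)) →₀ 𝔤) →ₗ[ℂ] ((ℤ × (Fin n → ℤ)) →₀ 𝔤) →ₗ[ℂ]
      AddMonoidAlgebra ℂ (Fin n → ℤ) :=
  LinearMap.mk₂ ℂ
    (fun f g => f.sum fun a x => g.sum fun b y =>
      if a.1 + b.1 = 0 then AddMonoidAlgebra.single (a.2 + b.2) ((a.1 : ℂ) * D.form x y) else 0)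
    (by
      intro f f' g
      refine Finsupp.sum_add_index' (by simp) fun a x x' => ?_
      simp only [Finsupp.sum, ← Finset.sum_add_distrib]
      refine Finset.sum_congr rfl fun b _ => ?_
      split_ifs <;> simp [mul_add])
    (by
      intro c f g
      rw [Finsupp.sum_smul_index' (by simp)]
      simp only [Finsupp.sum, Finset.smul_sum]
      refine Finset.sum_congr rfl fun a _ => Finset.sum_congr rfl fun b _ => ?_
      split_ifs <;> simp [mul_left_comm])
    (by
      intro f g g'
      rw [← Finsupp.sum_add]
      refine Finsupp.sum_congr fun a _ => ?_
      refine Finsupp.sum_add_index' (by simp) fun b y y' => ?_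
      split_ifs <;> simp [mul_add])
    (by
      intro c f g
      rw [Finsupp.smul_sum]
      refine Finsupp.sum_congr fun a _ => ?_
      rw [Finsupp.sum_smul_index' (by simp), Finsupp.smul_sum]
      refine Finsupp.sum_congr fun b _ => ?_
      split_ifs <;> simp [mul_left_comm])

@[simp] theorem loopBracket_single (a b : ℤ × (Fin n → ℤ)) (x y : 𝔤) :
    loopBracket n 𝔤 (Finsupp.single a x) (Finsupp.single b y) =
      Finsupp.single (a + b) ⁅x, y⁆ := by
  simp [loopBracket]

@[simp] theorem deg_single (a : ℤ × (Fin n → ℤ)) (x : 𝔤) :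
    deg n 𝔤 (Finsupp.single a x) = (a.1 : ℂ) • Finsupp.single a x := by
  simp [deg]

@[simp] theorem cocycle_single (a b : ℤ × (Fin n → ℤ)) (x y : 𝔤) :
    D.cocycle (Finsupp.single a x) (Finsupp.single b y) =
      if a.1 + b.1 = 0 then AddMonoidAlgebra.single (a.2 + b.2) ((a.1 : ℂ) * D.form x y)
      else 0 := by
  simp [cocycle]

theorem loopBracket_skew (f g : (ℤ × (Fin n → ℤ)) →₀ 𝔤) :
    loopBracket n 𝔤 f g = -loopBracket n 𝔤 g f := by
  induction f using Finsupp.induction_linear with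
  | zero => simp
  | add f f' hf hf' => simp [hf, hf', add_comm]
  | single a x =>
    induction g using Finsupp.induction_linear with
    | zero => simp
    | add g g' hg hg' => simp [hg, hg', add_comm]
    | single b y =>
      rw [loopBracket_single, loopBracket_single, ← lie_skew x y, add_comm a b,
        Finsupp.single_neg]

theorem cocycle_skew (f g : (ℤ × (Fin n → ℤ)) →₀ 𝔤) :
    D.cocycle f g = -D.cocycle g f := by
  induction f using Finsupp.induction_linear with
  | zero => simp
  | add f f' hf hf' => simp [hf, hf', add_comm]
  | single a x =>
    induction g using Finsupp.induction_linear with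
    | zero => simp
    | add g g' hg hg' => simp [hg, hg', add_comm]
    | single b y =>
      rw [cocycle_single, cocycle_single, add_comm b.1 a.1, add_comm b.2 a.2, D.form_symm y x]
      split_ifs with h
      · have : (b.1 : ℂ) = -(a.1 : ℂ) := by
          have h' : b.1 = -a.1 := by omega
          rw [h']; push_cast; ring
        rw [this, neg_mul, AddMonoidAlgebra.single_neg, neg_neg]
      · simp

theorem loopBracket_leibniz (f g h : (ℤ × (Fin n → ℤ)) →₀ 𝔤) :
    loopBracket n 𝔤 f (loopBracket n 𝔤 g h) =
      loopBracket n 𝔤 (loopBracket n 𝔤 f g) h + loopBracket n 𝔤 g (loopBracket n 𝔤 f h) := by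
  induction f using Finsupp.induction_linear with
  | zero => simp
  | add f f' hf hf' => simp only [map_add, LinearMap.add_apply, hf, hf']; abel
  | single a x =>
    induction g using Finsupp.induction_linear with
    | zero => simp
    | add g g' hg hg' => simp only [map_add, LinearMap.add_apply, hg, hg']; abel
    | single b y =>
      induction h using Finsupp.induction_linear with
      | zero => simp
      | add h h' hh hh' => simp only [map_add, hh, hh']; abel
      | single c z =>
        simp only [loopBracket_single]
        rw [leibniz_lie, Finsupp.single_add, add_assoc, add_left_comm b a c]

theorem cocycle_leibniz (f g h : (ℤ × (Fin n → ℤ)) →₀ 𝔤) :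
    D.cocycle f (loopBracket n 𝔤 g h) =
      D.cocycle (loopBracket n 𝔤 f g) h + D.cocycle g (loopBracket n 𝔤 f h) := by
  induction f using Finsupp.induction_linear with
  | zero => simp
  | add f f' hf hf' => simp only [map_add, LinearMap.add_apply, hf, hf']; abel
  | single a x =>
    induction g using Finsupp.induction_linear with
    | zero => simp
    | add g g' hg hg' => simp only [map_add, LinearMap.add_apply, hg, hg']; abel
    | single b y =>
      induction h using Finsupp.induction_linear with
      | zero => simp
      | add h h' hh hh' => simp only [map_add, hh, hh']; abel
      | single c z =>
        simp only [loopBracket_single, cocycle_single, Prod.fst_add, Prod.snd_add]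
        rw [← add_assoc a.1, ← add_assoc a.2, add_left_comm b.1 a.1 c.1, ← add_assoc a.1 b.1,
          add_left_comm b.2 a.2 c.2, ← add_assoc a.2 b.2]
        split_ifs with hs
        · rw [← AddMonoidAlgebra.single_add]
          congr 1
          have e1 : D.form x ⁅y, z⁆ = D.form ⁅x, y⁆ z := (D.form_invariant x y z).symm
          have e2 : D.form y ⁅x, z⁆ = -D.form ⁅x, y⁆ z := by
            rw [← D.form_invariant, ← lie_skew y x, map_neg, LinearMap.neg_apply]
          rw [e1, e2]
          push_cast
          ring
        · simp

theorem deg_loopBracket (f g : (ℤ × (Fin n → ℤ)) →₀ 𝔤) :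
    deg n 𝔤 (loopBracket n 𝔤 f g) =
      loopBracket n 𝔤 (deg n 𝔤 f) g + loopBracket n 𝔤 f (deg n 𝔤 g) := by
  induction f using Finsupp.induction_linear with
  | zero => simp
  | add f f' hf hf' => simp only [map_add, LinearMap.add_apply, hf, hf']; abel
  | single a x =>
    induction g using Finsupp.induction_linear with
    | zero => simp
    | add g g' hg hg' => simp only [map_add, hg, hg']; abel
    | single b y =>
      simp only [loopBracket_single, deg_single, map_smul, LinearMap.smul_apply, ← add_smul]
      simp

theorem cocycle_deg (f g : (ℤ × (Fin n → ℤ)) →₀ 𝔤) :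
    D.cocycle (deg n 𝔤 f) g + D.cocycle f (deg n 𝔤 g) = 0 := by
  induction f using Finsupp.induction_linear with
  | zero => simp
  | add f f' hf hf' =>
    simp only [map_add, LinearMap.add_apply]
    rw [add_add_add_comm, hf, hf', add_zero]
  | single a x =>
    induction g using Finsupp.induction_linear with
    | zero => simp
    | add g g' hg hg' =>
      simp only [map_add]
      rw [add_add_add_comm, hg, hg', add_zero]
    | single b y =>
      simp only [cocycle_single, deg_single, map_smul, LinearMap.smul_apply, ← add_smul]
      split_ifs with h
      · have : (a.1 : ℂ) + (b.1 : ℂ) = 0 := by exact_mod_cast h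
        rw [this, zero_smul]
      · simp

/-- The space `𝔤 ⊗ A ⊕ K ⊗ Aₙ ⊕ ℂ d₀`. -/
@[ext] structure Ambient (D : MultiloopDatum n 𝔤) where
  /-- the component in `𝔤 ⊗ A` -/
  loop : (ℤ × (Fin n → ℤ)) →₀ 𝔤
  /-- the component in `K ⊗ Aₙ` -/
  cent : AddMonoidAlgebra ℂ (Fin n → ℤ)
  /-- the coefficient of `d₀` -/
  der : ℂ

/-- An element of the ambient space is a triple. -/
def Ambient.toProd : D.Ambient ≃
    ((ℤ × (Fin n → ℤ)) →₀ 𝔤) × AddMonoidAlgebra ℂ (Fin n → ℤ) × ℂ where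
  toFun x := (x.loop, x.cent, x.der)
  invFun y := ⟨y.1, y.2.1, y.2.2⟩
  left_inv _ := rfl
  right_inv _ := rfl

noncomputable instance : AddCommGroup D.Ambient := (Ambient.toProd D).addCommGroup

noncomputable instance : Module ℂ D.Ambient := (Ambient.toProd D).module ℂ

@[simp] theorem Ambient.loop_zero : (0 : D.Ambient).loop = 0 := rfl
@[simp] theorem Ambient.cent_zero : (0 : D.Ambient).cent = 0 := rfl
@[simp] theorem Ambient.der_zero : (0 : D.Ambient).der = 0 := rfl
@[simp] theorem Ambient.loop_add (x y : D.Ambient) : (x + y).loop = x.loop + y.loop := rfl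
@[simp] theorem Ambient.cent_add (x y : D.Ambient) : (x + y).cent = x.cent + y.cent := rfl
@[simp] theorem Ambient.der_add (x y : D.Ambient) : (x + y).der = x.der + y.der := rfl
@[simp] theorem Ambient.loop_smul (c : ℂ) (x : D.Ambient) : (c • x).loop = c • x.loop := rfl
@[simp] theorem Ambient.cent_smul (c : ℂ) (x : D.Ambient) : (c • x).cent = c • x.cent := rfl
@[simp] theorem Ambient.der_smul (c : ℂ) (x : D.Ambient) : (c • x).der = c • x.der := rfl

/-- The bracket on `𝔤 ⊗ A ⊕ K ⊗ Aₙ ⊕ ℂ d₀`: `K ⊗ Aₙ` is central, `d₀` acts on `𝔤 ⊗ A` by `deg`,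
and two elements of `𝔤 ⊗ A` are multiplied by `loopBracket`, with the central term `cocycle`. -/
noncomputable instance : Bracket D.Ambient D.Ambient where
  bracket x y :=
    { loop := loopBracket n 𝔤 x.loop y.loop + x.der • deg n 𝔤 y.loop - y.der • deg n 𝔤 x.loop
      cent := D.cocycle x.loop y.loop
      der := 0 }

@[simp] theorem Ambient.loop_lie (x y : D.Ambient) : ⁅x, y⁆.loop =
    loopBracket n 𝔤 x.loop y.loop + x.der • deg n 𝔤 y.loop - y.der • deg n 𝔤 x.loop := rfl
@[simp] theorem Ambient.cent_lie (x y : D.Ambient) :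
    ⁅x, y⁆.cent = D.cocycle x.loop y.loop := rfl
@[simp] theorem Ambient.der_lie (x y : D.Ambient) : ⁅x, y⁆.der = 0 := rfl

noncomputable instance : LieRing D.Ambient where
  add_lie x y z := by
    ext1
    · simp only [Ambient.loop_lie, Ambient.loop_add, Ambient.der_add, map_add,
        LinearMap.add_apply, add_smul, smul_add]
      abel
    · simp
    · simp
  lie_add x y z := by
    ext1
    · simp only [Ambient.loop_lie, Ambient.loop_add, Ambient.der_add, map_add, add_smul, smul_add]
      abel
    · simp
    · simp
  lie_self x := by
    ext1
    · have h := loopBracket_skew x.loop x.loop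
      have h2 : (2 : ℂ) • loopBracket n 𝔤 x.loop x.loop = 0 := by
        rw [two_smul]
        nth_rewrite 1 [h]
        exact neg_add_cancel _
      simp [(smul_eq_zero.mp h2).resolve_left two_ne_zero]
    · have h := D.cocycle_skew x.loop x.loop
      rw [Ambient.cent_lie, Ambient.cent_zero]
      have h2 : (2 : ℂ) • D.cocycle x.loop x.loop = 0 := by
        rw [two_smul]
        nth_rewrite 1 [h]
        exact neg_add_cancel _
      exact (smul_eq_zero.mp h2).resolve_left two_ne_zero
    · simp
  leibniz_lie x y z := by
    ext1
    · simp only [Ambient.loop_lie, Ambient.loop_add, Ambient.der_lie, map_add, map_sub, map_smul,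
        LinearMap.add_apply, LinearMap.sub_apply, LinearMap.smul_apply, smul_add, smul_sub,
        zero_smul, loopBracket_leibniz x.loop y.loop z.loop, deg_loopBracket]
      rw [loopBracket_skew y.loop (deg n 𝔤 x.loop), smul_comm x.der y.der,
        smul_comm x.der z.der, smul_comm y.der z.der]
      simp only [smul_neg]
      abel
    · simp only [Ambient.cent_lie, Ambient.cent_add, Ambient.loop_lie, map_add, map_sub, map_smul,
        LinearMap.add_apply, LinearMap.sub_apply, LinearMap.smul_apply,
        D.cocycle_leibniz x.loop y.loop z.loop]
      have h1 : D.cocycle x.loop (deg n 𝔤 z.loop) = -D.cocycle (deg n 𝔤 x.loop) z.loop :=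
        eq_neg_of_add_eq_zero_right (D.cocycle_deg x.loop z.loop)
      have h2 : D.cocycle y.loop (deg n 𝔤 z.loop) = -D.cocycle (deg n 𝔤 y.loop) z.loop :=
        eq_neg_of_add_eq_zero_right (D.cocycle_deg y.loop z.loop)
      have h3 : D.cocycle y.loop (deg n 𝔤 x.loop) = D.cocycle x.loop (deg n 𝔤 y.loop) := by
        rw [D.cocycle_skew y.loop, eq_neg_of_add_eq_zero_left (D.cocycle_deg x.loop y.loop),
          neg_neg]
      rw [h1, h2, h3]
      simp only [smul_neg]
      abel
    · simp

noncomputable instance : LieAlgebra ℂ D.Ambient where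
  lie_smul c x y := by
    ext1
    · simp only [Ambient.loop_lie, Ambient.loop_smul, Ambient.der_smul, map_smul, smul_eq_mul,
        smul_add, smul_sub, smul_smul, mul_comm x.der c]
    · simp
    · simp

theorem loopBracket_mem {f g : (ℤ × (Fin n → ℤ)) →₀ 𝔤} (hf : ∀ a, f a ∈ D.piece a)
    (hg : ∀ a, g a ∈ D.piece a) (c : ℤ × (Fin n → ℤ)) :
    loopBracket n 𝔤 f g c ∈ D.piece c := by
  classical
  simp only [loopBracket, LinearMap.mk₂_apply, Finsupp.sum, Finsupp.finsetSum_apply]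
  refine Submodule.sum_mem _ fun a _ => Submodule.sum_mem _ fun b _ => ?_
  rw [Finsupp.single_apply]
  split_ifs with h
  · exact h ▸ D.lie_mem_piece (hf a) (hg b)
  · exact zero_mem _

theorem deg_apply (f : (ℤ × (Fin n → ℤ)) →₀ 𝔤) (a : ℤ × (Fin n → ℤ)) :
    deg n 𝔤 f a = (a.1 : ℂ) • f a := by
  classical
  induction f using Finsupp.induction_linear with
  | zero => simp
  | add f g hf hg => simp [hf, hg]
  | single b x =>
    rw [deg_single, Finsupp.smul_apply, Finsupp.single_apply]
    split_ifs with h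
    · rw [h]
    · simp

variable [FiniteDimensional ℂ 𝔤] [LieAlgebra.IsSimple ℂ 𝔤]

theorem cocycle_mem {f g : (ℤ × (Fin n → ℤ)) →₀ 𝔤} (hf : ∀ a, f a ∈ D.piece a)
    (hg : ∀ a, g a ∈ D.piece a) : D.cocycle f g ∈ D.Am := by
  classical
  simp only [cocycle, LinearMap.mk₂_apply, Finsupp.sum]
  refine sum_mem fun a _ => sum_mem fun b _ => ?_
  split_ifs with h
  · by_cases h0 : D.form (f a) (g b) = 0
    · rw [h0, mul_zero, AddMonoidAlgebra.single_zero]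
      exact zero_mem _
    · intro k hk
      rw [AddMonoidAlgebra.coeff_single, Finsupp.single_apply] at hk
      split_ifs at hk with hk'
      · exact hk' ▸ D.add_mem_Γ_of_form_ne_zero (hf a) (hg b) h0
      · exact absurd rfl hk
  · exact zero_mem _

/-- The Lie algebra `𝔏 = LT ⊕ K ⊗ A(m) ⊕ ℂ d₀`, where `LT = ⨁ 𝔤(k̄₀,k̄) t₀^{k₀} t^k` is the
multiloop algebra. -/
noncomputable def L : LieSubalgebra ℂ D.Ambient where
  carrier := {x | (∀ a, x.loop a ∈ D.piece a) ∧ x.cent ∈ D.Am}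
  zero_mem' := ⟨fun _ => zero_mem _, zero_mem _⟩
  add_mem' := fun hx hy => ⟨fun a => add_mem (hx.1 a) (hy.1 a), add_mem hx.2 hy.2⟩
  smul_mem' := fun c _ hx =>
    ⟨fun a => Submodule.smul_mem _ c (hx.1 a), Subalgebra.smul_mem _ hx.2 c⟩
  lie_mem' := fun {x y} hx hy => by
    refine ⟨fun a => ?_, D.cocycle_mem hx.1 hy.1⟩
    rw [Ambient.loop_lie, Finsupp.sub_apply, Finsupp.add_apply, Finsupp.smul_apply,
      Finsupp.smul_apply, deg_apply, deg_apply]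
    exact sub_mem (add_mem (D.loopBracket_mem hx.1 hy.1 a)
      (Submodule.smul_mem _ _ (Submodule.smul_mem _ _ (hy.1 a))))
      (Submodule.smul_mem _ _ (Submodule.smul_mem _ _ (hx.1 a)))

end Algebra

/-! ## Root data of `𝔤(0̄,0̄)` and Lie tori -/

section LieTorus

open LieAlgebra.IsKilling

variable {n : ℕ} {𝔤 : Type*} [LieRing 𝔤] [LieAlgebra ℂ 𝔤] [FiniteDimensional ℂ 𝔤]
  (D : MultiloopDatum n 𝔤) [LieAlgebra.IsSimple ℂ D.gZero]
  (H : LieSubalgebra ℂ D.gZero) [H.IsCartanSubalgebra] (b : (rootSystem H).Base)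

/-- The monoid `⨁ ℕ αᵢ` generated by the simple roots. -/
def posCone : AddSubmonoid (Module.Dual ℂ H) :=
  AddSubmonoid.closure ((rootSystem H).root '' b.support)

/-- `i` is a short root: its length is minimal among all roots. (So all roots are short in the
simply laced case.) -/
noncomputable def IsShort (i : H.root) : Prop :=
  ∀ j, ((rootSystem H).posRootForm ℤ).rootLength i ≤ ((rootSystem H).posRootForm ℤ).rootLength j

/-- `i` is the highest root. -/
def IsHighestRoot (i : H.root) : Prop :=
  ∀ j, (rootSystem H).root i - (rootSystem H).root j ∈ D.posCone H b

/-- `i` is the highest short root. -/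
def IsHighestShortRoot (i : H.root) : Prop :=
  D.IsShort H i ∧
    ∀ j, D.IsShort H j → (rootSystem H).root i - (rootSystem H).root j ∈ D.posCone H b

/-- The root system of `𝔤(0̄,0̄)` is of type `B_l` for some `l` (type `B₁` being `A₁`). -/
def IsTypeB : Prop :=
  ∃ (l : ℕ) (e : Fin l ≃ b.support), ∀ i j, b.cartanMatrix (e i) (e j) = CartanMatrix.B l i j

/-- `μ` is a highest weight of the `𝔤(0̄,0̄)`-submodule `V` of `𝔤`: there is a non-zero vector of
weight `μ` in `V` that is killed by all positive root spaces of `𝔤(0̄,0̄)`. -/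
def IsHighestWeight (V : LieSubmodule ℂ D.gZero 𝔤) (μ : Module.Dual ℂ H) : Prop :=
  ∃ v ∈ V, v ≠ 0 ∧ (∀ h : H, ⁅(h : D.gZero), v⁆ = μ h • v) ∧
    ∀ i : H.root, (rootSystem H).root i ∈ D.posCone H b →
      ∀ x ∈ LieAlgebra.rootSpace H ((rootSystem H).root i), ⁅x, v⁆ = 0

/-- Property `(M)` for an irreducible `𝔤(0̄,0̄)`-submodule `V` of `𝔤`: its highest weight is the
highest root, or the highest short root if not all roots have the same length, or twice the
highest short root in type `B_l`. -/
def PropertyM (V : LieSubmodule ℂ D.gZero 𝔤) : Prop :=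
  LieModule.IsIrreducible ℂ D.gZero V ∧
    ((∃ i, D.IsHighestRoot H b i ∧ D.IsHighestWeight H b V ((rootSystem H).root i)) ∨
      ((∃ j, ¬ D.IsShort H j) ∧
        ∃ i, D.IsHighestShortRoot H b i ∧ D.IsHighestWeight H b V ((rootSystem H).root i)) ∨
      (D.IsTypeB H b ∧
        ∃ i, D.IsHighestShortRoot H b i ∧
          D.IsHighestWeight H b V (2 • (rootSystem H).root i)))

/-- The multiloop algebra (with `𝔤(0̄,0̄)` simple) is a centerless Lie torus: each
`𝔤(k̄₀,k̄)` is, as a `𝔤(0̄,0̄)`-module, the direct sum of a trivial module `U` and a module `V`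
which is zero or has property `(M)`. -/
def IsLieTorus : Prop :=
  ∀ a : ℤ × (Fin n → ℤ), ∃ U V : LieSubmodule ℂ D.gZero 𝔤,
    Disjoint U V ∧ (U ⊔ V).toSubmodule = D.piece a ∧
      LieModule.IsTrivial D.gZero U ∧ (V = ⊥ ∨ D.PropertyM H b V)

end LieTorus

/-! ## Root spaces of `𝔏`, highest weight modules -/

section Modules

open LieAlgebra.IsKilling TensorProduct

variable {n : ℕ} {𝔤 : Type*} [LieRing 𝔤] [LieAlgebra ℂ 𝔤] (D : MultiloopDatum n 𝔤)

/-- `𝔤(k̄₀,k̄,α)`: the vectors of weight `α` with respect to `𝔥(0)` in `𝔤(k̄₀,k̄)`. -/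
def rootPiece (H : LieSubalgebra ℂ D.gZero) (α : Module.Dual ℂ H) (a : ℤ × (Fin n → ℤ)) :
    Submodule ℂ 𝔤 where
  carrier := {x | x ∈ D.piece a ∧ ∀ h : H, ⁅((h : D.gZero) : 𝔤), x⁆ = α h • x}
  zero_mem' := ⟨zero_mem _, by simp⟩
  add_mem' := fun hx hy => ⟨add_mem hx.1 hy.1, fun h => by rw [lie_add, hx.2, hy.2, smul_add]⟩
  smul_mem' := fun c _ hx =>
    ⟨Submodule.smul_mem _ c hx.1, fun h => by rw [lie_smul, hx.2, smul_comm]⟩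

variable [FiniteDimensional ℂ 𝔤] [LieAlgebra.IsSimple ℂ 𝔤]

/-- The root space `𝔏_{α + k₀δ}`: it is `⨁_k 𝔤(k̄₀,k̄,α) t₀^{k₀} t^k`, to which `K ⊗ A(m) ⊕ ℂ d₀`
is added when `α + k₀δ = 0`. -/
def rootSpaceL (H : LieSubalgebra ℂ D.gZero) (α : Module.Dual ℂ H) (k₀ : ℤ) :
    Submodule ℂ D.L where
  carrier := {x | (∀ a, (x : D.Ambient).loop a ∈ D.rootPiece H α a) ∧
    (∀ a, a.1 ≠ k₀ → (x : D.Ambient).loop a = 0) ∧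
    (α ≠ 0 ∨ k₀ ≠ 0 → (x : D.Ambient).cent = 0 ∧ (x : D.Ambient).der = 0)}
  zero_mem' := ⟨fun _ => zero_mem _, fun _ _ => rfl, fun _ => ⟨rfl, rfl⟩⟩
  add_mem' := by
    rintro x y ⟨h1, h2, h3⟩ ⟨h1', h2', h3'⟩
    refine ⟨fun a => add_mem (h1 a) (h1' a), fun a ha => ?_, fun h => ⟨?_, ?_⟩⟩
    · simp [h2 a ha, h2' a ha]
    · simp [(h3 h).1, (h3' h).1]
    · simp [(h3 h).2, (h3' h).2]
  smul_mem' := by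
    rintro c x ⟨h1, h2, h3⟩
    refine ⟨fun a => Submodule.smul_mem _ c (h1 a), fun a ha => ?_, fun h => ⟨?_, ?_⟩⟩
    · simp [h2 a ha]
    · simp [(h3 h).1]
    · simp [(h3 h).2]

/-- The subalgebra `𝔏⁰ = 𝔏_0`. -/
def L0 (H : LieSubalgebra ℂ D.gZero) : LieSubalgebra ℂ D.L where
  __ := D.rootSpaceL H 0 0
  lie_mem' := by
    classical
    rintro x y ⟨h1, h2, _⟩ ⟨h1', h2', _⟩
    have hdeg : ∀ z : D.L, (∀ a, a.1 ≠ 0 → (z : D.Ambient).loop a = 0) →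
        deg n 𝔤 (z : D.Ambient).loop = 0 := by
      intro z hz
      ext a
      rw [deg_apply]
      by_cases ha : a.1 = 0
      · simp [ha]
      · simp [hz a ha]
    have hloop : ((⁅x, y⁆ : D.L) : D.Ambient).loop =
        loopBracket n 𝔤 (x : D.Ambient).loop (y : D.Ambient).loop := by
      rw [LieSubalgebra.coe_bracket, Ambient.loop_lie, hdeg x h2, hdeg y h2']
      simp
    have hval : ∀ c, ((⁅x, y⁆ : D.L) : D.Ambient).loop c =
        ∑ a ∈ (x : D.Ambient).loop.support, ∑ b ∈ (y : D.Ambient).loop.support,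
          Finsupp.single (a + b) ⁅(x : D.Ambient).loop a, (y : D.Ambient).loop b⁆ c := by
      intro c
      rw [hloop]
      simp only [loopBracket, LinearMap.mk₂_apply, Finsupp.sum, Finsupp.finsetSum_apply]
    refine ⟨fun c => ?_, fun c hc => ?_, fun h => by simp at h⟩
    · refine ⟨(⁅x, y⁆ : D.L).2.1 c, fun h => ?_⟩
      rw [hval, lie_sum, LinearMap.zero_apply, zero_smul]
      refine Finset.sum_eq_zero fun a _ => ?_
      rw [lie_sum]
      refine Finset.sum_eq_zero fun b _ => ?_
      rw [Finsupp.single_apply]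
      split_ifs
      · rw [leibniz_lie, (h1 a).2 h, (h1' b).2 h]
        simp
      · simp
    · rw [hval]
      refine Finset.sum_eq_zero fun a _ => Finset.sum_eq_zero fun b _ => ?_
      rw [Finsupp.single_apply]
      split_ifs with hab
      · have hne : a.1 ≠ 0 ∨ b.1 ≠ 0 := by
          by_contra! h0
          refine hc ?_
          rw [← hab, Prod.fst_add, h0.1, h0.2, add_zero]
        rcases hne with h0 | h0
        · rw [h2 a h0, zero_lie]
        · rw [h2' b h0, lie_zero]
      · rfl

/-- `𝔥̃(0) = 𝔥(0) ⊕ ℂ K ⊕ ℂ d₀`. -/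
def hTilde (H : LieSubalgebra ℂ D.gZero) : Submodule ℂ D.L where
  carrier := {x | (∃ h : H, (x : D.Ambient).loop = Finsupp.single 0 ((h : D.gZero) : 𝔤)) ∧
    ∃ c : ℂ, (x : D.Ambient).cent = AddMonoidAlgebra.single 0 c}
  zero_mem' := ⟨⟨0, by simp⟩, ⟨0, by simp⟩⟩
  add_mem' := by
    rintro x y ⟨⟨h, hh⟩, c, hc⟩ ⟨⟨h', hh'⟩, c', hc'⟩
    exact ⟨⟨h + h', by simp [hh, hh']⟩, c + c', by simp [hc, hc']⟩
  smul_mem' := by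
    rintro r x ⟨⟨h, hh⟩, c, hc⟩
    exact ⟨⟨r • h, by simp [hh]⟩, r * c, by simp [hc]⟩

/-- `X ⊗ t₀^{k₀} t^k p`, for `a = (k₀, k)` and `p ∈ Aₙ`. -/
noncomputable def tens (a : ℤ × (Fin n → ℤ)) (X : 𝔤) (p : AddMonoidAlgebra ℂ (Fin n → ℤ)) :
    (ℤ × (Fin n → ℤ)) →₀ 𝔤 :=
  p.coeff.sum fun l c => Finsupp.single (a.1, a.2 + l) (c • X)

/-- `𝔏⁰(I) = ∑_k 𝔤(0̄,k̄,0) t^k I ⊕ K ⊗ I`, for an ideal `I` of `A(m)`. -/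
noncomputable def L0I (H : LieSubalgebra ℂ D.gZero) (I : Ideal D.Am) : Submodule ℂ D.L :=
  Submodule.span ℂ
    ({x | ∃ k : Fin n → ℤ, ∃ X ∈ D.rootPiece H 0 (0, k), ∃ p ∈ I,
        (x : D.Ambient) = ⟨tens (0, k) X (p : AddMonoidAlgebra ℂ (Fin n → ℤ)), 0, 0⟩} ∪
      {x | ∃ p ∈ I, (x : D.Ambient) = ⟨0, (p : AddMonoidAlgebra ℂ (Fin n → ℤ)), 0⟩})

variable [LieAlgebra.IsSimple ℂ D.gZero]
  (H : LieSubalgebra ℂ D.gZero) [H.IsCartanSubalgebra] (b : (rootSystem H).Base)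

/-- `𝔏⁺`, the sum of the root spaces `𝔏_{α + k₀δ}` with `k₀ > 0`, or `k₀ = 0` and `α > 0`. -/
noncomputable def Lplus : Submodule ℂ D.L :=
  ⨆ (α : Module.Dual ℂ H) (k₀ : ℤ) (_ : 0 < k₀ ∨ k₀ = 0 ∧ α ≠ 0 ∧ α ∈ D.posCone H b),
    D.rootSpaceL H α k₀

variable (N : Type*) [AddCommGroup N] [Module ℂ N] [LieRingModule (D.L0 H) N]

/-- The relations `u x ⊗ v = u ⊗ x v` for `x ∈ 𝔏⁺ ⊕ 𝔏⁰`, where `𝔏⁺` acts by zero on `N`; they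
present `U(𝔏) ⊗_{U(𝔏⁺ ⊕ 𝔏⁰)} N` as a quotient of `U(𝔏) ⊗_ℂ N`. -/
noncomputable def vermaRel : Submodule (UniversalEnvelopingAlgebra ℂ D.L)
    (UniversalEnvelopingAlgebra ℂ D.L ⊗[ℂ] N) :=
  Submodule.span (UniversalEnvelopingAlgebra ℂ D.L)
    ({z | ∃ (u : UniversalEnvelopingAlgebra ℂ D.L) (x : D.L0 H) (v : N),
        z = (u * UniversalEnvelopingAlgebra.ι ℂ (x : D.L)) ⊗ₜ[ℂ] v - u ⊗ₜ[ℂ] ⁅x, v⁆} ∪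
      {z | ∃ (u : UniversalEnvelopingAlgebra ℂ D.L), ∃ x ∈ D.Lplus H b, ∃ v : N,
        z = (u * UniversalEnvelopingAlgebra.ι ℂ x) ⊗ₜ[ℂ] v})

/-- The Verma module `M(N) = U(𝔏) ⊗_{U(𝔏⁺ ⊕ 𝔏⁰)} N`, as a `U(𝔏)`-module. -/
abbrev Verma : Type _ := (UniversalEnvelopingAlgebra ℂ D.L ⊗[ℂ] N) ⧸ D.vermaRel H b N

/-- The sum of all proper submodules of `M(N)`. -/
noncomputable def vermaRad :
    Submodule (UniversalEnvelopingAlgebra ℂ D.L) (D.Verma H b N) :=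
  sSup {W | W ≠ ⊤}

/-- The irreducible quotient `V(N)` of `M(N)`, the quotient by the sum of all proper
submodules. -/
abbrev V : Type _ := D.Verma H b N ⧸ D.vermaRad H b N

/-- The weight space `V(N)_χ`, for `χ ∈ 𝔥̃(0)^*`. -/
noncomputable def weightSpace (χ : Module.Dual ℂ (D.hTilde H)) : Submodule ℂ (D.V H b N) where
  carrier := {v | ∀ h : D.hTilde H, UniversalEnvelopingAlgebra.ι ℂ (h : D.L) • v = χ h • v}
  zero_mem' := fun h => by rw [smul_zero, smul_zero]
  add_mem' := fun hv hw h => by rw [smul_add, hv h, hw h, smul_add]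
  smul_mem' := fun c v hv h => by rw [smul_algebra_smul_comm, hv h, smul_comm]

end Modules

end MultiloopDatum

set_option linter.unusedSectionVars false

section

open scoped TensorProduct

attribute [local instance] LieRing.ofAssociativeRing

/-! ### Linear algebra -/

/-! Both directions rest on one integer grading of `𝔏`. The weights of an irreducible
`𝔤(0̄,0̄)`-module with property `(M)` are stable under reflections and lie below its highest weight,
and a saturation argument places them among `0`, the roots and the doubled roots. So `𝔤` has only
finitely many weights for `𝔥(0)` (`IsLieTorus.mem_extendedRoots`). Let `h` take the value 1 on all
simple roots and let `B` exceed all `|χ(h)|`. Then `r = h + B d₀` has integral eigenvalues on `𝔏`,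
with `𝔏⁰` and `𝔏⁺` as zero and positive parts (`nonempty_grading`, `Grading.mem_L0_iff`,
`Grading.Lplus_eq`).

By Schur's lemma `r` acts on `N` by a scalar `c`. The map `N → M(N)` is injective, because the
action of the non-negative part on `N` extends to an action of `𝔏` on `U(𝔏⁻) ⊗ N`, where `𝔏⁻` is the
negative part; this action is built by recursion, without the Poincaré–Birkhoff–Witt theorem
(`Induced.exists_extension`). Hence `M(N)` is the direct sum of `N` and of eigenspaces of `r` below
`c`. Proper submodules are exactly those contained in the lower part, so `N` also embeds into `V(N)`
(`Grading.vermaRad_le_low`, `incl_injective`).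

Suppose `𝔏⁰(I)` kills `N`. The ideal `LT ⊗ I ⊕ K ⊗ I` of `𝔏` sends `M(N)` into the lower part, so it
kills `V(N)` (`Grading.idealL_smul_eq_zero`). Modulo this ideal every non-zero degree of `𝔏` is
finite-dimensional, hence the eigenspaces of `r` in `V(N)`, which contain the weight spaces, are
finite-dimensional (`LieHom.finiteDimensional_eigenspace`).

Conversely, let the weight spaces be finite-dimensional. For fixed `β ≠ 0` and fixed degrees, all `Y
t₀^{-k₀} t^l p` with `Y` of weight `β` send `N` into one weight space, whatever `p` is. So the `p`
for which they all kill `N` form a subspace of finite codimension, and this is an ideal since the `h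
⊗ q` with `h ∈ 𝔥(0)` preserve `N` (`killIdeal`). Intersecting over the finitely many `β`, residues
of `l` and `0 < k₀ ≤ 2m₀` gives `J`. Brackets with elements of `𝔏⁺` then kill a loop term plus a
central term; comparing `k₀` with `k₀ + m₀` separates the two
(`tensEl_and_centEl_smul_incl_eq_zero`). As `𝔤` is simple, its vectors of weight zero are sums of
brackets of vectors of opposite non-zero weights (`rootPiece_zero_le_span`), and so `𝔏⁰(J)` kills
`N`. -/

theorem iSupIndep.eq_of_le_of_iSup_eq_top {ι R M : Type*} [Ring R] [AddCommGroup M] [Module R M]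
    {E S : ι → Submodule R M} (hE : iSupIndep E) (hle : ∀ i, S i ≤ E i) (hS : ⨆ i, S i = ⊤)
    (i : ι) : S i = E i := by
  refine le_antisymm (hle i) ?_
  have h1 : S i ⊔ ⨆ (j) (_ : j ≠ i), E j = ⊤ := by
    rw [eq_top_iff, ← hS]
    refine iSup_le fun j => ?_
    by_cases hj : j = i
    · subst hj; exact le_sup_left
    · exact (hle j).trans (le_sup_of_le_right (le_iSup₂_of_le j hj le_rfl))
  -- The modular law, applicable because `S i ≤ E i`.
  calc E i = (S i ⊔ ⨆ (j) (_ : j ≠ i), E j) ⊓ E i := by rw [h1, top_inf_eq]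
    _ = S i ⊔ (⨆ (j) (_ : j ≠ i), E j) ⊓ E i := sup_inf_assoc_of_le _ (hle i)
    _ = S i := by rw [inf_comm, (hE i).eq_bot, sup_bot_eq]
    _ ≤ S i := le_rfl

/-- The spans of the members of `X` in the various `E i` lie in the `E i` and add up to everything,
so the previous lemma applies. This is how single degrees or joint eigenspaces are computed from a
spanning set of homogeneous elements. -/
theorem iSupIndep.eq_span_of_span_eq_top {ι R M : Type*} [Ring R] [AddCommGroup M] [Module R M]
    {E : ι → Submodule R M} (hE : iSupIndep E) {X : Set M} (hX : Submodule.span R X = ⊤)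
    (hXE : ∀ x ∈ X, ∃ i, x ∈ E i) (i : ι) : E i = Submodule.span R {x ∈ X | x ∈ E i} := by
  refine (hE.eq_of_le_of_iSup_eq_top (S := fun i => Submodule.span R {x ∈ X | x ∈ E i})
    (fun i => Submodule.span_le.mpr fun x hx => hx.2) ?_ i).symm
  rw [eq_top_iff, ← hX, Submodule.span_le]
  intro x hx
  obtain ⟨i, hi⟩ := hXE x hx
  exact Submodule.mem_iSup_of_mem i (Submodule.subset_span ⟨hx, hi⟩)

/-- An invariant subspace contains the components of its elements along eigenspaces. -/
theorem Module.End.mem_of_add_mem_of_invariant {K M : Type*} [Field K] [AddCommGroup M]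
    [Module K M] (f : Module.End K M) (W : Submodule K M) (hW : ∀ w ∈ W, f w ∈ W) (c : K) {x y : M}
    (hx : x ∈ f.eigenspace c) (hy : y ∈ ⨆ (e) (_ : e ≠ c), f.eigenspace e) (hxy : x + y ∈ W) :
    x ∈ W := by
  -- A product of factors `X - e`, over eigenvalues `e ≠ c` occurring in `y`, kills `y` and acts on
  -- `x` by a non-zero scalar.
  have hkey : ∃ p : Polynomial K, p.eval c ≠ 0 ∧ Polynomial.aeval f p y = 0 := by
    have hsup : (⨆ (e) (_ : e ≠ c), f.eigenspace e) = ⨆ e : {e // e ≠ c}, f.eigenspace e :=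
      iSup_subtype'
    rw [hsup] at hy
    clear hxy
    induction hy using Submodule.iSup_induction' with
    | mem e v hv =>
      refine ⟨Polynomial.X - Polynomial.C e.1, ?_, ?_⟩
      · simpa [sub_eq_zero] using e.2.symm
      · simp [Module.End.mem_eigenspace_iff.mp hv]
    | zero => exact ⟨1, by simp, by simp⟩
    | add v w _ _ hv hw =>
      obtain ⟨p, hp, hpv⟩ := hv
      obtain ⟨q, hq, hqw⟩ := hw
      refine ⟨p * q, by simp [hp, hq], ?_⟩
      have h1 : Polynomial.aeval f (p * q) v = 0 := by
        rw [mul_comm, map_mul, Module.End.mul_apply, hpv, map_zero]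
      rw [map_add, h1, map_mul, Module.End.mul_apply, hqw, map_zero, add_zero]
  obtain ⟨p, hp, hpy⟩ := hkey
  have hWp : ∀ q : Polynomial K, ∀ w ∈ W, Polynomial.aeval f q w ∈ W := by
    intro q w hw
    induction q using Polynomial.induction_on' with
    | add p q hp hq => rw [map_add]; exact add_mem hp hq
    | monomial n a =>
      rw [Polynomial.aeval_monomial, Module.algebraMap_end_eq_smul_id]
      refine W.smul_mem _ ?_
      change (f ^ n) w ∈ W
      induction n with
      | zero => simpa
      | succ n ih => rw [pow_succ', Module.End.mul_apply]; exact hW _ ih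
  have h1 := hWp p _ hxy
  have h2 : Polynomial.aeval f p x = p.eval c • x := by
    by_cases hx0 : x = 0
    · simp [hx0]
    · exact Module.End.aeval_apply_of_hasEigenvector ⟨hx, hx0⟩
  rw [map_add, hpy, add_zero, h2] at h1
  exact (W.smul_mem_iff hp).mp h1

/-! ### Triangular generation -/

/-- The smallest `A`-stable subspace `T` containing `N` turns out to be `B`-stable too, because `b y
w = y b w + [b, y] w` and `[b, y]` is a sum of an element of `A` and one of `B`. This stands in for
`U(L) = U(A) U(B)`; neither `A` nor `B` has to be a subalgebra. -/
theorem LieHom.eq_top_of_triangular {R L M : Type*} [CommRing R] [LieRing L] [LieAlgebra R L]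
    [AddCommGroup M] [Module R M] (ρ : L →ₗ⁅R⁆ Module.End R M) {A B : Submodule R L}
    (hAB : A ⊔ B = ⊤) {N S : Submodule R M} (hN : ∀ x ∈ B, ∀ v ∈ N, ρ x v ∈ N)
    (hgen : ∀ P : Submodule R M, N ≤ P → (∀ x, ∀ v ∈ P, ρ x v ∈ P) → P = ⊤)
    (hNS : N ≤ S) (hS : ∀ x ∈ A, ∀ v ∈ S, ρ x v ∈ S) : S = ⊤ := by
  let T : Submodule R M := sInf {P | N ≤ P ∧ ∀ x ∈ A, ∀ v ∈ P, ρ x v ∈ P}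
  have hT : ∀ {v}, v ∈ T ↔ ∀ P : Submodule R M, (N ≤ P ∧ ∀ x ∈ A, ∀ v ∈ P, ρ x v ∈ P) → v ∈ P := by
    intro v
    simp only [T, Submodule.mem_sInf, Set.mem_ofPred_eq]
  have hNT : N ≤ T := fun v hv => hT.mpr fun P hP => hP.1 hv
  have hAT : ∀ x ∈ A, ∀ v ∈ T, ρ x v ∈ T := fun x hx v hv =>
    hT.mpr fun P hP => hP.2 x hx v (hT.mp hv P hP)
  -- The vectors of `T` that `B` does not move out of `T`; they contain `N` and are stable under
  -- `A`, hence exhaust `T`.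
  let T' : Submodule R M :=
    { carrier := {v | v ∈ T ∧ ∀ b ∈ B, ρ b v ∈ T}
      zero_mem' := ⟨zero_mem _, fun b _ => by rw [map_zero]; exact zero_mem _⟩
      add_mem' := fun hv hw => ⟨add_mem hv.1 hw.1, fun b hb => by
        rw [map_add]; exact add_mem (hv.2 b hb) (hw.2 b hb)⟩
      smul_mem' := fun c v hv => ⟨T.smul_mem c hv.1, fun b hb => by
        rw [map_smul]; exact T.smul_mem c (hv.2 b hb)⟩ }
  have hT' : ∀ v ∈ T, v ∈ T' := fun v hv => hT.mp hv T'
    ⟨fun w hw => ⟨hNT hw, fun b hb => hNT (hN b hb w hw)⟩, fun y hy w hw => by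
      refine ⟨hAT y hy w hw.1, fun b hb => ?_⟩
      have h1 : ρ b (ρ y w) = ρ y (ρ b w) + ρ ⁅b, y⁆ w := by
        rw [LieHom.map_lie, LieHom.lie_apply]; simp
      have h2 : ⁅b, y⁆ ∈ A ⊔ B := hAB ▸ Submodule.mem_top
      obtain ⟨a, ha, b', hb', h3⟩ := Submodule.mem_sup.mp h2
      rw [h1, ← h3, map_add, LinearMap.add_apply]
      exact add_mem (hAT y hy _ (hw.2 b hb)) (add_mem (hAT a ha _ hw.1) (hw.2 b' hb'))⟩
  have hTtop : T = ⊤ := hgen T hNT fun x v hv => by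
    have h2 : x ∈ A ⊔ B := hAB ▸ Submodule.mem_top
    obtain ⟨a, ha, b', hb', h3⟩ := Submodule.mem_sup.mp h2
    rw [← h3, map_add, LinearMap.add_apply]
    exact add_mem (hAT a ha _ hv) ((hT' v hv).2 b' hb')
  rw [eq_top_iff, ← hTtop]
  exact fun v hv => hT.mp hv S ⟨hNS, hS⟩

/-! ### Universal enveloping algebras -/

namespace UniversalEnvelopingAlgebra

variable {R L : Type*} [CommRing R] [LieRing L] [LieAlgebra R L]

/-- The universal property yields a homomorphism from the enveloping algebra to `T`. Composed with
the inclusion it fixes the image of `L`, so it is the identity. -/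
theorem subalgebra_eq_top (T : Subalgebra R (UniversalEnvelopingAlgebra R L))
    (h : ∀ x, ι R x ∈ T) : T = ⊤ := by
  let f : L →ₗ⁅R⁆ T :=
    { toFun := fun x => ⟨ι R x, h x⟩
      map_add' := fun x y => Subtype.ext (map_add _ _ _)
      map_smul' := fun c x => Subtype.ext (map_smul _ _ _)
      map_lie' := fun {x y} => Subtype.ext (LieHom.map_lie (ι R) x y) }
  have hcomp : T.val.comp (lift R f) = AlgHom.id R _ := by
    ext x
    simp [f]
  rw [eq_top_iff]
  intro u _
  have := congrArg (fun g => g u) hcomp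
  simp only [AlgHom.comp_apply, AlgHom.id_apply] at this
  rw [← this]
  exact (lift R f u).2

/-- The elements that multiply `S` into itself from the left form a subalgebra containing the image
of `L`. -/
theorem submodule_eq_top (S : Submodule R (UniversalEnvelopingAlgebra R L)) (h1 : 1 ∈ S)
    (h : ∀ x, ∀ u ∈ S, ι R x * u ∈ S) : S = ⊤ := by
  let T : Subalgebra R (UniversalEnvelopingAlgebra R L) :=
    { carrier := {u | ∀ v ∈ S, u * v ∈ S}
      mul_mem' := fun {a b} ha hb v hv => by rw [mul_assoc]; exact ha _ (hb v hv)
      add_mem' := fun {a b} ha hb v hv => by rw [add_mul]; exact add_mem (ha v hv) (hb v hv)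
      algebraMap_mem' := fun r v hv => by
        rw [← Algebra.smul_def]; exact S.smul_mem r hv }
  have hT : T = ⊤ := subalgebra_eq_top T fun x v hv => h x v hv
  rw [eq_top_iff]
  intro u _
  have hu : u ∈ T := hT ▸ Algebra.mem_top
  simpa using hu 1 h1

variable {M : Type*} [AddCommGroup M] [Module R M] [Module (UniversalEnvelopingAlgebra R L) M]
  [IsScalarTower R (UniversalEnvelopingAlgebra R L) M]

theorem smul_mem_of_forall_ι_smul_mem (P : Submodule R M) (hP : ∀ x : L, ∀ v ∈ P, ι R x • v ∈ P)
    (u : UniversalEnvelopingAlgebra R L) {v : M} (hv : v ∈ P) : u • v ∈ P := by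
  let S : Submodule R (UniversalEnvelopingAlgebra R L) :=
    { carrier := {u | u • v ∈ P}
      zero_mem' := by simp
      add_mem' := fun ha hb => by
        simp only [Set.mem_ofPred_eq, add_smul] at *; exact add_mem ha hb
      smul_mem' := fun c a ha => by
        simp only [Set.mem_ofPred_eq, smul_assoc] at *; exact P.smul_mem c ha }
  have hS : S = ⊤ := submodule_eq_top S (by simpa [S] using hv) fun x u hu => by
    simp only [S, Submodule.mem_mk, AddSubmonoid.mem_mk, AddSubsemigroup.mem_mk,
      Set.mem_ofPred_eq, mul_smul] at *
    exact hP x _ hu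
  have : u ∈ S := hS ▸ Submodule.mem_top
  exact this

variable (R L M) in
/-- The representation of a Lie algebra on a module over its enveloping algebra. -/
noncomputable def toRep : L →ₗ⁅R⁆ Module.End R M :=
  ((Algebra.lsmul R R M : UniversalEnvelopingAlgebra R L →ₐ[R] Module.End R M) :
    UniversalEnvelopingAlgebra R L →ₗ⁅R⁆ Module.End R M).comp (ι R)

@[simp] theorem toRep_apply (x : L) (v : M) : toRep R L M x v = ι R x • v := rfl

end UniversalEnvelopingAlgebra
end

section

open scoped TensorProduct

attribute [local instance] LieRing.ofAssociativeRing

/-! ### Induced modules -/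

namespace LieAlgebra.Induced

open UniversalEnvelopingAlgebra

variable {R L : Type*} [CommRing R] [LieRing L] [LieAlgebra R L] {A : LieSubalgebra R L}
  (pA : L →ₗ[R] A)

/-- The projection complementary to `pA`. -/
def compl : L →ₗ[R] L := LinearMap.id - A.toSubmodule.subtype ∘ₗ pA

theorem add_compl (x : L) : (pA x : L) + compl pA x = x := by simp [compl]

/-! ### The recursion behind the action on an induced module. -/

section Pairs

variable {M : Type*} [AddCommGroup M] [Module R M] (ρ : A →ₗ⁅R⁆ Module.End R M)

/-- The action on `w` of `x = a + b`, given the vectors `b • w`. -/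
def total : M × (L →ₗ[R] M) →ₗ[R] L →ₗ[R] M where
  toFun p :=
    { toFun := fun x => ρ (pA x) p.1 + p.2 (compl pA x)
      map_add' := fun x y => by simp only [map_add, LinearMap.add_apply]; abel
      map_smul' := fun c x => by simp }
  map_add' p q := by ext x; simp; abel
  map_smul' c p := by ext x; simp

@[simp] theorem total_apply (p : M × (L →ₗ[R] M)) (x : L) :
    total pA ρ p x = ρ (pA x) p.1 + p.2 (compl pA x) := rfl

/-- Left multiplication by `y` on pairs consisting of a vector `w` and the family of the vectors
`x • w`: it turns `x • w` into `x • (y • w) = y • (x • w) - [y, x] • w`. -/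
def actPair (y : A) : Module.End R (M × (L →ₗ[R] M)) where
  toFun p := (ρ y p.1, ρ y ∘ₗ p.2 - total pA ρ p ∘ₗ LieModule.toEnd R L L (y : L))
  map_add' p q := by
    ext x
    · simp
    · simp only [Prod.snd_add, map_add, LinearMap.sub_apply, LinearMap.add_apply,
        LinearMap.comp_apply]
      abel
  map_smul' c p := by
    ext x
    · simp
    · simp only [Prod.smul_snd, map_smul, LinearMap.sub_apply, LinearMap.smul_apply,
        LinearMap.comp_apply, smul_sub, RingHom.id_apply]

theorem actPair_fst (y : A) (p : M × (L →ₗ[R] M)) : (actPair pA ρ y p).1 = ρ y p.1 := rfl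

theorem actPair_snd (y : A) (p : M × (L →ₗ[R] M)) (x : L) :
    (actPair pA ρ y p).2 x = ρ y (p.2 x) - total pA ρ p ⁅(y : L), x⁆ := rfl

theorem map_lie_apply (y z : A) (w : M) : ρ ⁅y, z⁆ w = ρ y (ρ z w) - ρ z (ρ y w) := by
  rw [LieHom.map_lie]; rfl

variable (hA : ∀ y : A, pA y = y)
include hA

theorem compl_coe (y : A) : compl pA y = 0 := by simp [compl, hA]

theorem compl_compl (x : L) : compl pA (compl pA x) = compl pA x := by
  conv_rhs => rw [← add_compl pA x, map_add, compl_coe pA hA, zero_add]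

/-- The rule `x (y w) = y (x w) - [y, x] w`, imposed by `actPair` on the second component of a pair,
persists for the full action of every `x`: on the `A`-component of `x` it is the commutator identity
of `ρ`. -/
theorem total_actPair (y : A) (p : M × (L →ₗ[R] M)) (x : L) :
    total pA ρ (actPair pA ρ y p) x = ρ y (total pA ρ p x) - total pA ρ p ⁅(y : L), x⁆ := by
  have h1 : ⁅(y : L), x⁆ = ((⁅y, pA x⁆ : A) : L) + ⁅(y : L), compl pA x⁆ := by
    conv_lhs => rw [← add_compl pA x, lie_add]
    simp
  have h2 : total pA ρ p ((⁅y, pA x⁆ : A) : L) = ρ y (ρ (pA x) p.1) - ρ (pA x) (ρ y p.1) := by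
    rw [total_apply, hA, compl_coe pA hA, map_zero, add_zero, map_lie_apply]
  rw [h1, map_add, h2, total_apply, actPair_snd, actPair_fst, total_apply pA ρ p x, map_add]
  abel

/-- `actPair` as a representation. -/
def pairRep : A →ₗ⁅R⁆ Module.End R (M × (L →ₗ[R] M)) where
  toFun := actPair pA ρ
  map_add' y z := by
    ext p x <;> simp [actPair_fst, actPair_snd] <;> abel
  map_smul' c y := by
    ext p x <;> simp [actPair_fst, actPair_snd, smul_sub]
  map_lie' {y z} := by
    refine LinearMap.ext fun p => Prod.ext ?_ (LinearMap.ext fun x => ?_)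
    · change ρ ⁅y, z⁆ p.1 = ρ y (ρ z p.1) - ρ z (ρ y p.1)
      exact map_lie_apply ρ y z p.1
    · change ρ ⁅y, z⁆ (p.2 x) - total pA ρ p ⁅((⁅y, z⁆ : A) : L), x⁆ =
        (ρ y ((actPair pA ρ z p).2 x) - total pA ρ (actPair pA ρ z p) ⁅(y : L), x⁆) -
        (ρ z ((actPair pA ρ y p).2 x) - total pA ρ (actPair pA ρ y p) ⁅(z : L), x⁆)
      rw [total_actPair pA ρ hA, total_actPair pA ρ hA, actPair_snd, actPair_snd, map_sub, map_sub,
        map_lie_apply, LieSubalgebra.coe_bracket, lie_lie, map_sub]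
      abel

end Pairs

/-! ### The action of the whole Lie algebra on `U(A) ⊗ N`. -/

variable {N : Type*} [AddCommGroup N] [Module R N]

/-- Left multiplication on `U(A) ⊗ N`. -/
noncomputable def leftRep : A →ₗ⁅R⁆ Module.End R (UniversalEnvelopingAlgebra R A ⊗[R] N) where
  toFun y := (LinearMap.mulLeft R (ι R y)).rTensor N
  map_add' y z := by ext u n; simp [add_mul, TensorProduct.add_tmul]
  map_smul' c y := by ext u n; simp [TensorProduct.smul_tmul']
  map_lie' {y z} := by
    ext u n
    simp [LieRing.of_associative_ring_bracket, sub_mul, TensorProduct.sub_tmul, mul_assoc]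

@[simp] theorem leftRep_tmul (y : A) (u : UniversalEnvelopingAlgebra R A) (v : N) :
    leftRep y (u ⊗ₜ[R] v) = (ι R y * u) ⊗ₜ[R] v := rfl

variable (hA : ∀ y : A, pA y = y) (β : L →ₗ[R] Module.End R N)

/-- The pair of `1 ⊗ v` and the vectors `1 ⊗ β x v`. -/
noncomputable def initPair : N →ₗ[R] (UniversalEnvelopingAlgebra R A ⊗[R] N) ×
    (L →ₗ[R] (UniversalEnvelopingAlgebra R A ⊗[R] N)) where
  toFun v := (1 ⊗ₜ v, TensorProduct.mk R _ N 1 ∘ₗ LinearMap.applyₗ v ∘ₗ β)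
  map_add' v w := by ext <;> simp [TensorProduct.tmul_add]
  map_smul' c v := by ext <;> simp

/-- The pair of `w ∈ U(A) ⊗ N` and the family of the vectors `x • w`. -/
noncomputable def pairOf : UniversalEnvelopingAlgebra R A ⊗[R] N →ₗ[R]
    (UniversalEnvelopingAlgebra R A ⊗[R] N) × (L →ₗ[R] (UniversalEnvelopingAlgebra R A ⊗[R] N)) :=
  TensorProduct.lift
    (LinearMap.lcomp R _ (initPair β) ∘ₗ (lift R (pairRep pA leftRep hA)).toLinearMap)

theorem pairOf_tmul (u : UniversalEnvelopingAlgebra R A) (v : N) :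
    pairOf pA hA β (u ⊗ₜ v) = lift R (pairRep pA leftRep hA) u (initPair β v) := rfl

theorem pairOf_one_tmul (v : N) : pairOf pA hA β (1 ⊗ₜ v) = initPair β v := by
  rw [pairOf_tmul, map_one]; rfl

theorem pairOf_leftRep (y : A) (w : UniversalEnvelopingAlgebra R A ⊗[R] N) :
    pairOf pA hA β (leftRep y w) = actPair pA leftRep y (pairOf pA hA β w) := by
  induction w with
  | zero => simp
  | add w w' h h' => simp only [map_add, h, h']
  | tmul u v =>
    rw [leftRep_tmul, pairOf_tmul, pairOf_tmul, map_mul, lift_ι_apply]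
    rfl

/-- `U(A)` is generated by `A`, so `U(A) ⊗ N` is reached from the vectors `1 ⊗ v` by left
multiplications and linear combinations. This makes the recursion for the action usable as an
induction. -/
theorem tensor_induction {p : UniversalEnvelopingAlgebra R A ⊗[R] N → Prop} (zero : p 0)
    (add : ∀ w w', p w → p w' → p (w + w')) (one : ∀ v, p (1 ⊗ₜ v))
    (left : ∀ y w, p w → p (leftRep y w)) (smul : ∀ (c : R) w, p w → p (c • w)) (w) : p w := by
  induction w with
  | zero => exact zero
  | add w w' h h' => exact add w w' h h'
  | tmul u v =>
    let S : Submodule R (UniversalEnvelopingAlgebra R A) :=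
      { carrier := {u | p (u ⊗ₜ v)}
        zero_mem' := by simpa using zero
        add_mem' := fun {a b} ha hb => by
          have := add _ _ ha hb
          rwa [← TensorProduct.add_tmul] at this
        smul_mem' := fun c a ha => by
          have := smul c _ ha
          rwa [TensorProduct.smul_tmul'] at this }
    have hS : S = ⊤ := submodule_eq_top S (one v) fun y u hu => left y _ hu
    have : u ∈ S := hS ▸ Submodule.mem_top
    exact this

theorem pairOf_fst (w : UniversalEnvelopingAlgebra R A ⊗[R] N) : (pairOf pA hA β w).1 = w := by
  induction w using tensor_induction with
  | zero => simp
  | add w w' h h' => simp [h, h']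
  | one v => rw [pairOf_one_tmul]; rfl
  | left y w h => rw [pairOf_leftRep, actPair_fst, h]
  | smul c w h => simp [h]

/-- The action of `L` on `U(A) ⊗ N`. -/
noncomputable def act (x : L) : Module.End R (UniversalEnvelopingAlgebra R A ⊗[R] N) :=
  (total pA leftRep ∘ₗ pairOf pA hA β).flip x

theorem act_apply (x : L) (w : UniversalEnvelopingAlgebra R A ⊗[R] N) :
    act pA hA β x w = total pA leftRep (pairOf pA hA β w) x := rfl

theorem act_add (x y : L) (w : UniversalEnvelopingAlgebra R A ⊗[R] N) :
    act pA hA β (x + y) w = act pA hA β x w + act pA hA β y w := by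
  rw [act_apply, map_add]; rfl

theorem act_coe (y : A) (w : UniversalEnvelopingAlgebra R A ⊗[R] N) :
    act pA hA β y w = leftRep y w := by
  rw [act_apply, total_apply, hA, compl_coe pA hA, map_zero, add_zero, pairOf_fst]

theorem act_leftRep (x : L) (y : A) (w : UniversalEnvelopingAlgebra R A ⊗[R] N) :
    act pA hA β x (leftRep y w) = leftRep y (act pA hA β x w) - act pA hA β ⁅(y : L), x⁆ w := by
  rw [act_apply, pairOf_leftRep, total_actPair pA _ hA]; rfl

theorem act_compl_one_tmul (x : L) (v : N) :
    act pA hA β (compl pA x) (1 ⊗ₜ v) = 1 ⊗ₜ β (compl pA x) v := by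
  have h : pA (compl pA x) = 0 := by
    have h := add_compl pA (compl pA x)
    rw [compl_compl pA hA, add_eq_right] at h
    exact_mod_cast h
  rw [act_apply, total_apply, h, compl_compl pA hA, pairOf_one_tmul]
  simp [initPair]

variable (hB : ∀ x y, pA ⁅compl pA x, compl pA y⁆ = 0)
  (hβ : ∀ x y, β ⁅compl pA x, compl pA y⁆ = ⁅β (compl pA x), β (compl pA y)⁆)

include hB in
theorem compl_lie_compl (x y : L) :
    compl pA ⁅compl pA x, compl pA y⁆ = ⁅compl pA x, compl pA y⁆ := by
  have h := add_compl pA ⁅compl pA x, compl pA y⁆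
  rwa [hB, ZeroMemClass.coe_zero, zero_add] at h

-- If one argument lies in `A`, this is `act_leftRep`. For two arguments in the complement one
-- inducts on `w`: on `1 ⊗ v` the claim is the multiplicativity of `β`, and passing from `w` to `y
-- w` is the Jacobi identity.
include hB hβ in
theorem act_lie (x x' : L) (w : UniversalEnvelopingAlgebra R A ⊗[R] N) :
    act pA hA β ⁅x, x'⁆ w =
      act pA hA β x (act pA hA β x' w) - act pA hA β x' (act pA hA β x w) := by
  have hcoe : ∀ (y : A) (x : L) (w : UniversalEnvelopingAlgebra R A ⊗[R] N),
      act pA hA β ⁅(y : L), x⁆ w =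
        act pA hA β y (act pA hA β x w) - act pA hA β x (act pA hA β y w) := by
    intro y x w
    rw [act_coe, act_coe, act_leftRep]
    abel
  have hneg : ∀ (x : L) (w : UniversalEnvelopingAlgebra R A ⊗[R] N),
      act pA hA β (-x) w = -act pA hA β x w := by
    intro x w
    rw [act_apply, map_neg]; rfl
  have hcoe' : ∀ (y : A) (x : L) (w : UniversalEnvelopingAlgebra R A ⊗[R] N),
      act pA hA β ⁅x, (y : L)⁆ w =
        act pA hA β x (act pA hA β y w) - act pA hA β y (act pA hA β x w) := by
    intro y x w
    rw [← lie_skew, hneg, hcoe]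
    abel
  -- It suffices to treat complements; the general case follows by bilinearity.
  suffices H : ∀ w, ∀ x x', act pA hA β ⁅compl pA x, compl pA x'⁆ w =
      act pA hA β (compl pA x) (act pA hA β (compl pA x') w) -
        act pA hA β (compl pA x') (act pA hA β (compl pA x) w) by
    rw [← add_compl pA x, ← add_compl pA x']
    simp only [add_lie, lie_add, act_add, map_add, hcoe, hcoe', H]
    abel
  intro w
  induction w using tensor_induction with
  | zero => simp
  | add w w' h h' => intro x x'; simp only [map_add, h, h']; abel
  | smul c w h => intro x x'; simp only [map_smul, h, smul_sub]
  | one v =>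
    intro x x'
    rw [← compl_lie_compl pA hB, act_compl_one_tmul, act_compl_one_tmul, act_compl_one_tmul,
      act_compl_one_tmul, act_compl_one_tmul, compl_lie_compl pA hB, hβ,
      ← TensorProduct.tmul_sub]
    rfl
  | left y w h =>
    -- The brackets `[y, x]` produced by the Jacobi identity may leave the complement, so the
    -- induction hypothesis is first extended to one arbitrary argument.
    have hfull : ∀ x z, act pA hA β ⁅compl pA x, z⁆ w =
        act pA hA β (compl pA x) (act pA hA β z w) -
          act pA hA β z (act pA hA β (compl pA x) w) := by
      intro x z
      rw [← add_compl pA z]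
      simp only [lie_add, act_add, map_add, hcoe', h]
      abel
    have hfull' : ∀ x z, act pA hA β ⁅z, compl pA x⁆ w =
        act pA hA β z (act pA hA β (compl pA x) w) -
          act pA hA β (compl pA x) (act pA hA β z w) := by
      intro x z
      rw [← lie_skew, hneg, hfull]
      abel
    intro x x'
    have hj : ⁅(y : L), ⁅compl pA x, compl pA x'⁆⁆ =
        ⁅⁅(y : L), compl pA x⁆, compl pA x'⁆ + ⁅compl pA x, ⁅(y : L), compl pA x'⁆⁆ :=
      leibniz_lie _ _ _
    simp only [act_leftRep, map_sub, hj, act_add, hfull, hfull']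
    abel

include hA hB hβ in
/-- A representation of a subalgebra `B` complementary to the subalgebra `A` embeds into a
representation of the whole Lie algebra. -/
theorem exists_extension : ∃ σ : L →ₗ⁅R⁆ Module.End R (UniversalEnvelopingAlgebra R A ⊗[R] N),
    ∀ x v, σ (compl pA x) (1 ⊗ₜ v) = 1 ⊗ₜ β (compl pA x) v :=
  ⟨{ toFun := act pA hA β
     map_add' := fun x y => LinearMap.ext fun w => act_add pA hA β x y w
     map_smul' := fun c x => LinearMap.ext fun w => by
       simp only [act_apply, map_smul]; rfl
     map_lie' := fun {x y} => LinearMap.ext fun w => act_lie pA hA β hB hβ x y w },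
   fun x v => act_compl_one_tmul pA hA β x v⟩

/-- The augmentation `U(A) → R` provides a left inverse. -/
theorem one_tmul_injective : Function.Injective
    (fun v : N => (1 : UniversalEnvelopingAlgebra R A) ⊗ₜ[R] v) := by
  let ε : UniversalEnvelopingAlgebra R A →ₐ[R] R := lift R (0 : A →ₗ⁅R⁆ R)
  let f : UniversalEnvelopingAlgebra R A ⊗[R] N →ₗ[R] N :=
    (TensorProduct.lid R N).toLinearMap ∘ₗ ε.toLinearMap.rTensor N
  intro v w hvw
  have := congrArg f hvw
  simpa [f] using this

end LieAlgebra.Induced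
end

section

/-! ### Root systems -/

namespace RootPairing.Base

variable {ι K M N : Type*} [Finite ι] [Field K] [CharZero K] [AddCommGroup M] [Module K M]
  [AddCommGroup N] [Module K N] {P : RootPairing ι K M N} [P.IsRootSystem] [P.IsCrystallographic]
  (b : P.Base)

/-- The monoid generated by the simple roots. -/
def cone : AddSubmonoid M := AddSubmonoid.closure (P.root '' b.support)

/-- The height of a linear combination of roots. -/
noncomputable def heightLin : M →ₗ[K] K := b.toWeightBasis.constr K fun _ => (1 : K)

theorem heightLin_root {i : ι} (hi : i ∈ b.support) : b.heightLin (P.root i) = 1 := by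
  have := b.toWeightBasis.constr_basis K (fun _ => (1 : K)) ⟨i, hi⟩
  rwa [toWeightBasis_apply] at this

/-- Heights on the cone are natural numbers and vanish only at 0. This supplies the induction
parameter below and shows that the cone contains no non-zero element together with its negative. -/
theorem exists_heightLin_eq_nat {γ : M} (hγ : γ ∈ b.cone) :
    ∃ n : ℕ, b.heightLin γ = n ∧ (n = 0 → γ = 0) := by
  induction hγ using AddSubmonoid.closure_induction with
  | mem x hx =>
    obtain ⟨i, hi, rfl⟩ := hx
    exact ⟨1, by rw [b.heightLin_root hi, Nat.cast_one], by simp⟩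
  | zero => exact ⟨0, by simp⟩
  | add x y _ _ hx hy =>
    obtain ⟨n, hn, hn0⟩ := hx
    obtain ⟨m, hm, hm0⟩ := hy
    refine ⟨n + m, by rw [map_add, hn, hm, Nat.cast_add], fun h => ?_⟩
    rw [hn0 (by omega), hm0 (by omega), add_zero]

theorem exists_coroot_eq_int_of_mem_span {γ : M}
    (hγ : γ ∈ Submodule.span ℤ (Set.range P.root)) (i : ι) :
    ∃ z : ℤ, P.coroot' i γ = z := by
  induction hγ using Submodule.span_induction with
  | mem x hx =>
    obtain ⟨j, rfl⟩ := hx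
    exact ⟨P.pairingIn ℤ j i, (P.algebraMap_pairingIn ℤ j i).symm⟩
  | zero => exact ⟨0, by simp⟩
  | add x y _ _ hx hy =>
    obtain ⟨a, ha⟩ := hx
    obtain ⟨c, hc⟩ := hy
    exact ⟨a + c, by rw [map_add, ha, hc, Int.cast_add]⟩
  | smul n x _ hx =>
    obtain ⟨a, ha⟩ := hx
    exact ⟨n * a, by rw [map_zsmul, ha, zsmul_eq_mul, Int.cast_mul]⟩

theorem cone_le_span {γ : M} (hγ : γ ∈ b.cone) : γ ∈ Submodule.span ℤ (Set.range P.root) := by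
  induction hγ using AddSubmonoid.closure_induction with
  | mem x hx =>
    obtain ⟨i, _, rfl⟩ := hx
    exact Submodule.subset_span ⟨i, rfl⟩
  | zero => exact zero_mem _
  | add x y _ _ hx hy => exact add_mem hx hy

/-- Write `γ` as a sum of simple roots. Subtracting any one summand stays in the cone, so the
hypothesis covers each of them, and `2(x, αᵢ) = ⟨x, αᵢ^∨⟩ (αᵢ, αᵢ)` with a positive integer `(αᵢ,
αᵢ)`. Since `K` carries no order, signs are expressed through natural numbers. -/
theorem exists_nonpos_form_of_forall [Fintype ι] {γ x : M} (hγ : γ ∈ b.cone)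
    (hx : x ∈ Submodule.span ℤ (Set.range P.root))
    (h : ∀ i ∈ b.support, γ - P.root i ∈ b.cone → ∃ m : ℕ, P.coroot' i x = -(m : K)) :
    ∃ m : ℕ, 2 * P.RootForm x γ = -(m : K) := by
  have key : ∀ j, 2 * P.RootForm x (P.root j) =
      P.coroot' j x * P.RootForm (P.root j) (P.root j) := by
    intro j
    have hx' : x ∈ Submodule.span K (Set.range P.root) :=
      Submodule.span_le_restrictScalars ℤ K _ hx
    clear h hx hγ
    induction hx' using Submodule.span_induction with
    | mem y hy =>
      obtain ⟨k, rfl⟩ := hy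
      exact (P.posRootForm ℤ).two_mul_apply_root_root k j
    | zero => simp
    | add y z _ _ hy hz =>
      simp only [map_add, LinearMap.add_apply, mul_add, add_mul] at *
      rw [hy, hz]
    | smul c y _ hy =>
      simp only [map_smul, LinearMap.smul_apply, smul_eq_mul] at *
      rw [mul_left_comm, hy, mul_assoc]
  induction hγ using AddSubmonoid.closure_induction with
  | mem y hy =>
    obtain ⟨i, hi, rfl⟩ := hy
    obtain ⟨m, hm⟩ := h i hi (by rw [sub_self]; exact zero_mem _)
    have hlen : ∃ l : ℕ, P.RootForm (P.root i) (P.root i) = (l : K) := by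
      have h1 := (P.posRootForm ℤ).rootLength_pos i
      have h2 := (P.posRootForm ℤ).algebraMap_rootLength i
      obtain ⟨l, hl⟩ := Int.eq_ofNat_of_zero_le h1.le
      refine ⟨l, ?_⟩
      change _ = P.RootForm _ _ at h2
      rw [← h2, hl]
      simp
    obtain ⟨l, hl⟩ := hlen
    exact ⟨m * l, by rw [key, hm, hl]; push_cast; ring⟩
  | zero => exact ⟨0, by simp⟩
  | add y z hy hz ihy ihz =>
    obtain ⟨m, hm⟩ := ihy fun i hi hyi => h i hi (by
      have := add_mem hyi hz
      rwa [sub_add_eq_add_sub] at this)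
    obtain ⟨m', hm'⟩ := ihz fun i hi hyi => h i hi (by
      have := add_mem hy hyi
      rwa [← add_sub_assoc] at this)
    exact ⟨m + m', by rw [map_add, mul_add, hm, hm']; push_cast; ring⟩

/-- A non-zero element of the cone pairs positively with a simple coroot in its support. -/
theorem exists_coroot_pos_of_mem_cone {γ : M} (hγ : γ ∈ b.cone) (hγ0 : γ ≠ 0) :
    ∃ i ∈ b.support, γ - P.root i ∈ b.cone ∧ ∃ m : ℕ, 0 < m ∧ P.coroot' i γ = m := by
  have := Fintype.ofFinite ι
  by_contra! hcon
  have hspan := b.cone_le_span hγ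
  obtain ⟨m, hm⟩ := b.exists_nonpos_form_of_forall hγ hspan fun i hi hγi => by
    obtain ⟨z, hz⟩ := exists_coroot_eq_int_of_mem_span hspan i
    have hz0 : z ≤ 0 := by
      by_contra! h0
      obtain ⟨n, rfl⟩ := Int.eq_ofNat_of_zero_le h0.le
      exact hcon i hi hγi n (by omega) (by rw [hz, Int.cast_natCast])
    obtain ⟨n, hn⟩ := Int.eq_ofNat_of_zero_le (neg_nonneg.mpr hz0)
    refine ⟨n, ?_⟩
    rw [hz, ← neg_neg z, hn, Int.cast_neg, Int.cast_natCast]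
  let γ' : Submodule.span ℤ (Set.range P.root) := ⟨γ, hspan⟩
  -- Over `ℤ` the norm of `γ` is a sum of squares of its values at the coroots. Being non-positive,
  -- it forces all these values to vanish, and coroots separate points.
  have h1 : (P.posRootForm ℤ).posForm γ' γ' = ∑ k, P.coroot'In ℤ k γ' * P.coroot'In ℤ k γ' :=
    P.posRootForm_posForm_apply_apply ℤ γ' γ'
  have h2 : algebraMap ℤ K ((P.posRootForm ℤ).posForm γ' γ') = P.RootForm γ γ :=
    P.algebraMap_posRootForm_posForm ℤ γ' γ'
  have h3 : (P.posRootForm ℤ).posForm γ' γ' ≤ 0 := by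
    have : ((2 * (P.posRootForm ℤ).posForm γ' γ' : ℤ) : K) = ((-m : ℤ) : K) := by
      push_cast
      rw [← hm, ← h2]
      simp
    have := Int.cast_injective this
    omega
  have h4 : ∀ k, P.coroot'In ℤ k γ' = 0 := by
    intro k
    have h5 := Finset.single_le_sum (f := fun k => P.coroot'In ℤ k γ' * P.coroot'In ℤ k γ')
      (fun k _ => mul_self_nonneg _) (Finset.mem_univ k)
    nlinarith [mul_self_nonneg (P.coroot'In ℤ k γ')]
  refine hγ0 ?_
  have h6 : ∀ k, P.coroot' k γ = 0 := fun k => by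
    have := P.algebraMap_coroot'In_apply ℤ k γ'
    rw [h4, map_zero] at this
    exact this.symm
  have h7 : ∀ y : N, P.toLinearMap γ y = 0 := by
    intro y
    have hy : y ∈ P.corootSpan K := by
      have : P.corootSpan K = ⊤ := RootPairing.IsRootSystem.span_coroot_eq_top
      rw [this]; trivial
    induction hy using Submodule.span_induction with
    | mem x hx => obtain ⟨k, rfl⟩ := hx; exact h6 k
    | zero => simp
    | add x y _ _ hx hy => rw [map_add, hx, hy, add_zero]
    | smul c x _ hx => rw [map_smul, hx, smul_zero]
  exact P.toPerfPair.injective (LinearMap.ext fun y => by simpa using! h7 y)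

end RootPairing.Base
end

/-! ### Saturated sets of weights, and root lengths in type `B`. -/

section

namespace RootPairing.Base

variable {ι K M N : Type*} [Finite ι] [Field K] [CharZero K] [AddCommGroup M] [Module K M]
  [AddCommGroup N] [Module K N] {P : RootPairing ι K M N} [P.IsRootSystem] [P.IsCrystallographic]
  (b : P.Base)

/-- A dominant vector below `λ` belongs to every set containing `λ` that is closed under
subtracting a simple root from a vector pairing positively with it. -/
theorem mem_of_dominant {R : Set M}
    (hR : ∀ β ∈ R, ∀ i ∈ b.support, (∃ m : ℕ, 0 < m ∧ P.coroot' i β = m) → β - P.root i ∈ R)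
    {ν β : M} (hβ : β ∈ R) (hνβ : β - ν ∈ b.cone)
    (hν : ∀ i ∈ b.support, ∃ m : ℕ, P.coroot' i ν = m) : ν ∈ R := by
  obtain ⟨n, hn, -⟩ := b.exists_heightLin_eq_nat hνβ
  induction n using Nat.strong_induction_on generalizing β with
  | _ n ih =>
    by_cases h0 : β - ν = 0
    · rwa [← sub_eq_zero.mp h0]
    -- As `ν` is dominant, `β = (β - ν) + ν` also pairs positively with this coroot. So `β - αᵢ`
    -- stays in `R`, still lies above `ν`, and is closer to it by 1.
    obtain ⟨i, hi, hci, m, hm, hmi⟩ := b.exists_coroot_pos_of_mem_cone hνβ h0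
    obtain ⟨m', hm'⟩ := hν i hi
    have h1 : β - P.root i - ν = β - ν - P.root i := by abel
    have h2 : b.heightLin (β - P.root i - ν) = n - 1 := by
      rw [h1, map_sub, hn, b.heightLin_root hi]
    rw [← h1] at hci
    obtain ⟨k, hk, -⟩ := b.exists_heightLin_eq_nat hci
    have hkn : k + 1 = n := by
      have : (k : K) + 1 = n := by rw [← hk, h2]; ring
      exact_mod_cast this
    refine ih k (by omega) (hR β hβ i hi ⟨m + m', by omega, ?_⟩) hci hk
    rw [← sub_add_cancel β ν, map_add, hmi, hm', Nat.cast_add]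

/-- A set of integral vectors below `λ` that is stable under simple reflections. -/
theorem subset_of_reflection_stable {R Q : Set M}
    (hR : ∀ β ∈ R, ∀ i ∈ b.support, (∃ m : ℕ, 0 < m ∧ P.coroot' i β = m) → β - P.root i ∈ R)
    (hRs : ∀ β ∈ R, ∀ i ∈ b.support, P.reflection i β ∈ R)
    (hQs : ∀ β ∈ Q, ∀ i ∈ b.support, P.reflection i β ∈ Q)
    {μ : M} (hμ : μ ∈ R) (hμs : μ ∈ Submodule.span ℤ (Set.range P.root))
    (hQμ : ∀ ν ∈ Q, μ - ν ∈ b.cone) : Q ⊆ R := by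
  intro ν hν
  obtain ⟨n, hn, -⟩ := b.exists_heightLin_eq_nat (hQμ ν hν)
  induction n using Nat.strong_induction_on generalizing ν with
  | _ n ih =>
    have hint : ∀ i, ∃ z : ℤ, P.coroot' i ν = z := fun i => by
      refine exists_coroot_eq_int_of_mem_span ?_ i
      rw [← sub_sub_cancel μ ν]
      exact sub_mem hμs (b.cone_le_span (hQμ ν hν))
    by_cases hdom : ∀ i ∈ b.support, ∃ m : ℕ, P.coroot' i ν = m
    · exact b.mem_of_dominant hR hμ (hQμ ν hν) hdom
    push Not at hdom
    obtain ⟨i, hi, hneg⟩ := hdom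
    obtain ⟨z, hz⟩ := hint i
    have hz0 : z < 0 := by
      by_contra! h0
      obtain ⟨m, rfl⟩ := Int.eq_ofNat_of_zero_le h0
      exact hneg m (by rw [hz, Int.cast_natCast])
    -- If `ν` pairs to `z < 0` with the coroot, reflecting it adds `-z` copies of `αᵢ` and lowers
    -- the height of `μ - ν`. The induction handles the reflected vector, and a second reflection
    -- returns to `ν`.
    have h1 := hQs ν hν i hi
    obtain ⟨k, hk, -⟩ := b.exists_heightLin_eq_nat (hQμ _ h1)
    have h2 : b.heightLin (μ - P.reflection i ν) = n + z := by
      rw [reflection_apply, hz, ← sub_add, map_add, hn, map_smul, b.heightLin_root hi, smul_eq_mul,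
        mul_one]
    have hkn : (k : ℤ) = n + z := by
      have : (k : K) = n + z := by rw [← hk, h2]
      exact_mod_cast this
    have h3 := hRs _ (ih k (by omega) h1 hk) i hi
    rwa [reflection_same] at h3

variable [P.IsReduced]

/-- The roots together with zero. -/
def rootsOrZero (P : RootPairing ι K M N) : Set M := insert 0 (Set.range P.root)

theorem pairingIn_pos_of_coroot {i j : ι} (h : ∃ m : ℕ, 0 < m ∧ P.coroot' i (P.root j) = m) :
    0 < P.pairingIn ℤ j i := by
  obtain ⟨m, hm, h⟩ := h
  have h1 : (algebraMap ℤ K) (P.pairingIn ℤ j i) = m := by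
    rw [P.algebraMap_pairingIn]; exact h
  have h2 : P.pairingIn ℤ j i = m := by
    have : ((P.pairingIn ℤ j i : ℤ) : K) = ((m : ℤ) : K) := by simpa using h1
    exact Int.cast_injective this
  omega

theorem sub_mem_rootsOrZero {β : M} (hβ : β ∈ rootsOrZero P) {i : ι}
    (h : ∃ m : ℕ, 0 < m ∧ P.coroot' i β = m) : β - P.root i ∈ rootsOrZero P := by
  rcases hβ with rfl | ⟨j, rfl⟩
  · obtain ⟨m, hm, h⟩ := h
    rw [map_zero] at h
    exact absurd h.symm (Nat.cast_ne_zero.mpr hm.ne')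
  · by_cases hij : j = i
    · subst hij; rw [sub_self]; exact Or.inl rfl
    · exact Or.inr (P.root_sub_root_mem_of_pairingIn_pos (pairingIn_pos_of_coroot h) hij)

theorem reflection_mem_rootsOrZero {β : M} (hβ : β ∈ rootsOrZero P) (i : ι) :
    P.reflection i β ∈ rootsOrZero P := by
  rcases hβ with rfl | ⟨j, rfl⟩
  · rw [map_zero]; exact Or.inl rfl
  · exact Or.inr ⟨P.reflectionPerm i j, P.root_reflectionPerm i j⟩

theorem mem_cone_or_neg_mem_of_mem_rootsOrZero {β : M} (hβ : β ∈ rootsOrZero P) :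
    β ∈ b.cone ∨ -β ∈ b.cone := by
  rcases hβ with rfl | ⟨j, rfl⟩
  · exact Or.inl (zero_mem _)
  · exact b.root_mem_or_neg_mem j

/-! ### Short roots and their doubles in type `B_l`. -/

section TypeB

variable [Fintype ι] {l : ℕ} (e : Fin l ≃ b.support)
  (he : ∀ i j, b.cartanMatrix (e i) (e j) = CartanMatrix.B l i j)

theorem rootLength_reflectionPerm (i j : ι) :
    (P.posRootForm ℤ).rootLength (P.reflectionPerm i j) = (P.posRootForm ℤ).rootLength j := by
  apply FaithfulSMul.algebraMap_injective ℤ K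
  rw [RootPositiveForm.algebraMap_rootLength, RootPositiveForm.algebraMap_rootLength,
    root_reflectionPerm]
  exact (P.posRootForm ℤ).isOrthogonal_reflection i _ _

include he

/-- The last column of the Cartan matrix of type `B` has only entries 2, -2 and 0, so the last
simple coroot takes even values on the whole root lattice. -/
theorem even_pairingIn_last (q : Fin l) (hq : q.val + 1 = l) (j : ι) :
    Even (P.pairingIn ℤ j (e q)) := by
  have hj : P.root j ∈ Submodule.span ℤ (P.root '' b.support) := b.root_mem_span_int j
  have key : ∀ x ∈ Submodule.span ℤ (P.root '' b.support), ∃ z : ℤ, P.coroot' (e q) x = 2 * z := by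
    intro x hx
    induction hx using Submodule.span_induction with
    | mem x hx =>
      obtain ⟨i, hi, rfl⟩ := hx
      have h1 := he (e.symm ⟨i, hi⟩) q
      rw [e.apply_symm_apply, cartanMatrix, cartanMatrixIn_def] at h1
      have h2 : Even (CartanMatrix.B l (e.symm ⟨i, hi⟩) q) := by
        simp only [CartanMatrix.B, Matrix.of_apply]
        split_ifs <;> first | omega | decide
      rw [← h1] at h2
      obtain ⟨z, hz⟩ := h2
      refine ⟨z, ?_⟩
      have h3 := P.algebraMap_pairingIn ℤ i (e q)
      simp only at hz
      rw [hz] at h3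
      change P.pairing i (e q) = _
      rw [← h3]
      simp [two_mul]
    | zero => exact ⟨0, by simp⟩
    | add x y _ _ hx hy =>
      obtain ⟨z, hz⟩ := hx
      obtain ⟨w, hw⟩ := hy
      exact ⟨z + w, by rw [map_add, hz, hw]; push_cast; ring⟩
    | smul n x _ hx =>
      obtain ⟨z, hz⟩ := hx
      exact ⟨n * z, by rw [map_zsmul, hz, zsmul_eq_mul]; push_cast; ring⟩
  obtain ⟨z, hz⟩ := key _ hj
  refine ⟨z, ?_⟩
  have h3 := P.algebraMap_pairingIn ℤ j (e q)
  have h4 : ((P.pairingIn ℤ j (e q) : ℤ) : K) = ((z + z : ℤ) : K) := by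
    push_cast
    rw [← two_mul, ← hz]
    simpa using h3
  exact Int.cast_injective h4

/-- The ratio of the squared lengths of neighbouring simple roots is read off the Cartan matrix: it
is 1 except on the last edge, where it is 2. The induction runs over the distance to the last node.
-/
theorem rootLength_eq_two_mul_last (q : Fin l) (hq : q.val + 1 = l) (i : Fin l) (hi : i ≠ q) :
    (P.posRootForm ℤ).rootLength (e i) = 2 * (P.posRootForm ℤ).rootLength (e q) := by
  have hstep : ∀ i j : Fin l, i.val + 1 = j.val → (P.posRootForm ℤ).rootLength (e i) =
      if j.val = l - 1 then 2 * (P.posRootForm ℤ).rootLength (e j)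
        else (P.posRootForm ℤ).rootLength (e j) := by
    intro i j hij
    have h1 := (P.posRootForm ℤ).pairingIn_mul_eq_pairingIn_mul_swap (e i) (e j)
    have h2 := he i j
    have h3 := he j i
    rw [cartanMatrix, cartanMatrixIn_def] at h2 h3
    rw [h2, h3] at h1
    have hne : i ≠ j := fun h => by rw [h] at hij; omega
    simp only [CartanMatrix.B, Matrix.of_apply, if_neg hne, if_neg hne.symm, if_pos hij] at h1
    rw [if_neg (by omega)] at h1
    split_ifs at h1 ⊢ <;> linarith
  obtain ⟨d, hd⟩ : ∃ d, i.val + d + 1 = q.val := by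
    have : i.val ≠ q.val := fun h => hi (Fin.ext h)
    exact ⟨q.val - i.val - 1, by omega⟩
  induction d generalizing i with
  | zero => rw [hstep i q (by omega), if_pos (by omega)]
  | succ d ih =>
    have hlt : i.val + 1 < l := by omega
    rw [hstep i ⟨i.val + 1, hlt⟩ rfl, if_neg (by simp only; omega)]
    exact ih ⟨i.val + 1, hlt⟩ (fun h => by
      have := congrArg Fin.val h
      simp only at this; omega) (by simp only; omega)

theorem rootLength_eq_or (q : Fin l) (hq : q.val + 1 = l) (j : ι) :
    (P.posRootForm ℤ).rootLength j = (P.posRootForm ℤ).rootLength (e q) ∨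
      (P.posRootForm ℤ).rootLength j = 2 * (P.posRootForm ℤ).rootLength (e q) := by
  refine b.induction_reflect j (p := fun j =>
    (P.posRootForm ℤ).rootLength j = (P.posRootForm ℤ).rootLength (e q) ∨
      (P.posRootForm ℤ).rootLength j = 2 * (P.posRootForm ℤ).rootLength (e q)) ?_ ?_ ?_
  · intro i hi; rwa [rootLength_reflectionPerm]
  · intro i hi
    by_cases hiq : e.symm ⟨i, hi⟩ = q
    · left
      rw [← hiq, e.apply_symm_apply]
    · right
      have := b.rootLength_eq_two_mul_last e he q hq _ hiq
      rwa [e.apply_symm_apply] at this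
  · intro i k hi _; rwa [rootLength_reflectionPerm]

/-- If `αᵢ` is the last simple root, it has the length of the short root `αⱼ`, so the two pairings
agree; being positive and even they equal 2, and `i = j`. Otherwise `αᵢ` has twice the squared
length of `αⱼ`, hence `⟨αᵢ, αⱼ^∨⟩ = 2`, and `2αⱼ - αᵢ` is the negative of the reflection of `αᵢ` in
`αⱼ`. -/
theorem two_smul_sub_mem {j : ι} (hj : ∀ k, (P.posRootForm ℤ).rootLength j ≤
    (P.posRootForm ℤ).rootLength k) {i : ι} (hi : i ∈ b.support) (hpos : 0 < P.pairingIn ℤ j i) :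
    2 • P.root j - P.root i ∈ Set.range P.root := by
  have hl : 0 < l := Fin.pos_iff_nonempty.mpr ⟨e.symm ⟨i, hi⟩⟩
  let q : Fin l := ⟨l - 1, by omega⟩
  have hq : q.val + 1 = l := by simp only [q]; omega
  have hlen : (P.posRootForm ℤ).rootLength j = (P.posRootForm ℤ).rootLength (e q) := by
    have h1 := hj (e q)
    have h2 := (P.posRootForm ℤ).rootLength_pos (e q)
    rcases b.rootLength_eq_or e he q hq j with h | h
    · exact h
    · omega
  have hlpos := (P.posRootForm ℤ).rootLength_pos j
  have hswap := (P.posRootForm ℤ).pairingIn_mul_eq_pairingIn_mul_swap i j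
  have hmem := P.pairingIn_pairingIn_mem_set_of_isCrystal_of_isRed i j
  by_cases hiq : e.symm ⟨i, hi⟩ = q
  · have hieq : i = (e q : ι) := by rw [← hiq, e.apply_symm_apply]
    have heven := b.even_pairingIn_last e he q hq j
    rw [hieq, ← hlen, ← hieq] at hswap
    rw [← hieq] at heven
    have h1 : P.pairingIn ℤ j i = P.pairingIn ℤ i j := mul_right_cancel₀ hlpos.ne' hswap
    have h2 : P.pairingIn ℤ i j = 2 ∧ P.pairingIn ℤ j i = 2 := by
      obtain ⟨z, hz⟩ := heven
      simp only [Set.mem_insert_iff, Set.mem_singleton_iff, Prod.mk.injEq] at hmem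
      omega
    have h3 : i = j := by
      exact (P.pairingIn_two_two_iff ℤ i j).mp h2
    exact ⟨j, by rw [h3, two_smul, add_sub_cancel_right]⟩
  · have h1 := b.rootLength_eq_two_mul_last e he q hq _ hiq
    rw [e.apply_symm_apply, ← hlen] at h1
    simp only at h1
    rw [h1, ← mul_assoc] at hswap
    have h2 : P.pairingIn ℤ j i * 2 = P.pairingIn ℤ i j := mul_right_cancel₀ hlpos.ne' hswap
    have h3 : P.pairingIn ℤ i j = 2 := by
      simp only [Set.mem_insert_iff, Set.mem_singleton_iff, Prod.mk.injEq] at hmem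
      omega
    have h4 := P.reflection_apply_root' ℤ (i := j) (j := i)
    rw [h3] at h4
    have h5 : 2 • P.root j - P.root i = -P.reflection j (P.root i) := by
      rw [h4]
      simp only [ofNat_zsmul, neg_sub]
    rw [h5, ← root_reflectionPerm]
    exact P.neg_mem_range_root_iff.mpr ⟨_, rfl⟩

end TypeB

end RootPairing.Base
end

section

/-! ### Joint eigenspaces -/

theorem Module.End.iSupIndep_iInf_eigenspace {ι K M : Type*} [Field K] [AddCommGroup M]
    [Module K M] (f : ι → Module.End K M) (hf : ∀ i j, Commute (f i) (f j)) :
    iSupIndep fun χ : ι → K => ⨅ i, (f i).eigenspace (χ i) := by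
  refine (Module.End.independent_iInf_maxGenEigenspace_of_forall_mapsTo f fun i j φ =>
    Module.End.mapsTo_maxGenEigenspace_of_comm (hf j i) φ).mono fun χ => ?_
  exact iInf_mono fun i => (Module.End.genEigenspace (f i) (χ i)).monotone le_top

namespace LieModule

open LieAlgebra.IsKilling LieAlgebra

variable {𝔰 M : Type*} [LieRing 𝔰] [LieAlgebra ℂ 𝔰] [FiniteDimensional ℂ 𝔰]
  [LieAlgebra.IsKilling ℂ 𝔰] [AddCommGroup M] [Module ℂ M] [LieRingModule 𝔰 M] [LieModule ℂ 𝔰 M]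
  (H : LieSubalgebra ℂ 𝔰)

variable (M) in
/-- The vectors of weight `χ`. -/
def weightVectors (χ : Module.Dual ℂ H) : Submodule ℂ M where
  carrier := {v | ∀ h : H, ⁅(h : 𝔰), v⁆ = χ h • v}
  zero_mem' := by simp
  add_mem' := fun hv hw h => by rw [lie_add, hv, hw, smul_add]
  smul_mem' := fun c v hv h => by rw [lie_smul, hv, smul_comm]

variable [H.IsCartanSubalgebra]

theorem iSupIndep_weightVectors : iSupIndep fun χ : Module.Dual ℂ H => weightVectors M H χ := by
  have h1 := Module.End.iSupIndep_iInf_eigenspace (fun h : H => LieModule.toEnd ℂ 𝔰 M (h : 𝔰))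
    (fun h h' => by
      refine LinearMap.ext fun v => ?_
      have h0 : ⁅(h : 𝔰), (h' : 𝔰)⁆ = 0 := by
        have := trivial_lie_zero H H h h'
        rw [← LieSubalgebra.coe_bracket, this, ZeroMemClass.coe_zero]
      have := leibniz_lie (h : 𝔰) (h' : 𝔰) v
      rw [h0, zero_lie, zero_add] at this
      exact this)
  refine (h1.comp (f := fun χ : Module.Dual ℂ H => (χ : H → ℂ)) DFunLike.coe_injective).mono
    fun χ v hv => ?_
  simp only [Function.comp, Submodule.mem_iInf, Module.End.mem_eigenspace_iff]
  exact hv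

theorem lie_mem_weightVectors {α χ : Module.Dual ℂ H} {x : 𝔰} {v : M}
    (hx : x ∈ rootSpace H α) (hv : v ∈ weightVectors M H χ) :
    ⁅x, v⁆ ∈ weightVectors M H (χ + α) := by
  intro h
  have h1 : ⁅(h : 𝔰), x⁆ = α h • x := lie_eq_smul_of_mem_rootSpace hx h
  rw [leibniz_lie, h1, hv h, smul_lie, lie_smul, LinearMap.add_apply, add_smul, add_comm]

theorem toEnd_pow_mem_weightVectors {α χ : Module.Dual ℂ H} {x : 𝔰} {v : M}
    (hx : x ∈ rootSpace H α) (hv : v ∈ weightVectors M H χ) (k : ℕ) :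
    ((toEnd ℂ 𝔰 M x) ^ k) v ∈ weightVectors M H (χ + k • α) := by
  induction k with
  | zero => simpa using hv
  | succ k ih =>
    rw [pow_succ', Module.End.mul_apply, succ_nsmul, ← add_assoc]
    exact lie_mem_weightVectors H hx ih

variable [FiniteDimensional ℂ M]

/-- The top of the string through `v`. -/
theorem exists_hasPrimitiveVectorWith_pow {h e f : 𝔰} (t : IsSl2Triple h e f) {v : M} (hv : v ≠ 0)
    {c : ℂ} (hc : ⁅h, v⁆ = c • v) : ∃ n N : ℕ, c + 2 * n = N ∧
      t.HasPrimitiveVectorWith (((toEnd ℂ 𝔰 M e) ^ n) v) (N : ℂ) := by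
  have h_exists_zero : ∃ k, ((toEnd ℂ 𝔰 M e) ^ k) v = 0 := by
    -- Otherwise the vectors `e^k v` would be eigenvectors of `h` with infinitely many distinct
    -- eigenvalues `c + 2k`.
    by_contra! contra
    have h_inj : Function.Injective fun n : ℕ => c + 2 * (n : ℂ) := fun a b hab => by
      simpa [add_right_inj, mul_eq_mul_left_iff, Nat.cast_inj] using hab
    have aux (μ : Set.range fun n : ℕ => c + 2 * (n : ℂ)) :
        (toEnd ℂ 𝔰 M h).HasEigenvector μ (((toEnd ℂ 𝔰 M e) ^ μ.property.choose) v) := by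
      refine ⟨?_, contra _⟩
      have h1 : c + 2 * (μ.property.choose : ℂ) = μ := μ.property.choose_spec
      have h2 := t.lie_h_pow_toEnd_e hc μ.property.choose
      rw [h1] at h2
      exact Module.End.mem_eigenspace_iff.mpr h2
    have _i := ((toEnd ℂ 𝔰 M h).eigenvectors_linearIndependent _ _ aux).finite
    exact (Set.infinite_range_of_injective h_inj) (Set.toFinite _)
  obtain ⟨n, hn, hn0⟩ := Nat.exists_not_and_succ_of_not_zero_of_exists hv h_exists_zero
  have P : t.HasPrimitiveVectorWith (((toEnd ℂ 𝔰 M e) ^ n) v) (c + 2 * n) :=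
    { ne_zero := hn
      lie_h := t.lie_h_pow_toEnd_e hc n
      lie_e := by rwa [← toEnd_apply_apply ℂ 𝔰 M, ← Module.End.mul_apply, ← pow_succ'] }
  obtain ⟨N, hN⟩ := P.exists_nat
  exact ⟨n, N, hN, hN ▸ P⟩

variable (V : LieSubmodule ℂ 𝔰 M)

theorem pow_toEnd_mem (x : 𝔰) {v : M} (hv : v ∈ V) (k : ℕ) : ((toEnd ℂ 𝔰 M x) ^ k) v ∈ V := by
  induction k with
  | zero => simpa
  | succ k ih => rw [pow_succ', Module.End.mul_apply]; exact V.lie_mem ih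

/-- Applying `f` directly to `v` may give zero when `v` is not a highest weight vector. So `v` is
first raised to a primitive vector `e^n v` of weight `m + 2n`, from which `f` can be applied `m + n`
times without reaching zero. -/
theorem exists_reflected_of_nat {h e f : 𝔰} (t : IsSl2Triple h e f) {α χ : Module.Dual ℂ H}
    (he : e ∈ rootSpace H α) (hf : f ∈ rootSpace H (-α : Module.Dual ℂ H)) {v : M} (hv : v ≠ 0)
    (hvχ : v ∈ weightVectors M H χ) (hvV : v ∈ V) (m : ℕ) (hm : ⁅h, v⁆ = (m : ℂ) • v) :
    ∃ w ∈ V, w ≠ 0 ∧ w ∈ weightVectors M H (χ - m • α) := by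
  obtain ⟨n, N, hN, P⟩ := exists_hasPrimitiveVectorWith_pow t hv hm
  have hN' : m + 2 * n = N := by exact_mod_cast hN
  refine ⟨((toEnd ℂ 𝔰 M f) ^ (m + n)) (((toEnd ℂ 𝔰 M e) ^ n) v),
    pow_toEnd_mem V _ (pow_toEnd_mem V _ hvV _) _,
    P.pow_toEnd_f_ne_zero_of_eq_nat rfl (by omega), ?_⟩
  have h1 := toEnd_pow_mem_weightVectors H hf (toEnd_pow_mem_weightVectors H he hvχ n) (m + n)
  have h2 : χ + n • α + (m + n) • -α = χ - m • α := by
    rw [add_smul, smul_neg, smul_neg]; abel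
  rwa [h2] at h1

/-- The weights of a finite-dimensional module are stable under reflections. -/
theorem exists_weightVector_reflection (i : H.root) {χ : Module.Dual ℂ H} {v : M} (hv : v ≠ 0)
    (hvχ : v ∈ weightVectors M H χ) (hvV : v ∈ V) :
    ∃ w ∈ V, w ≠ 0 ∧ w ∈ weightVectors M H ((rootSystem H).reflection i χ) := by
  have hi : i.1.IsNonZero := (Finset.mem_filter.mp i.2).2
  obtain ⟨h, e, f, t, he, hf⟩ := exists_isSl2Triple_of_weight_isNonZero hi
  obtain rfl := t.h_eq_coroot hi he hf
  have he' : e ∈ rootSpace H ((rootSystem H).root i) := he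
  have hf' : f ∈ rootSpace H (-(rootSystem H).root i : Module.Dual ℂ H) := hf
  have hval : (rootSystem H).coroot' i χ = χ (coroot i.1) := rfl
  have hc : ⁅(coroot i.1 : 𝔰), v⁆ = χ (coroot i.1) • v := hvχ _
  obtain ⟨n, N, hN, -⟩ := exists_hasPrimitiveVectorWith_pow t hv hc
  rcases le_total (2 * n) N with hle | hle
  · obtain ⟨m, rfl⟩ := Nat.exists_eq_add_of_le hle
    have hm : χ (coroot i.1) = m := by
      push_cast at hN; linear_combination hN
    rw [hm] at hc
    have := exists_reflected_of_nat H V t he' hf' hv hvχ hvV m hc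
    rwa [RootPairing.reflection_apply, hval, hm, Nat.cast_smul_eq_nsmul]
  -- The weight takes the value `-m` on the coroot; the opposite triple, with `e` and `f` exchanged,
  -- reduces this to the previous case.
  · obtain ⟨m, hm'⟩ := Nat.exists_eq_add_of_le hle
    have hm : χ (coroot i.1) = -m := by
      have : (2 * n : ℂ) = N + m := by exact_mod_cast hm'
      linear_combination hN - this
    have hc' : ⁅-(coroot i.1 : 𝔰), v⁆ = (m : ℂ) • v := by
      rw [neg_lie, hc, hm, neg_smul, neg_neg]
    have := exists_reflected_of_nat H V (α := -(rootSystem H).root i) t.symm hf'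
      (by rwa [neg_neg]) hv hvχ hvV m hc'
    rwa [RootPairing.reflection_apply, hval, hm, neg_smul, Nat.cast_smul_eq_nsmul, sub_neg_eq_add,
      ← sub_neg_eq_add, ← smul_neg]

variable (b : (rootSystem H).Base)

theorem rootSpace_sup_eq_top :
    (⨆ i : {i : H.root // -(rootSystem H).root i ∈ b.cone},
      (rootSpace H ((rootSystem H).root i.1)).toSubmodule) ⊔
    (H.toSubmodule ⊔ ⨆ i : {i : H.root // (rootSystem H).root i ∈ b.cone},
      (rootSpace H ((rootSystem H).root i.1)).toSubmodule) = ⊤ := by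
  have h1 := iSup_genWeightSpace_eq_top' ℂ H 𝔰
  rw [← LieSubmodule.toSubmodule_inj, LieSubmodule.iSup_toSubmodule,
    LieSubmodule.top_toSubmodule] at h1
  rw [eq_top_iff, ← h1]
  refine iSup_le fun χ => ?_
  by_cases hχ : χ.IsZero
  · refine le_sup_of_le_right (le_sup_of_le_left ?_)
    rw [hχ.eq]
    exact fun x hx => by
      have : x ∈ rootSpace H 0 := hx
      rwa [LieAlgebra.rootSpace_zero_eq] at this
  · have hχ' : χ ∈ H.root := by simpa [LieSubalgebra.root] using hχ
    rcases b.root_mem_or_neg_mem ⟨χ, hχ'⟩ with h | h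
    · refine le_sup_of_le_right (le_sup_of_le_right ?_)
      exact le_iSup_of_le (⟨⟨χ, hχ'⟩, h⟩ : {i : H.root // (rootSystem H).root i ∈ b.cone}) le_rfl
    · refine le_sup_of_le_left ?_
      exact le_iSup_of_le (⟨⟨χ, hχ'⟩, h⟩ : {i : H.root // -(rootSystem H).root i ∈ b.cone}) le_rfl

/-- An irreducible module generated by a highest weight vector is spanned by vectors whose weights
are below the highest weight. -/
theorem le_iSup_weightVectors (hV : LieModule.IsIrreducible ℂ 𝔰 V) {v : M} (hv : v ≠ 0)
    (hvV : v ∈ V) {μ : Module.Dual ℂ H} (hvμ : v ∈ weightVectors M H μ)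
    (hpos : ∀ i : H.root, (rootSystem H).root i ∈ b.cone →
      ∀ x ∈ rootSpace H ((rootSystem H).root i), ⁅x, v⁆ = 0) :
    V.toSubmodule ≤ ⨆ γ : b.cone, V.toSubmodule ⊓ weightVectors M H (μ - γ) := by
  set S : Submodule ℂ M := ⨆ γ : b.cone, V.toSubmodule ⊓ weightVectors M H (μ - γ) with hS
  -- Triangular generation: the Borel subalgebra preserves the line of `v`, and the negative root
  -- spaces preserve `S`, since they enlarge the subtracted element of the cone.
  have hmain : S.comap V.toSubmodule.subtype = ⊤ := by
    refine LieHom.eq_top_of_triangular (LieModule.toEnd ℂ 𝔰 V) (rootSpace_sup_eq_top H b)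
      (N := Submodule.span ℂ {⟨v, hvV⟩}) ?_ ?_ ?_ ?_
    · have key : ∀ x ∈ H.toSubmodule ⊔ ⨆ i : {i : H.root // (rootSystem H).root i ∈ b.cone},
          (rootSpace H ((rootSystem H).root i.1)).toSubmodule, ∃ c : ℂ, ⁅x, v⁆ = c • v := by
        intro x hx
        let T : Submodule ℂ 𝔰 := (Submodule.span ℂ {v}).comap ((toEnd ℂ 𝔰 M : 𝔰 →ₗ[ℂ] Module.End ℂ M).flip v)
        have hT : H.toSubmodule ⊔ (⨆ i : {i : H.root // (rootSystem H).root i ∈ b.cone},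
          (rootSpace H ((rootSystem H).root i.1)).toSubmodule) ≤ T := by
          refine sup_le (fun h hh => ?_) (iSup_le fun i y hy => ?_)
          · exact Submodule.mem_span_singleton.mpr ⟨_, (hvμ ⟨h, hh⟩).symm⟩
          · exact Submodule.mem_span_singleton.mpr ⟨0, by
              rw [zero_smul]; exact (hpos i.1 i.2 y hy).symm⟩
        obtain ⟨c, hc⟩ := Submodule.mem_span_singleton.mp (hT hx)
        exact ⟨c, hc.symm⟩
      intro x hx w hw
      obtain ⟨c, rfl⟩ := Submodule.mem_span_singleton.mp hw
      obtain ⟨d, hd⟩ := key x hx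
      refine Submodule.mem_span_singleton.mpr ⟨c * d, Subtype.ext ?_⟩
      rw [map_smul]
      change (c * d) • v = c • ⁅x, v⁆
      rw [hd, mul_smul]
    · intro P hP hst
      let P' : LieSubmodule ℂ 𝔰 V := { P with lie_mem := fun {x m} hm => hst x m hm }
      have : P' ≠ ⊥ := by
        intro h0
        have h1 : (⟨v, hvV⟩ : V) ∈ P' := hP (Submodule.mem_span_singleton_self _)
        rw [h0, LieSubmodule.mem_bot] at h1
        exact hv (congrArg Subtype.val h1)
      have h2 : P' = ⊤ := (hV.eq_bot_or_eq_top P').resolve_left this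
      rw [eq_top_iff]
      intro w _
      have : w ∈ P' := h2 ▸ LieSubmodule.mem_top w
      exact this
    · rw [Submodule.span_singleton_le_iff_mem]
      refine Submodule.mem_iSup_of_mem (0 : b.cone) ⟨hvV, ?_⟩
      simpa using hvμ
    · intro x hx
      let T : Submodule ℂ 𝔰 :=
        { carrier := {x | ∀ w ∈ S, ⁅x, w⁆ ∈ S}
          zero_mem' := fun w _ => by rw [zero_lie]; exact zero_mem _
          add_mem' := fun ha hb w hw => by rw [add_lie]; exact add_mem (ha w hw) (hb w hw)
          smul_mem' := fun c a ha w hw => by rw [smul_lie]; exact S.smul_mem c (ha w hw) }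
      have hT : (⨆ i : {i : H.root // -(rootSystem H).root i ∈ b.cone},
          (rootSpace H ((rootSystem H).root i.1)).toSubmodule) ≤ T := by
        refine iSup_le fun i y hy w hw => ?_
        rw [hS] at hw
        induction hw using Submodule.iSup_induction' with
        | mem γ w hw =>
          refine Submodule.mem_iSup_of_mem (⟨γ + -(rootSystem H).root i.1, add_mem γ.2 i.2⟩ :
            b.cone) ⟨V.lie_mem hw.1, ?_⟩
          have := lie_mem_weightVectors H hy hw.2
          have h0 : μ - (γ : Module.Dual ℂ H) + (rootSystem H).root i.1 =
              μ - ((γ : Module.Dual ℂ H) + -(rootSystem H).root i.1) := by abel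
          rwa [h0] at this
        | zero => rw [lie_zero]; exact zero_mem _
        | add w w' _ _ h h' => rw [lie_add]; exact add_mem h h'
      exact fun w hw => hT hx w hw
  intro w hw
  have : (⟨w, hw⟩ : V) ∈ S.comap V.toSubmodule.subtype := hmain ▸ Submodule.mem_top
  exact this

end LieModule
end

/-! ### The weights that occur in a Lie torus. -/

section

namespace RootPairing.Base

variable {ι K M N : Type*} [Fintype ι] [Field K] [CharZero K] [AddCommGroup M] [Module K M]
  [AddCommGroup N] [Module K N] {P : RootPairing ι K M N} [P.IsRootSystem] [P.IsCrystallographic]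
  [P.IsReduced] (b : P.Base)

/-- The roots, their doubles, and zero. -/
def extendedRoots (P : RootPairing ι K M N) : Set M :=
  {χ | χ ∈ rootsOrZero P ∨ ∃ k, χ = 2 • P.root k}

theorem finite_extendedRoots : (extendedRoots P).Finite := by
  refine ((Set.finite_range P.root).insert 0).union (s := rootsOrZero P)
    ((Set.finite_range fun k => 2 • P.root k).subset ?_)
  rintro _ ⟨k, rfl⟩
  exact ⟨k, rfl⟩

theorem mem_cone_or_neg_mem_of_mem_extendedRoots {β : M} (hβ : β ∈ extendedRoots P) :
    β ∈ b.cone ∨ -β ∈ b.cone := by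
  rcases hβ with h | ⟨k, rfl⟩
  · exact b.mem_cone_or_neg_mem_of_mem_rootsOrZero h
  · rcases b.root_mem_or_neg_mem k with h | h
    · exact Or.inl (nsmul_mem h 2)
    · rw [← smul_neg]
      exact Or.inr (nsmul_mem h 2)

/-- The set of roots and zero is saturated and contains the highest weight. This covers both the
highest root and the highest short root. -/
theorem subset_extendedRoots_of_root {Q : Set M}
    (hQs : ∀ β ∈ Q, ∀ i ∈ b.support, P.reflection i β ∈ Q) {j : ι}
    (hQ : ∀ ν ∈ Q, P.root j - ν ∈ b.cone) : Q ⊆ extendedRoots P := fun _ hν =>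
  Or.inl (b.subset_of_reflection_stable (R := rootsOrZero P)
    (fun _ hβ _ _ h => sub_mem_rootsOrZero hβ h) (fun _ hβ i _ => reflection_mem_rootsOrZero hβ i)
    hQs (Or.inr ⟨j, rfl⟩) (Submodule.subset_span ⟨j, rfl⟩) hQ hν)

/-- The saturated set here consists of the roots, zero and the doubles of roots of minimal length
only: `two_smul_sub_mem` needs minimality to close the set under subtracting simple roots, and
reflections preserve lengths. -/
theorem subset_extendedRoots_of_typeB {l : ℕ} (e : Fin l ≃ b.support)
    (he : ∀ i j, b.cartanMatrix (e i) (e j) = CartanMatrix.B l i j) {Q : Set M}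
    (hQs : ∀ β ∈ Q, ∀ i ∈ b.support, P.reflection i β ∈ Q) {j : ι}
    (hj : ∀ k, (P.posRootForm ℤ).rootLength j ≤ (P.posRootForm ℤ).rootLength k)
    (hQ : ∀ ν ∈ Q, 2 • P.root j - ν ∈ b.cone) : Q ⊆ extendedRoots P := by
  have h := b.subset_of_reflection_stable (Q := Q) (R := {χ | χ ∈ rootsOrZero P ∨ ∃ k, (∀ k',
    (P.posRootForm ℤ).rootLength k ≤ (P.posRootForm ℤ).rootLength k') ∧ χ = 2 • P.root k})
    (μ := 2 • P.root j) ?_ ?_ hQs (Or.inr ⟨j, hj, rfl⟩)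
    (nsmul_mem (Submodule.subset_span (Set.mem_range_self j)) 2) hQ
  · intro ν hν
    rcases h hν with h' | ⟨k, -, hk⟩
    · exact Or.inl h'
    · exact Or.inr ⟨k, hk⟩
  · rintro β (hβ | ⟨k, hk, rfl⟩) i hi hm
    · exact Or.inl (sub_mem_rootsOrZero hβ hm)
    · refine Or.inl (Or.inr (b.two_smul_sub_mem e he hk hi ?_))
      obtain ⟨m, hm0, hm⟩ := hm
      have h1 : (algebraMap ℤ K) (P.pairingIn ℤ k i) = P.coroot' i (P.root k) :=
        P.algebraMap_pairingIn ℤ k i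
      rw [map_nsmul, ← h1, nsmul_eq_mul] at hm
      have h2 : 2 * P.pairingIn ℤ k i = m := by
        rw [eq_intCast] at hm; exact_mod_cast hm
      omega
  · rintro β (hβ | ⟨k, hk, rfl⟩) i hi
    · exact Or.inl (reflection_mem_rootsOrZero hβ i)
    · refine Or.inr ⟨P.reflectionPerm i k, fun k' => ?_, ?_⟩
      · rw [rootLength_reflectionPerm]; exact hk k'
      · rw [map_nsmul, root_reflectionPerm]

end RootPairing.Base

namespace MultiloopDatum

open LieAlgebra.IsKilling LieModule RootPairing.Base

variable {n : ℕ} {𝔤 : Type*} [LieRing 𝔤] [LieAlgebra ℂ 𝔤] [FiniteDimensional ℂ 𝔤]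
  (D : MultiloopDatum n 𝔤) [LieAlgebra.IsSimple ℂ D.gZero]
  (H : LieSubalgebra ℂ D.gZero) [H.IsCartanSubalgebra] (b : (rootSystem H).Base)

/-- A coweight `h` with `αᵢ(h) = 1` for all simple roots, and a bound for its eigenvalues. -/
theorem exists_heightVector (b : (rootSystem H).Base) : ∃ (h : H) (B : ℕ), 0 < B ∧
    ∀ χ ∈ extendedRoots (rootSystem H), ∃ z : ℤ, χ h = z ∧ |z| < B ∧
      (0 ≤ z → χ ∈ b.cone) ∧ (z ≤ 0 → -χ ∈ b.cone) := by
  obtain ⟨h, hh⟩ : ∃ h : H, ∀ χ : Module.Dual ℂ H, χ h = b.heightLin χ :=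
    ⟨(Module.evalEquiv ℂ H).symm b.heightLin, fun χ =>
      Module.apply_evalEquiv_symm_apply ..⟩
  have h1 : ∀ χ ∈ extendedRoots (rootSystem H), ∃ z : ℤ, χ h = z ∧
      (0 ≤ z → χ ∈ b.cone) ∧ (z ≤ 0 → -χ ∈ b.cone) := by
    intro χ hχ
    rcases b.mem_cone_or_neg_mem_of_mem_extendedRoots hχ with hc | hc
    · obtain ⟨k, hk, hk0⟩ := b.exists_heightLin_eq_nat hc
      refine ⟨k, by rw [hh, hk, Int.cast_natCast], fun _ => hc, fun hz => ?_⟩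
      rw [hk0 (by omega), neg_zero]; exact zero_mem _
    · obtain ⟨k, hk, hk0⟩ := b.exists_heightLin_eq_nat hc
      refine ⟨-k, by rw [hh, ← neg_neg χ, map_neg, hk]; simp, fun hz => ?_, fun _ => hc⟩
      rw [← neg_neg χ, hk0 (by omega), neg_zero]; exact zero_mem _
  choose! z hz using h1
  obtain ⟨B, hB⟩ := ((finite_extendedRoots (P := rootSystem H)).image fun χ => |z χ|).bddAbove
  -- The summand 1 makes the bound positive and the inequality strict.
  refine ⟨h, B.toNat + 1, by omega, fun χ hχ => ⟨z χ, (hz χ hχ).1, ?_, (hz χ hχ).2⟩⟩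
  have := hB ⟨χ, hχ, rfl⟩
  simp only at this
  have := Int.self_le_toNat B
  push_cast
  omega

-- The weights of `V` form a reflection-stable set below the highest weight, so the saturation
-- lemmas confine them; `V` is the sum of its weight spaces because it is generated from a highest
-- weight vector.
variable {D H b} in
theorem PropertyM.le_iSup {V : LieSubmodule ℂ D.gZero 𝔤} (hV : D.PropertyM H b V) :
    V.toSubmodule ≤ ⨆ χ : extendedRoots (rootSystem H),
      V.toSubmodule ⊓ weightVectors 𝔤 H χ.1 := by
  obtain ⟨hirr, hV⟩ := hV
  let Q : Set (Module.Dual ℂ H) := {χ | ∃ w ∈ V, w ≠ 0 ∧ w ∈ weightVectors 𝔤 H χ}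
  have hQs : ∀ β ∈ Q, ∀ i ∈ b.support, (rootSystem H).reflection i β ∈ Q := by
    rintro β ⟨w, hwV, hw0, hw⟩ i _
    exact exists_weightVector_reflection H V i hw0 hw hwV
  obtain ⟨μ, hwt, hμ⟩ : ∃ μ, D.IsHighestWeight H b V μ ∧
      ((∀ ν ∈ Q, μ - ν ∈ b.cone) → Q ⊆ extendedRoots (rootSystem H)) := by
    rcases hV with ⟨i, -, h⟩ | ⟨-, i, -, h⟩ | ⟨⟨l, e, he⟩, i, hi, h⟩
    · exact ⟨_, h, fun hQ => b.subset_extendedRoots_of_root hQs hQ⟩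
    · exact ⟨_, h, fun hQ => b.subset_extendedRoots_of_root hQs hQ⟩
    · exact ⟨_, h, fun hQ => b.subset_extendedRoots_of_typeB e he hQs hi.1 hQ⟩
  obtain ⟨v, hvV, hv0, hvμ, hpos⟩ := hwt
  have hle := le_iSup_weightVectors H V b hirr hv0 hvV hvμ hpos
  have hind := iSupIndep_weightVectors (M := 𝔤) H
  -- A weight not below `μ` would have its weight space inside the sum of the others, against their
  -- independence.
  have hQ : ∀ ν ∈ Q, μ - ν ∈ b.cone := by
    rintro ν ⟨w, hwV, hw0, hw⟩
    by_contra hν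
    refine hw0 ?_
    have h1 : w ∈ ⨆ (χ : Module.Dual ℂ H) (_ : χ ≠ ν), weightVectors 𝔤 H χ := by
      suffices h : V.toSubmodule ≤ ⨆ (χ : Module.Dual ℂ H) (_ : χ ≠ ν), weightVectors 𝔤 H χ from
        h hwV
      refine hle.trans (iSup_le fun γ => ?_)
      refine inf_le_right.trans (le_iSup₂_of_le (μ - (γ : Module.Dual ℂ H)) (fun h => hν ?_) le_rfl)
      rw [← h, sub_sub_cancel]
      exact γ.2
    have h2 := (hind ν).le_bot ⟨hw, h1⟩
    simpa using h2
  have hQR := hμ hQ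
  refine hle.trans (iSup_le fun γ => ?_)
  by_cases h0 : V.toSubmodule ⊓ weightVectors 𝔤 H (μ - (γ : Module.Dual ℂ H)) = ⊥
  · rw [h0]; exact bot_le
  · obtain ⟨w, hw, hw0⟩ := Submodule.exists_mem_ne_zero_of_ne_bot h0
    exact le_iSup_of_le (⟨_, hQR ⟨w, hw.1, hw0, hw.2⟩⟩ : extendedRoots (rootSystem H)) le_rfl

variable {D H b} (hLT : D.IsLieTorus H b)
include hLT

theorem IsLieTorus.piece_le_iSup (a : ℤ × (Fin n → ℤ)) :
    D.piece a ≤ ⨆ χ : extendedRoots (rootSystem H), D.rootPiece H χ.1 a := by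
  obtain ⟨U, V, -, hUV, hU, hV⟩ := hLT a
  have hUle : U.toSubmodule ≤ D.piece a := by
    rw [← hUV]; exact fun x hx => (le_sup_left : U ≤ U ⊔ V) hx
  have hVle : V.toSubmodule ≤ D.piece a := by
    rw [← hUV]; exact fun x hx => (le_sup_right : V ≤ U ⊔ V) hx
  conv_lhs => rw [← hUV, LieSubmodule.sup_toSubmodule]
  refine sup_le (fun x hx => ?_) ?_
  · refine Submodule.mem_iSup_of_mem (⟨0, Or.inl (Or.inl rfl)⟩ : extendedRoots (rootSystem H))
      ⟨hUle hx, fun h => ?_⟩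
    have := congrArg Subtype.val (hU.trivial (h : D.gZero) ⟨x, hx⟩)
    rw [LinearMap.zero_apply, zero_smul]
    exact this
  · rcases hV with rfl | hV
    · simp
    · refine hV.le_iSup.trans (iSup_mono fun χ x hx => ⟨hVle hx.1, hx.2⟩)

/-- Each piece is already exhausted by weights from the extended set, and weight spaces are
independent. From here on only finitely many weights matter. -/
theorem IsLieTorus.mem_extendedRoots {a : ℤ × (Fin n → ℤ)} {χ : Module.Dual ℂ H} {x : 𝔤}
    (hx : x ∈ D.rootPiece H χ a) (hx0 : x ≠ 0) : χ ∈ extendedRoots (rootSystem H) := by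
  by_contra hχ
  refine hx0 ?_
  have h1 : x ∈ ⨆ (ψ : Module.Dual ℂ H) (_ : ψ ≠ χ), weightVectors 𝔤 H ψ := by
    suffices h : D.piece a ≤ ⨆ (ψ : Module.Dual ℂ H) (_ : ψ ≠ χ), weightVectors 𝔤 H ψ from h hx.1
    refine (hLT.piece_le_iSup a).trans (iSup_le fun ψ => ?_)
    exact le_iSup₂_of_le ψ.1 (fun h => hχ (h ▸ ψ.2)) fun y hy => hy.2
  have h2 := (iSupIndep_weightVectors (M := 𝔤) H χ).le_bot ⟨hx.2, h1⟩
  simpa using h2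

end MultiloopDatum
end

section

attribute [local instance] LieRing.ofAssociativeRing

open scoped TensorProduct

/-! ### Lie algebras graded by the eigenvalues of an element -/

namespace LieAlgebra

universe u w

variable {L : Type u} [LieRing L] [LieAlgebra ℂ L] (r : L)

/-- The `c`-eigenspace of `ad r`. -/
noncomputable def grade (c : ℂ) : Submodule ℂ L := (LieAlgebra.ad ℂ L r).eigenspace c

theorem mem_grade {c : ℂ} {x : L} : x ∈ grade r c ↔ ⁅r, x⁆ = c • x :=
  Module.End.mem_eigenspace_iff

theorem lie_mem_grade {c d : ℂ} {x y : L} (hx : x ∈ grade r c) (hy : y ∈ grade r d) :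
    ⁅x, y⁆ ∈ grade r (c + d) := by
  rw [mem_grade] at *
  rw [leibniz_lie, hx, hy, smul_lie, lie_smul, add_smul]

theorem iSupIndep_grade : iSupIndep fun j : ℤ => grade r (j : ℂ) :=
  (Module.End.eigenspaces_iSupIndep (LieAlgebra.ad ℂ L r)).comp (f := fun j : ℤ => (j : ℂ))
    Int.cast_injective

/-- The sum of the grades in a set. -/
noncomputable def gradeSum (s : Set ℤ) : Submodule ℂ L := ⨆ j ∈ s, grade r (j : ℂ)

theorem grade_le_gradeSum {s : Set ℤ} {j : ℤ} (hj : j ∈ s) : grade r (j : ℂ) ≤ gradeSum r s :=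
  le_iSup₂_of_le j hj le_rfl

theorem gradeSum_induction {s : Set ℤ} {p : L → Prop} (mem : ∀ j ∈ s, ∀ x ∈ grade r (j : ℂ), p x)
    (zero : p 0) (add : ∀ x y, p x → p y → p (x + y)) {x : L} (hx : x ∈ gradeSum r s) : p x := by
  rw [gradeSum, iSup_subtype'] at hx
  induction hx using Submodule.iSup_induction' with
  | mem j x hx => exact mem j.1 j.2 x hx
  | zero => exact zero
  | add x y _ _ hx hy => exact add x y hx hy

theorem lie_mem_gradeSum {s t u : Set ℤ} (h : ∀ i ∈ s, ∀ j ∈ t, i + j ∈ u) {x y : L}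
    (hx : x ∈ gradeSum r s) (hy : y ∈ gradeSum r t) : ⁅x, y⁆ ∈ gradeSum r u := by
  refine gradeSum_induction r (p := fun x => ⁅x, y⁆ ∈ gradeSum r u) (fun i hi x hx => ?_) ?_
    (fun x x' h h' => ?_) hx
  · refine gradeSum_induction r (p := fun y => ⁅x, y⁆ ∈ gradeSum r u) (fun j hj y hy => ?_) ?_
      (fun y y' h h' => ?_) hy
    · have := lie_mem_grade r hx hy
      rw [← Int.cast_add] at this
      exact grade_le_gradeSum r (h i hi j hj) this
    · rw [lie_zero]; exact zero_mem _
    · rw [lie_add]; exact add_mem h h'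
  · rw [zero_lie]; exact zero_mem _
  · rw [add_lie]; exact add_mem h h'

theorem gradeSum_mono {s t : Set ℤ} (h : s ⊆ t) : gradeSum r s ≤ gradeSum r t :=
  biSup_mono h

theorem disjoint_gradeSum {s t : Set ℤ} (h : Disjoint s t) :
    Disjoint (gradeSum r s) (gradeSum r t) :=
  (iSupIndep_grade r).disjoint_biSup_biSup h

/-- The subalgebra of negative grades. -/
noncomputable def negPart : LieSubalgebra ℂ L where
  __ := gradeSum r (Set.Iio 0)
  lie_mem' := fun {_ _} hx hy =>
    lie_mem_gradeSum r (fun _ hi _ hj => add_neg (Set.mem_Iio.mp hi) (Set.mem_Iio.mp hj)) hx hy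

theorem isCompl_gradeSum (hr : gradeSum r Set.univ = ⊤) (s : Set ℤ) :
    IsCompl (gradeSum r s) (gradeSum r sᶜ) := by
  refine ⟨disjoint_gradeSum r disjoint_compl_right, ?_⟩
  rw [codisjoint_iff, eq_top_iff, ← hr]
  refine iSup₂_le fun j _ => ?_
  by_cases hj : j ∈ s
  · exact le_sup_of_le_left (grade_le_gradeSum r hj)
  · exact le_sup_of_le_right (grade_le_gradeSum r hj)

variable {r} (hr : gradeSum r Set.univ = ⊤) {L0 : LieSubalgebra ℂ L}
  (hL0 : ∀ x, x ∈ L0 ↔ x ∈ grade r 0) (N : Type w) [AddCommGroup N] [Module ℂ N]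
  [LieRingModule L0 N] [LieModule ℂ L0 N]

include hr hL0 in
/-- A module over the degree zero part, on which positive grades act by zero, embeds into a
representation of the whole graded Lie algebra. -/
theorem exists_rep_of_grade_zero :
    ∃ (W : Type (max u w)) (_ : AddCommGroup W) (_ : Module ℂ W) (σ : L →ₗ⁅ℂ⁆ Module.End ℂ W)
      (f : N →ₗ[ℂ] W), Function.Injective f ∧ (∀ (x : L0) v, σ x (f v) = f ⁅x, v⁆) ∧
      ∀ x ∈ gradeSum r (Set.Ioi 0), ∀ v, σ x (f v) = 0 := by
  have hneg := isCompl_gradeSum r hr (Set.Iio 0)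
  have hzero := isCompl_gradeSum r hr {0}
  have hcompl : (Set.Iio (0 : ℤ))ᶜ = Set.Ici 0 := by ext; simp
  rw [hcompl] at hneg
  -- The induced-module construction is applied with the negative part as `A` and the non-negative
  -- part as its complement.
  let pA : L →ₗ[ℂ] negPart r := Submodule.projectionOnto _ _ hneg
  have hA : ∀ y : negPart r, pA y = y := fun y =>
    Submodule.projectionOnto_apply_left hneg y
  have hpA : ∀ x ∈ gradeSum r (Set.Ici 0), pA x = 0 := fun x hx =>
    Submodule.projectionOnto_apply_of_mem_right hneg hx
  have hc : ∀ x, Induced.compl pA x ∈ gradeSum r (Set.Ici 0) := by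
    intro x
    have h1 := Induced.add_compl pA x
    have h2 : x ∈ gradeSum r (Set.Iio 0) ⊔ gradeSum r (Set.Ici 0) := by
      rw [hneg.sup_eq_top]; trivial
    obtain ⟨a, ha, c, hc, rfl⟩ := Submodule.mem_sup.mp h2
    have h3 : pA (a + c) = ⟨a, ha⟩ := by
      rw [map_add, hpA c hc, add_zero]; exact hA ⟨a, ha⟩
    rw [h3] at h1
    rw [add_left_cancel h1]
    exact hc
  have hcc : ∀ x ∈ gradeSum r (Set.Ici 0), Induced.compl pA x = x := fun x hx => by
    have h1 := Induced.add_compl pA x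
    rwa [hpA x hx, ZeroMemClass.coe_zero, zero_add] at h1
  have hL0' : ∀ x : gradeSum r {0}, (x : L) ∈ L0 := fun x => by
    rw [hL0]
    have := x.2
    simp only [gradeSum, Set.mem_singleton_iff, iSup_iSup_eq_left, Int.cast_zero] at this
    exact this
  let p0 : L →ₗ[ℂ] L0 := LinearMap.codRestrict L0.toSubmodule
    ((gradeSum r {0}).subtype ∘ₗ Submodule.projectionOnto _ _ hzero) fun x => hL0' _
  have hp0 : ∀ x : L0, p0 x = x := fun x => Subtype.ext (by
    have hx : (x : L) ∈ gradeSum r {0} := by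
      have := (hL0 _).mp x.2
      simpa [gradeSum] using this
    have := Submodule.projectionOnto_apply_left hzero ⟨x, hx⟩
    have h := congrArg Subtype.val this
    exact h)
  have hp0' : ∀ x ∈ gradeSum r (Set.Ioi 0), p0 x = 0 := fun x hx => Subtype.ext (by
    have hx' : x ∈ gradeSum r {0}ᶜ := gradeSum_mono r (fun j hj => ne_of_gt hj) hx
    have := Submodule.projectionOnto_apply_of_mem_right hzero hx'
    have h := congrArg Subtype.val this
    exact h)
  -- The action of the degree zero part, precomposed with the projection to degree zero. It is
  -- multiplicative on the non-negative part, because brackets involving a positive degree have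
  -- positive degree.
  let β : L →ₗ[ℂ] Module.End ℂ N := (LieModule.toEnd ℂ L0 N : L0 →ₗ[ℂ] Module.End ℂ N) ∘ₗ p0
  have hβ0 : ∀ (x : L0), β x = LieModule.toEnd ℂ L0 N x := fun x => by simp [β, hp0]
  have hβp : ∀ x ∈ gradeSum r (Set.Ioi 0), β x = 0 := fun x hx => by simp [β, hp0' x hx]
  have hβ : ∀ x ∈ gradeSum r (Set.Ici 0), ∀ y ∈ gradeSum r (Set.Ici 0),
      β ⁅x, y⁆ = ⁅β x, β y⁆ := by
    intro x hx y hy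
    refine gradeSum_induction r (p := fun x => β ⁅x, y⁆ = ⁅β x, β y⁆) (fun i hi x hx => ?_)
      (by simp) (fun x x' h h' => by rw [add_lie, map_add, h, h', map_add, add_lie]) hx
    refine gradeSum_induction r (p := fun y => β ⁅x, y⁆ = ⁅β x, β y⁆) (fun j hj y hy => ?_)
      (by simp) (fun y y' h h' => by rw [lie_add, map_add, h, h', map_add, lie_add]) hy
    have hxy := lie_mem_grade r hx hy
    rw [← Int.cast_add] at hxy
    rcases (Set.mem_Ici.mp hi).eq_or_lt with rfl | hi'
    · rcases (Set.mem_Ici.mp hj).eq_or_lt with rfl | hj'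
      · rw [Int.cast_zero] at hx hy
        have h1 := hβ0 ⁅(⟨x, (hL0 x).mpr hx⟩ : L0), (⟨y, (hL0 y).mpr hy⟩ : L0)⁆
        rw [LieHom.map_lie, ← hβ0, ← hβ0] at h1
        exact h1
      · rw [hβp _ (grade_le_gradeSum r (by simpa using hj') hxy),
          hβp y (grade_le_gradeSum r hj' hy), lie_zero]
    · have hj' := Set.mem_Ici.mp hj
      rw [hβp _ (grade_le_gradeSum r (show i + j ∈ Set.Ioi 0 from Set.mem_Ioi.mpr (by omega)) hxy),
        hβp x (grade_le_gradeSum r hi' hx), zero_lie]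
  obtain ⟨σ, hσ⟩ := Induced.exists_extension pA hA β
    (fun x y => hpA _ (lie_mem_gradeSum r (fun i hi j hj => add_nonneg hi hj) (hc x) (hc y)))
    (fun x y => hβ _ (hc x) _ (hc y))
  refine ⟨UniversalEnvelopingAlgebra ℂ (negPart r) ⊗[ℂ] N, inferInstance, inferInstance, σ,
    TensorProduct.mk ℂ (UniversalEnvelopingAlgebra ℂ (negPart r)) N 1, Induced.one_tmul_injective, ?_, ?_⟩
  · intro x v
    have hx : (x : L) ∈ gradeSum r (Set.Ici 0) :=
      grade_le_gradeSum r (j := 0) (by simp) (by rw [Int.cast_zero]; exact (hL0 _).mp x.2)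
    have := hσ x v
    rw [hcc _ hx, hβ0] at this
    exact this
  · intro x hx v
    have hx' := gradeSum_mono r Set.Ioi_subset_Ici_self hx
    have := hσ x v
    rw [hcc _ hx', hβp x hx] at this
    simpa using this

end LieAlgebra
end

section

/-! ### Elements of the Lie algebra of a multiloop datum -/

namespace MultiloopDatum

variable {n : ℕ} {𝔤 : Type*} [LieRing 𝔤] [LieAlgebra ℂ 𝔤] (D : MultiloopDatum n 𝔤)

section Tens

variable (a c : ℤ × (Fin n → ℤ)) (X Y : 𝔤) (p q : AddMonoidAlgebra ℂ (Fin n → ℤ))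

@[simp] theorem tens_single (l : Fin n → ℤ) (r : ℂ) :
    tens a X (AddMonoidAlgebra.single l r) = Finsupp.single (a.1, a.2 + l) (r • X) := by
  simp [tens]

@[simp] theorem tens_zero : tens a X (0 : AddMonoidAlgebra ℂ (Fin n → ℤ)) = 0 := by
  simp [tens]

theorem tens_add : tens a X (p + q) = tens a X p + tens a X q := by
  rw [tens, AddMonoidAlgebra.coeff_add]
  exact Finsupp.sum_add_index' (by simp) (by simp [add_smul])

theorem tens_smul (r : ℂ) : tens a X (r • p) = r • tens a X p := by
  induction p using AddMonoidAlgebra.induction_linear with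
  | zero => simp
  | add p q hp hq => rw [smul_add, tens_add, hp, hq, tens_add, smul_add]
  | single l s => simp [mul_smul]

theorem tens_add_left : tens a (X + Y) p = tens a X p + tens a Y p := by
  induction p using AddMonoidAlgebra.induction_linear with
  | zero => simp
  | add p q hp hq => rw [tens_add, hp, hq, tens_add, tens_add]; abel
  | single l s => simp

theorem tens_smul_left (r : ℂ) : tens a (r • X) p = r • tens a X p := by
  induction p using AddMonoidAlgebra.induction_linear with
  | zero => simp
  | add p q hp hq => rw [tens_add, hp, hq, tens_add, smul_add]
  | single l s => simp [smul_comm r s]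

theorem loopBracket_tens :
    loopBracket n 𝔤 (tens a X p) (tens c Y q) = tens (a + c) ⁅X, Y⁆ (p * q) := by
  induction p using AddMonoidAlgebra.induction_linear with
  | zero => simp
  | add p p' hp hp' => rw [tens_add, map_add, LinearMap.add_apply, hp, hp', add_mul, tens_add]
  | single l r =>
    induction q using AddMonoidAlgebra.induction_linear with
    | zero => simp
    | add q q' hq hq' => rw [tens_add, map_add, hq, hq', mul_add, tens_add]
    | single l' r' =>
      rw [AddMonoidAlgebra.single_mul_single, tens_single, tens_single, tens_single,
        loopBracket_single, smul_lie, lie_smul, smul_smul]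
      congr 1
      ext1
      · rfl
      · simp only [Prod.snd_add]; abel

theorem deg_tens : deg n 𝔤 (tens a X p) = (a.1 : ℂ) • tens a X p := by
  induction p using AddMonoidAlgebra.induction_linear with
  | zero => simp
  | add p p' hp hp' => rw [tens_add, map_add, hp, hp', smul_add]
  | single l r => rw [tens_single, deg_single]

theorem cocycle_tens : D.cocycle (tens a X p) (tens c Y q) =
    if a.1 + c.1 = 0 then AddMonoidAlgebra.single (a.2 + c.2) ((a.1 : ℂ) * D.form X Y) * (p * q)
    else 0 := by
  induction p using AddMonoidAlgebra.induction_linear with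
  | zero => simp
  | add p p' hp hp' =>
    rw [tens_add, map_add, LinearMap.add_apply, hp, hp', add_mul, mul_add]
    split_ifs <;> simp
  | single l r =>
    induction q using AddMonoidAlgebra.induction_linear with
    | zero => simp
    | add q q' hq hq' =>
      rw [tens_add, map_add, hq, hq', mul_add, mul_add]
      split_ifs <;> simp
    | single l' r' =>
      rw [tens_single, tens_single, cocycle_single]
      dsimp only
      split_ifs
      · rw [AddMonoidAlgebra.single_mul_single, AddMonoidAlgebra.single_mul_single, map_smul,
          map_smul, LinearMap.smul_apply, smul_eq_mul, smul_eq_mul]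
        congr 1
        · abel
        · ring
      · rfl

end Tens

theorem zpow_eq_zpow_of_dvd {i : Fin (n + 1)} {k l : ℤ} (h : (D.m i : ℤ) ∣ k - l) :
    D.ξ i ^ k = D.ξ i ^ l := by
  have h1 := ((D.ξ_primitive i).zpow_eq_one_iff_dvd _).mpr h
  rw [zpow_sub₀ (D.ξ_ne_zero i)] at h1
  exact (div_eq_one_iff_eq (zpow_ne_zero _ (D.ξ_ne_zero i))).mp h1

theorem piece_congr {a c : ℤ × (Fin n → ℤ)} (h0 : (D.m 0 : ℤ) ∣ a.1 - c.1)
    (h : a.2 - c.2 ∈ D.Γ) : D.piece a = D.piece c := by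
  have h1 := D.zpow_eq_zpow_of_dvd h0
  have h2 : ∀ i : Fin n, D.ξ i.succ ^ a.2 i = D.ξ i.succ ^ c.2 i := fun i =>
    D.zpow_eq_zpow_of_dvd (h i)
  ext x
  change (_ ∧ _) ↔ (_ ∧ _)
  simp only [h1, h2]

theorem rootPiece_congr (H : LieSubalgebra ℂ D.gZero) (χ : Module.Dual ℂ H)
    {a c : ℤ × (Fin n → ℤ)} (h0 : (D.m 0 : ℤ) ∣ a.1 - c.1)
    (h : a.2 - c.2 ∈ D.Γ) : D.rootPiece H χ a = D.rootPiece H χ c := by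
  ext x
  change (_ ∧ _) ↔ (_ ∧ _)
  rw [D.piece_congr h0 h]

theorem lie_mem_rootPiece {H : LieSubalgebra ℂ D.gZero} {α β : Module.Dual ℂ H}
    {a c : ℤ × (Fin n → ℤ)} {X Y : 𝔤} (hX : X ∈ D.rootPiece H α a) (hY : Y ∈ D.rootPiece H β c) :
    ⁅X, Y⁆ ∈ D.rootPiece H (α + β) (a + c) := by
  refine ⟨D.lie_mem_piece hX.1 hY.1, fun h => ?_⟩
  rw [leibniz_lie, hX.2, hY.2, smul_lie, lie_smul, LinearMap.add_apply, add_smul]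

theorem tens_mem_piece {a : ℤ × (Fin n → ℤ)} {X : 𝔤} (hX : X ∈ D.piece a)
    {p : AddMonoidAlgebra ℂ (Fin n → ℤ)} (hp : p ∈ D.Am) (c : ℤ × (Fin n → ℤ)) :
    tens a X p c ∈ D.piece c := by
  classical
  rw [tens, Finsupp.sum, Finsupp.finsetSum_apply]
  refine sum_mem fun l hl => ?_
  rw [Finsupp.single_apply]
  split_ifs with h
  · have : D.piece a = D.piece c := by
      refine D.piece_congr (by rw [← h]; simp) ?_
      rw [← h]
      simpa using D.Γ.neg_mem (hp l (Finsupp.mem_support_iff.mp hl))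
    rw [← this]
    exact Submodule.smul_mem _ _ hX
  · exact zero_mem _

theorem tens_mem_rootPiece {H : LieSubalgebra ℂ D.gZero} {χ : Module.Dual ℂ H}
    {a : ℤ × (Fin n → ℤ)} {X : 𝔤} (hX : X ∈ D.rootPiece H χ a)
    {p : AddMonoidAlgebra ℂ (Fin n → ℤ)} (hp : p ∈ D.Am) (c : ℤ × (Fin n → ℤ)) :
    tens a X p c ∈ D.rootPiece H χ c := by
  refine ⟨D.tens_mem_piece hX.1 hp c, fun h => ?_⟩
  classical
  rw [tens, Finsupp.sum, Finsupp.finsetSum_apply, lie_sum, Finset.smul_sum]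
  refine Finset.sum_congr rfl fun l _ => ?_
  rw [Finsupp.single_apply]
  split_ifs
  · rw [lie_smul, hX.2, smul_comm]
  · simp

theorem tens_apply_of_ne {a c : ℤ × (Fin n → ℤ)} (h : c.1 ≠ a.1) (X : 𝔤)
    (p : AddMonoidAlgebra ℂ (Fin n → ℤ)) : tens a X p c = 0 := by
  classical
  rw [tens, Finsupp.sum, Finsupp.finsetSum_apply]
  refine Finset.sum_eq_zero fun l _ => ?_
  rw [Finsupp.single_apply, if_neg]
  rintro rfl
  exact h rfl

/-- The monomial `t^k` of `A(m)`. -/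
noncomputable def mon (k : D.Γ) : D.Am :=
  ⟨AddMonoidAlgebra.single (k : Fin n → ℤ) 1, fun l hl => by
    classical
    rw [AddMonoidAlgebra.coeff_single, Finsupp.single_apply] at hl
    split_ifs at hl with h
    · exact h ▸ k.2
    · exact absurd rfl hl⟩

variable [FiniteDimensional ℂ 𝔤] [LieAlgebra.IsSimple ℂ 𝔤]

/-- The element `X ⊗ t₀^{k₀} t^k p` of `𝔏`. -/
noncomputable def tensEl (a : ℤ × (Fin n → ℤ)) : D.piece a →ₗ[ℂ] D.Am →ₗ[ℂ] D.L :=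
  LinearMap.mk₂ ℂ (fun X p => ⟨⟨tens a (X : 𝔤) p, 0, 0⟩,
      fun c => D.tens_mem_piece X.2 p.2 c, zero_mem _⟩)
    (fun X Y p => by
      apply Subtype.ext
      ext1
      · exact tens_add_left ..
      · simp
      · simp)
    (fun r X p => by
      apply Subtype.ext
      ext1
      · exact tens_smul_left ..
      · simp
      · simp)
    (fun X p q => by
      apply Subtype.ext
      ext1
      · exact tens_add ..
      · simp
      · simp)
    (fun r X p => by
      apply Subtype.ext
      ext1
      · exact tens_smul ..
      · simp
      · simp)

theorem coe_tensEl (a : ℤ × (Fin n → ℤ)) (X : D.piece a) (p : D.Am) :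
    (D.tensEl a X p : D.Ambient) = ⟨tens a (X : 𝔤) p, 0, 0⟩ := rfl

/-- The element `K ⊗ p` of `𝔏`. -/
noncomputable def centEl : D.Am →ₗ[ℂ] D.L where
  toFun p := ⟨⟨0, p, 0⟩, fun _ => zero_mem _, p.2⟩
  map_add' p q := by
    apply Subtype.ext
    ext1 <;> simp
  map_smul' r p := by
    apply Subtype.ext
    ext1 <;> simp

theorem coe_centEl (p : D.Am) :
    (D.centEl p : D.Ambient) = ⟨0, (p : AddMonoidAlgebra ℂ (Fin n → ℤ)), 0⟩ := rfl

/-- The element `d₀` of `𝔏`. -/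
noncomputable def derEl : D.L := ⟨⟨0, 0, 1⟩, fun _ => zero_mem _, zero_mem _⟩

theorem coe_derEl : (D.derEl : D.Ambient) = ⟨0, 0, 1⟩ := rfl

/-- The central term of the bracket of two elements of `𝔏`. -/
noncomputable def centTerm (a c : ℤ × (Fin n → ℤ)) (X : D.piece a) (Y : D.piece c) : D.Am :=
  ⟨if a.1 + c.1 = 0 then AddMonoidAlgebra.single (a.2 + c.2) ((a.1 : ℂ) * D.form X Y) else 0, by
    have := D.cocycle_mem (D.tensEl a X 1).2.1 (D.tensEl c Y 1).2.1
    rw [coe_tensEl, coe_tensEl, cocycle_tens] at this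
    simpa using this⟩

/-- The bracket of two elements of `𝔤(k̄₀,k̄)` and `𝔤(l̄₀,l̄)`. -/
def lieEl {a c : ℤ × (Fin n → ℤ)} (X : D.piece a) (Y : D.piece c) : D.piece (a + c) :=
  ⟨⁅(X : 𝔤), (Y : 𝔤)⁆, D.lie_mem_piece X.2 Y.2⟩

theorem lie_tensEl {a c : ℤ × (Fin n → ℤ)} (X : D.piece a) (Y : D.piece c) (p q : D.Am) :
    ⁅D.tensEl a X p, D.tensEl c Y q⁆ =
      D.tensEl (a + c) (D.lieEl X Y) (p * q) + D.centEl (D.centTerm a c X Y * (p * q)) := by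
  apply Subtype.ext
  rw [LieSubalgebra.coe_bracket, AddMemClass.coe_add, coe_tensEl, coe_tensEl, coe_tensEl,
    coe_centEl]
  ext1
  · simp [loopBracket_tens, lieEl]
  · simp only [Ambient.cent_lie, cocycle_tens, Ambient.cent_add, zero_add, centTerm,
      MulMemClass.coe_mul]
    split_ifs <;> simp
  · simp

theorem lie_centEl (x : D.L) (p : D.Am) : ⁅x, D.centEl p⁆ = 0 := by
  apply Subtype.ext
  rw [LieSubalgebra.coe_bracket, coe_centEl]
  ext1 <;> simp

theorem lie_derEl_tensEl (a : ℤ × (Fin n → ℤ)) (X : D.piece a) (p : D.Am) :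
    ⁅D.derEl, D.tensEl a X p⁆ = (a.1 : ℂ) • D.tensEl a X p := by
  apply Subtype.ext
  rw [LieSubalgebra.coe_bracket, SetLike.val_smul, coe_tensEl, coe_derEl]
  ext1 <;> simp [deg_tens]

theorem tensEl_mem_rootSpaceL {H : LieSubalgebra ℂ D.gZero} {χ : Module.Dual ℂ H}
    {a : ℤ × (Fin n → ℤ)} (X : D.piece a) (hX : (X : 𝔤) ∈ D.rootPiece H χ a) (p : D.Am) :
    D.tensEl a X p ∈ D.rootSpaceL H χ a.1 :=
  ⟨fun c => D.tens_mem_rootPiece hX p.2 c, fun _ hc => tens_apply_of_ne hc _ _,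
    fun _ => ⟨rfl, rfl⟩⟩

theorem centEl_mem_rootSpaceL (H : LieSubalgebra ℂ D.gZero) (p : D.Am) :
    D.centEl p ∈ D.rootSpaceL H 0 0 :=
  ⟨fun _ => zero_mem _, fun _ _ => rfl, fun h => by simp at h⟩

theorem derEl_mem_rootSpaceL (H : LieSubalgebra ℂ D.gZero) : D.derEl ∈ D.rootSpaceL H 0 0 :=
  ⟨fun _ => zero_mem _, fun _ _ => rfl, fun h => by simp at h⟩

theorem tensEl_mon (a : ℤ × (Fin n → ℤ)) (X : D.piece a) (k : D.Γ) :
    (D.tensEl a X (D.mon k) : D.Ambient) = ⟨Finsupp.single (a.1, a.2 + k) (X : 𝔤), 0, 0⟩ := by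
  rw [coe_tensEl, mon, tens_single, one_smul]

/-- A shift of the exponent by `Γ` does not change the space of coefficients in `𝔤`, so it can be
absorbed into a monomial of `A(m)`. Only finitely many residues of exponents remain. -/
theorem tensEl_mon_eq {a c : ℤ × (Fin n → ℤ)} (X : D.piece a) (Y : D.piece c) (k : D.Γ)
    (h1 : a.1 = c.1) (h2 : a.2 + k = c.2) (hXY : (X : 𝔤) = Y) :
    D.tensEl c Y 1 = D.tensEl a X (D.mon k) := by
  apply Subtype.ext
  rw [tensEl_mon, coe_tensEl, h1, h2, hXY, OneMemClass.coe_one, AddMonoidAlgebra.one_def,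
    tens_single, one_smul, add_zero]

/-- The homogeneous elements `X ⊗ t₀^{k₀} t^k`, `K ⊗ p` and `d₀` of `𝔏`. -/
inductive IsHomogeneous (H : LieSubalgebra ℂ D.gZero) : D.L → Prop
  | tens (χ : Module.Dual ℂ H) (a : ℤ × (Fin n → ℤ)) (X : D.piece a)
    (hX : (X : 𝔤) ∈ D.rootPiece H χ a) (h0 : (X : 𝔤) ≠ 0) : IsHomogeneous H (D.tensEl a X 1)
  | cent (p : D.Am) : IsHomogeneous H (D.centEl p)
  | der : IsHomogeneous H D.derEl

theorem span_isHomogeneous (H : LieSubalgebra ℂ D.gZero)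
    (hH : ∀ a, D.piece a ≤ ⨆ χ, D.rootPiece H χ a) :
    Submodule.span ℂ {x | D.IsHomogeneous H x} = ⊤ := by
  set S := Submodule.span ℂ {x | D.IsHomogeneous H x} with hS
  have h1 : ∀ a (X : D.piece a), D.tensEl a X 1 ∈ S := by
    intro a X
    have h2 : D.piece a ≤ (S.comap ((D.tensEl a).flip 1)).map (D.piece a).subtype := by
      refine (hH a).trans (iSup_le fun χ x hx => ⟨⟨x, hx.1⟩, ?_, rfl⟩)
      by_cases h0 : x = 0
      · subst h0
        exact zero_mem _
      · exact Submodule.subset_span (.tens χ a _ hx h0)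
    obtain ⟨Y, hY, hXY⟩ := h2 X.2
    rw [← Subtype.ext hXY]
    exact hY
  rw [eq_top_iff]
  intro x _
  have h2 : x = (∑ a ∈ (x : D.Ambient).loop.support, D.tensEl a ⟨_, x.2.1 a⟩ 1) +
      D.centEl ⟨_, x.2.2⟩ + (x : D.Ambient).der • D.derEl := by
    have hl : ∀ s : Finset (ℤ × (Fin n → ℤ)),
        ((∑ a ∈ s, D.tensEl a ⟨_, x.2.1 a⟩ 1 : D.L) : D.Ambient) =
          ⟨∑ a ∈ s, Finsupp.single a ((x : D.Ambient).loop a), 0, 0⟩ := by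
      classical
      intro s
      induction s using Finset.induction_on with
      | empty => rfl
      | insert a s ha ih =>
        rw [Finset.sum_insert ha, Finset.sum_insert ha, AddMemClass.coe_add, ih, coe_tensEl,
          OneMemClass.coe_one, AddMonoidAlgebra.one_def, tens_single, one_smul, add_zero]
        ext1 <;> simp
    apply Subtype.ext
    rw [AddMemClass.coe_add, AddMemClass.coe_add, hl, coe_centEl, SetLike.val_smul,
      coe_derEl]
    ext1
    · simp only [Ambient.loop_add, Ambient.loop_smul, smul_zero, add_zero]
      exact (Finsupp.sum_single _).symm
    · simp
    · simp
  rw [h2]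
  exact add_mem (add_mem (sum_mem fun a _ => h1 a _) (Submodule.subset_span (.cent _)))
    (S.smul_mem _ (Submodule.subset_span .der))

/-- The cocycle vanishes because the loop part of `r` has `t₀`-degree zero. If the eigenvalue is
non-zero, then `(χ, k₀) ≠ (0, 0)` and `x` has no component in `K ⊗ A(m) ⊕ ℂ d₀`. -/
theorem lie_eq_smul_of_mem_hTilde {H : LieSubalgebra ℂ D.gZero} {χ : Module.Dual ℂ H} {k₀ : ℤ}
    {r x : D.L} {h : H} (hr : (r : D.Ambient).loop = Finsupp.single 0 ((h : D.gZero) : 𝔤))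
    (hx : x ∈ D.rootSpaceL H χ k₀) :
    ⁅r, x⁆ = (χ h + (r : D.Ambient).der * k₀) • x := by
  obtain ⟨h1, h2, h3⟩ := hx
  have hb : ∀ f : (ℤ × (Fin n → ℤ)) →₀ 𝔤, (∀ a, f a ∈ D.rootPiece H χ a) →
      loopBracket n 𝔤 (Finsupp.single 0 ((h : D.gZero) : 𝔤)) f = χ h • f := by
    intro f hf
    conv_lhs => rw [← Finsupp.sum_single f]
    conv_rhs => rw [← Finsupp.sum_single f]
    rw [Finsupp.sum, map_sum, Finset.smul_sum]
    refine Finset.sum_congr rfl fun a _ => ?_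
    rw [loopBracket_single, zero_add, (hf a).2, Finsupp.smul_single]
  have hd : deg n 𝔤 (x : D.Ambient).loop = (k₀ : ℂ) • (x : D.Ambient).loop := by
    ext a
    rw [deg_apply, Finsupp.smul_apply]
    by_cases ha : a.1 = k₀
    · rw [ha]
    · rw [h2 a ha, smul_zero, smul_zero]
  have hd' : deg n 𝔤 (r : D.Ambient).loop = 0 := by rw [hr]; simp
  have hz : (χ h + (r : D.Ambient).der * k₀) ≠ 0 →
      (x : D.Ambient).cent = 0 ∧ (x : D.Ambient).der = 0 := by
    intro hne
    refine h3 ?_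
    by_contra! h0
    refine hne ?_
    rw [h0.1, h0.2]
    simp
  apply Subtype.ext
  rw [LieSubalgebra.coe_bracket, SetLike.val_smul]
  ext1
  · rw [Ambient.loop_lie, hd, hd', hr, hb _ h1, smul_zero, sub_zero, smul_smul, ← add_smul]
    rfl
  · rw [Ambient.cent_lie, Ambient.cent_smul]
    have h4 : D.cocycle (r : D.Ambient).loop (x : D.Ambient).loop = 0 := by
      rw [hr]
      conv_lhs => rw [← Finsupp.sum_single (x : D.Ambient).loop]
      rw [Finsupp.sum, map_sum]
      refine Finset.sum_eq_zero fun a _ => ?_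
      rw [cocycle_single]
      simp
    rw [h4]
    by_cases hc : (χ h + (r : D.Ambient).der * k₀) = 0
    · rw [hc, zero_smul]
    · rw [(hz hc).1, smul_zero]
  · rw [Ambient.der_lie, Ambient.der_smul]
    by_cases hc : (χ h + (r : D.Ambient).der * k₀) = 0
    · rw [hc, zero_smul]
    · rw [(hz hc).2, smul_zero]

end MultiloopDatum
end

section

/-! ### The principal grading -/

namespace MultiloopDatum

open LieAlgebra.IsKilling LieModule RootPairing.Base LieAlgebra

variable {n : ℕ} {𝔤 : Type*} [LieRing 𝔤] [LieAlgebra ℂ 𝔤] [FiniteDimensional ℂ 𝔤]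
  [LieAlgebra.IsSimple ℂ 𝔤]
  (D : MultiloopDatum n 𝔤) [LieAlgebra.IsSimple ℂ D.gZero]
  (H : LieSubalgebra ℂ D.gZero) [H.IsCartanSubalgebra] (b : (rootSystem H).Base)

theorem eq_zero_of_mem_cone_of_neg_mem {χ : Module.Dual ℂ H} (h1 : χ ∈ b.cone) (h2 : -χ ∈ b.cone) :
    χ = 0 := by
  obtain ⟨k, hk, hk0⟩ := b.exists_heightLin_eq_nat h1
  obtain ⟨l, hl, -⟩ := b.exists_heightLin_eq_nat h2
  rw [map_neg, hk] at hl
  have : ((k + l : ℕ) : ℂ) = 0 := by push_cast; rw [← hl]; ring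
  rw [Nat.cast_eq_zero] at this
  exact hk0 (by omega)

/-- An element `r` of `𝔥̃(0)` whose eigenvalues on `𝔏` are integers, such that `𝔏⁰` and `𝔏⁺` are
the zero and the positive part of the resulting grading. -/
structure Grading where
  /-- the grading element -/
  r : D.L
  /-- the degree of `t₀` -/
  B : ℕ
  /-- the degree of a weight of `𝔤` -/
  deg : Module.Dual ℂ H → ℤ
  mem_hTilde : r ∈ D.hTilde H
  mem_grade : ∀ χ ∈ extendedRoots (rootSystem H), ∀ k₀ : ℤ, ∀ x ∈ D.rootSpaceL H χ k₀,
    x ∈ grade r ((deg χ + B * k₀ : ℤ) : ℂ)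
  deg_lt : ∀ χ ∈ extendedRoots (rootSystem H), |deg χ| < B
  pos_iff : ∀ χ ∈ extendedRoots (rootSystem H), ∀ k₀ : ℤ,
    0 < deg χ + B * k₀ ↔ (0 < k₀ ∨ k₀ = 0 ∧ χ ≠ 0 ∧ χ ∈ D.posCone H b)
  eq_zero : ∀ χ ∈ extendedRoots (rootSystem H), ∀ k₀ : ℤ, deg χ + B * k₀ = 0 → χ = 0 ∧ k₀ = 0
  deg_zero : deg 0 = 0

/-- Take `r = h + B d₀`, with `h` the height coweight. As `B` exceeds every `|χ(h)|`, the sign of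
`χ(h) + B k₀` is that of `k₀`, unless `k₀ = 0`, when it is decided by the height of `χ`. -/
theorem nonempty_grading : Nonempty (D.Grading H b) := by
  obtain ⟨h, B, hB, hz⟩ := D.exists_heightVector H b
  choose! z hz using hz
  have h0 : (0 : Module.Dual ℂ H) ∈ extendedRoots (rootSystem H) := Or.inl (Or.inl rfl)
  let r : D.L := ⟨⟨Finsupp.single 0 ((h : D.gZero) : 𝔤), 0, B⟩, fun a => by
    classical
    change Finsupp.single 0 ((h : D.gZero) : 𝔤) a ∈ _
    rw [Finsupp.single_apply]
    split_ifs with ha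
    · exact ha ▸ (h : D.gZero).2
    · exact zero_mem _, zero_mem _⟩
  have hsmall : ∀ χ ∈ extendedRoots (rootSystem H), ∀ k₀ : ℤ,
      (0 < k₀ → 0 < z χ + B * k₀) ∧ (k₀ < 0 → z χ + B * k₀ < 0) := by
    intro χ hχ k₀
    have h1 := abs_lt.mp (hz χ hχ).2.1
    constructor
    · intro h2
      nlinarith
    · intro h2
      nlinarith
  have hne : ∀ χ ∈ extendedRoots (rootSystem H), z χ = 0 → χ = 0 := fun χ hχ h =>
    D.eq_zero_of_mem_cone_of_neg_mem H b ((hz χ hχ).2.2.1 h.ge) ((hz χ hχ).2.2.2 h.le)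
  have hz0 : z 0 = 0 := by
    have := (hz 0 h0).1
    rw [LinearMap.zero_apply] at this
    exact_mod_cast this.symm
  refine ⟨⟨r, B, z, ⟨⟨h, rfl⟩, 0, by simp [r]⟩, fun χ hχ k₀ x hx => ?_, fun χ hχ => (hz χ hχ).2.1,
    fun χ hχ k₀ => ?_, fun χ hχ k₀ hk => ?_, hz0⟩⟩
  · rw [LieAlgebra.mem_grade, D.lie_eq_smul_of_mem_hTilde (r := r) (h := h) rfl hx, (hz χ hχ).1]
    push_cast
    rfl
  · rcases lt_trichotomy k₀ 0 with hk | rfl | hk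
    · have := (hsmall χ hχ k₀).2 hk
      exact iff_of_false (by omega) (by omega)
    · rw [mul_zero, add_zero]
      simp only [lt_irrefl, true_and, false_or]
      constructor
      · intro h1
        refine ⟨?_, (hz χ hχ).2.2.1 h1.le⟩
        rintro rfl
        omega
      · rintro ⟨h1, h2⟩
        by_contra! h3
        exact h1 (D.eq_zero_of_mem_cone_of_neg_mem H b h2 ((hz χ hχ).2.2.2 h3))
    · exact iff_of_true ((hsmall χ hχ k₀).1 hk) (Or.inl hk)
  · have hk0 : k₀ = 0 := by
      rcases lt_trichotomy k₀ 0 with h1 | h1 | h1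
      · have := (hsmall χ hχ k₀).2 h1; omega
      · exact h1
      · have := (hsmall χ hχ k₀).1 h1; omega
    subst hk0
    exact ⟨hne χ hχ (by simpa using hk), rfl⟩

variable {D H b} (hLT : D.IsLieTorus H b) (G : D.Grading H b)

namespace Grading

theorem mem_grade_tensEl {χ : Module.Dual ℂ H} (hχ : χ ∈ extendedRoots (rootSystem H))
    {a : ℤ × (Fin n → ℤ)} (X : D.piece a) (hX : (X : 𝔤) ∈ D.rootPiece H χ a) (p : D.Am) :
    D.tensEl a X p ∈ grade G.r ((G.deg χ + G.B * a.1 : ℤ) : ℂ) :=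
  G.mem_grade χ hχ a.1 _ (D.tensEl_mem_rootSpaceL X hX p)

theorem mem_grade_zero {x : D.L} (hx : x ∈ D.rootSpaceL H 0 0) : x ∈ grade G.r 0 := by
  have := G.mem_grade 0 (Or.inl (Or.inl rfl)) 0 x hx
  rwa [G.deg_zero, mul_zero, add_zero, Int.cast_zero] at this

theorem eq_of_mem_grade {x : D.L} (hx : x ≠ 0) {i j : ℤ} (hi : x ∈ grade G.r (i : ℂ))
    (hj : x ∈ grade G.r (j : ℂ)) : i = j := by
  rw [LieAlgebra.mem_grade] at hi hj
  exact_mod_cast smul_left_injective ℂ hx (hi.symm.trans hj)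

include hLT

theorem piece_le (a : ℤ × (Fin n → ℤ)) : D.piece a ≤ ⨆ χ, D.rootPiece H χ a :=
  (hLT.piece_le_iSup a).trans (iSup_le fun χ => le_iSup (fun χ => D.rootPiece H χ a) χ.1)

theorem exists_mem_grade {x : D.L} (hx : D.IsHomogeneous H x) :
    ∃ j : ℤ, x ∈ grade G.r (j : ℂ) := by
  cases hx with
  | tens χ a X hX h0 => exact ⟨_, G.mem_grade_tensEl (hLT.mem_extendedRoots hX h0) X hX 1⟩
  | cent p => exact ⟨0, by rw [Int.cast_zero]; exact G.mem_grade_zero (D.centEl_mem_rootSpaceL H p)⟩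
  | der => exact ⟨0, by rw [Int.cast_zero]; exact G.mem_grade_zero (D.derEl_mem_rootSpaceL H)⟩

theorem gradeSum_univ : gradeSum G.r Set.univ = ⊤ := by
  rw [eq_top_iff, ← D.span_isHomogeneous H (piece_le hLT), Submodule.span_le]
  intro x hx
  obtain ⟨j, hj⟩ := G.exists_mem_grade hLT hx
  exact grade_le_gradeSum G.r (Set.mem_univ j) hj

theorem grade_eq_span (j : ℤ) : grade G.r (j : ℂ) =
    Submodule.span ℂ {x | D.IsHomogeneous H x ∧ x ∈ grade G.r (j : ℂ)} :=
  (iSupIndep_grade G.r).eq_span_of_span_eq_top (D.span_isHomogeneous H (piece_le hLT))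
    (fun _ hx => G.exists_mem_grade hLT hx) j

/-- Degree zero is spanned by its homogeneous elements, and for a loop element the degree vanishes
only if both the weight and `k₀` do. -/
theorem mem_L0_iff (x : D.L) : x ∈ D.L0 H ↔ x ∈ grade G.r 0 := by
  refine ⟨fun hx => G.mem_grade_zero hx, fun hx => ?_⟩
  suffices h : grade G.r ((0 : ℤ) : ℂ) ≤ D.rootSpaceL H 0 0 from h (by rwa [Int.cast_zero])
  rw [G.grade_eq_span hLT, Submodule.span_le]
  rintro x ⟨hx, hx0⟩
  cases hx with
  | tens χ a X hX h0 =>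
    by_cases hz : D.tensEl a X 1 = 0
    · rw [hz]; exact zero_mem _
    have hχ := hLT.mem_extendedRoots hX h0
    obtain ⟨rfl, ha⟩ := G.eq_zero χ hχ a.1
      (G.eq_of_mem_grade hz (G.mem_grade_tensEl hχ X hX 1) hx0)
    rw [← ha]
    exact D.tensEl_mem_rootSpaceL X hX 1
  | cent p => exact D.centEl_mem_rootSpaceL H p
  | der => exact D.derEl_mem_rootSpaceL H

theorem Lplus_eq : D.Lplus H b = gradeSum G.r (Set.Ioi 0) := by
  apply le_antisymm
  · refine iSup_le fun α => iSup_le fun k₀ => iSup_le fun h => fun x hx => ?_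
    by_cases hα : α ∈ extendedRoots (rootSystem H)
    · exact grade_le_gradeSum G.r ((G.pos_iff α hα k₀).mpr h) (G.mem_grade α hα k₀ x hx)
    -- The supremum in `Lplus` runs over all functionals; those outside the extended roots
    -- contribute nothing.
    · have hl : (x : D.Ambient).loop = 0 := by
        ext a
        by_contra h0
        exact hα (hLT.mem_extendedRoots (hx.1 a) h0)
      have h1 := hx.2.2 (by rcases h with h | h; exacts [Or.inr h.ne', Or.inl h.2.1])
      have hx0 : x = 0 := by
        apply Subtype.ext
        ext1
        exacts [hl, h1.1, h1.2]
      rw [hx0]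
      exact zero_mem _
  · refine iSup₂_le fun j hj => ?_
    rw [Set.mem_Ioi] at hj
    rw [G.grade_eq_span hLT, Submodule.span_le]
    rintro x ⟨hx, hxj⟩
    by_cases hz : x = 0
    · rw [hz]; exact zero_mem _
    cases hx with
    | tens χ a X hX h0 =>
      have hχ := hLT.mem_extendedRoots hX h0
      have h1 := G.eq_of_mem_grade hz (G.mem_grade_tensEl hχ X hX 1) hxj
      exact Submodule.mem_iSup_of_mem χ (Submodule.mem_iSup_of_mem a.1
        (Submodule.mem_iSup_of_mem ((G.pos_iff χ hχ a.1).mp (by omega))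
          (D.tensEl_mem_rootSpaceL X hX 1)))
    | cent p =>
      have h1 := G.mem_grade_zero (D.centEl_mem_rootSpaceL H p)
      rw [← Int.cast_zero] at h1
      have := G.eq_of_mem_grade hz h1 hxj
      omega
    | der =>
      have h1 := G.mem_grade_zero (D.derEl_mem_rootSpaceL H)
      rw [← Int.cast_zero] at h1
      have := G.eq_of_mem_grade hz h1 hxj
      omega

end Grading

end MultiloopDatum
end

section

attribute [local instance] LieRing.ofAssociativeRing

open scoped TensorProduct

theorem LieHom.mem_eigenspace_of_mem_grade {L M : Type*} [LieRing L] [LieAlgebra ℂ L]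
    [AddCommGroup M] [Module ℂ M] (ρ : L →ₗ⁅ℂ⁆ Module.End ℂ M) {r x : L} {c d : ℂ}
    (hx : x ∈ LieAlgebra.grade r d) {v : M} (hv : v ∈ (ρ r).eigenspace c) :
    ρ x v ∈ (ρ r).eigenspace (c + d) := by
  rw [Module.End.mem_eigenspace_iff] at *
  rw [LieAlgebra.mem_grade] at hx
  have h1 : ρ r (ρ x v) = ρ x (ρ r v) + ρ ⁅r, x⁆ v := by
    rw [LieHom.map_lie, LieHom.lie_apply]; simp
  rw [h1, hv, hx, map_smul, map_smul, LinearMap.smul_apply, add_smul]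

/-! ### Generalized Verma modules -/

namespace MultiloopDatum

open LieAlgebra.IsKilling LieModule RootPairing.Base LieAlgebra UniversalEnvelopingAlgebra

variable {n : ℕ} {𝔤 : Type*} [LieRing 𝔤] [LieAlgebra ℂ 𝔤] [FiniteDimensional ℂ 𝔤]
  [LieAlgebra.IsSimple ℂ 𝔤]
  (D : MultiloopDatum n 𝔤)

section Weights

variable (H : LieSubalgebra ℂ D.gZero)

/-- The projection of `𝔥̃(0)` to `𝔥(0)`. -/
noncomputable def toH : D.hTilde H →ₗ[ℂ] H where
  toFun x := x.2.1.choose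
  map_add' x y := by
    apply Subtype.ext
    apply Subtype.ext
    have h1 := (x + y).2.1.choose_spec
    have h2 := x.2.1.choose_spec
    have h3 := y.2.1.choose_spec
    refine Finsupp.single_injective (0 : ℤ × (Fin n → ℤ)) (h1.symm.trans ?_)
    refine (congrArg₂ (· + ·) h2 h3).trans ?_
    exact (Finsupp.single_add _ _ _).symm
  map_smul' c x := by
    apply Subtype.ext
    apply Subtype.ext
    have h1 := (c • x).2.1.choose_spec
    have h2 := x.2.1.choose_spec
    refine Finsupp.single_injective (0 : ℤ × (Fin n → ℤ)) (h1.symm.trans ?_)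
    refine (congrArg (c • ·) h2).trans ?_
    exact Finsupp.smul_single _ _ _

theorem loop_eq_toH (x : D.hTilde H) :
    ((x : D.L) : D.Ambient).loop = Finsupp.single 0 ((D.toH H x : D.gZero) : 𝔤) :=
  x.2.1.choose_spec

/-- The weight `α + k₀ δ` of `𝔥̃(0)`. -/
noncomputable def affineWeight (α : Module.Dual ℂ H) (k₀ : ℤ) : Module.Dual ℂ (D.hTilde H) :=
  α ∘ₗ D.toH H + (k₀ : ℂ) •
    { toFun := fun x => ((x : D.L) : D.Ambient).der
      map_add' := fun _ _ => rfl
      map_smul' := fun _ _ => rfl }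

theorem lie_of_mem_rootSpaceL (h : D.hTilde H) {α : Module.Dual ℂ H} {k₀ : ℤ} {x : D.L}
    (hx : x ∈ D.rootSpaceL H α k₀) : ⁅(h : D.L), x⁆ = D.affineWeight H α k₀ h • x := by
  rw [D.lie_eq_smul_of_mem_hTilde (D.loop_eq_toH H h) hx, mul_comm]
  rfl

end Weights

variable [LieAlgebra.IsSimple ℂ D.gZero]
  (H : LieSubalgebra ℂ D.gZero) [H.IsCartanSubalgebra] (b : (rootSystem H).Base)

theorem hTilde_le_L0 {x : D.L} (hx : x ∈ D.hTilde H) : x ∈ D.L0 H := by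
  have h1 := D.loop_eq_toH H ⟨x, hx⟩
  refine ⟨fun a => ?_, fun a ha => ?_, fun h => by simp at h⟩
  · classical
    rw [h1, Finsupp.single_apply]
    split_ifs with h0
    · subst h0
      refine ⟨(D.toH H ⟨x, hx⟩ : D.gZero).2, fun h => ?_⟩
      have h2 : ⁅h, D.toH H ⟨x, hx⟩⁆ = 0 := trivial_lie_zero H H _ _
      have h3 := congrArg (fun y : H => ((y : D.gZero) : 𝔤)) h2
      rw [LinearMap.zero_apply, zero_smul]
      exact h3
    · exact zero_mem _
  · rw [h1, Finsupp.single_apply, if_neg]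
    rintro rfl
    exact ha rfl

variable (N : Type*) [AddCommGroup N] [Module ℂ N] [LieRingModule (D.L0 H) N]
  [LieModule ℂ (D.L0 H) N]

/-- `𝔥̃(0)` commutes with `𝔏⁰`, so each of its elements acts on `N` by a scalar, by Schur's lemma;
linearity is tested on a non-zero vector. -/
theorem exists_weight [FiniteDimensional ℂ N] [LieModule.IsIrreducible ℂ (D.L0 H) N] :
    ∃ χ : Module.Dual ℂ (D.hTilde H), ∀ (h : D.hTilde H) (v : N),
      ⁅(⟨h, D.hTilde_le_L0 H h.2⟩ : D.L0 H), v⁆ = χ h • v := by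
  have : Nontrivial N := LieModule.nontrivial_of_isIrreducible ℂ (D.L0 H) N
  have key : ∀ h : D.hTilde H, ∃ c : ℂ, ∀ v : N, ⁅(⟨h, D.hTilde_le_L0 H h.2⟩ : D.L0 H), v⁆ = c • v := by
    intro h
    set y : D.L0 H := ⟨h, D.hTilde_le_L0 H h.2⟩
    obtain ⟨c, hc⟩ := Module.End.exists_eigenvalue (LieModule.toEnd ℂ (D.L0 H) N y)
    obtain ⟨v, hv⟩ := hc.exists_hasEigenvector
    have hy : ∀ x : D.L0 H, ⁅y, x⁆ = 0 := by
      intro x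
      apply Subtype.ext
      have := D.lie_of_mem_rootSpaceL H h x.2
      rw [LieSubalgebra.coe_bracket]
      refine this.trans ?_
      simp [affineWeight]
    let P : LieSubmodule ℂ (D.L0 H) N :=
      { (LieModule.toEnd ℂ (D.L0 H) N y).eigenspace c with
        lie_mem := by
          intro x w hw
          have hw' : ⁅y, w⁆ = c • w := Module.End.mem_eigenspace_iff.mp hw
          refine Module.End.mem_eigenspace_iff.mpr ?_
          rw [LieModule.toEnd_apply_apply, leibniz_lie, hy, zero_lie, zero_add, hw', lie_smul] }
    have hP : P = ⊤ := by
      refine (eq_bot_or_eq_top P).resolve_left fun h => hv.2 ?_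
      have hvP : v ∈ P := hv.1
      rw [h] at hvP
      simpa using hvP
    refine ⟨c, fun w => ?_⟩
    have hw : w ∈ P := hP ▸ LieSubmodule.mem_top w
    exact Module.End.mem_eigenspace_iff.mp hw
  choose χ hχ using key
  obtain ⟨v, hv⟩ := exists_ne (0 : N)
  refine ⟨⟨⟨χ, fun h h' => ?_⟩, fun c h => ?_⟩, hχ⟩
  · apply smul_left_injective ℂ hv
    simp only
    rw [add_smul, ← hχ, ← hχ, ← hχ, ← add_lie]
    rfl
  · apply smul_left_injective ℂ hv
    simp only
    rw [RingHom.id_apply, smul_eq_mul, mul_smul, ← hχ, ← hχ, ← smul_lie]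
    rfl

/-- The map `N → M(N)`. -/
noncomputable def vermaIncl : N →ₗ[ℂ] D.Verma H b N where
  toFun v := Submodule.Quotient.mk (1 ⊗ₜ v)
  map_add' v w := by rw [TensorProduct.tmul_add, Submodule.Quotient.mk_add]
  map_smul' c v := by rw [TensorProduct.tmul_smul, Submodule.Quotient.mk_smul]; rfl

theorem ι_smul_vermaIncl (x : D.L0 H) (v : N) :
    ι ℂ (x : D.L) • D.vermaIncl H b N v = D.vermaIncl H b N ⁅x, v⁆ := by
  have h : ι ℂ (x : D.L) • ((1 : UniversalEnvelopingAlgebra ℂ D.L) ⊗ₜ[ℂ] v) -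
      1 ⊗ₜ ⁅x, v⁆ ∈ D.vermaRel H b N :=
    Submodule.subset_span (Or.inl ⟨1, x, v, by rw [TensorProduct.smul_tmul', smul_eq_mul, mul_one,
      one_mul]⟩)
  exact (Submodule.Quotient.eq _).mpr h

theorem ι_smul_vermaIncl_of_mem_Lplus {x : D.L} (hx : x ∈ D.Lplus H b) (v : N) :
    ι ℂ x • D.vermaIncl H b N v = 0 := by
  have h : ι ℂ x • ((1 : UniversalEnvelopingAlgebra ℂ D.L) ⊗ₜ[ℂ] v) ∈ D.vermaRel H b N :=
    Submodule.subset_span (Or.inr ⟨1, x, hx, v, by rw [TensorProduct.smul_tmul', smul_eq_mul,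
      mul_one, one_mul]⟩)
  exact (Submodule.Quotient.mk_eq_zero _).mpr h

theorem eq_top_of_vermaIncl_mem (P : Submodule ℂ (D.Verma H b N))
    (hN : ∀ v, D.vermaIncl H b N v ∈ P) (hP : ∀ x : D.L, ∀ v ∈ P, ι ℂ x • v ∈ P) : P = ⊤ := by
  rw [eq_top_iff]
  rintro w -
  obtain ⟨w, rfl⟩ := Submodule.Quotient.mk_surjective _ w
  induction w using TensorProduct.induction_on with
  | zero => rw [Submodule.Quotient.mk_zero]; exact zero_mem _
  | add w w' hw hw' => rw [Submodule.Quotient.mk_add]; exact add_mem hw hw'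
  | tmul u v =>
    have h := smul_mem_of_forall_ι_smul_mem P hP u (hN v)
    have h2 : u • D.vermaIncl H b N v = Submodule.Quotient.mk (u ⊗ₜ v) := by
      change Submodule.Quotient.mk (u • (1 ⊗ₜ v)) = _
      rw [TensorProduct.smul_tmul', smul_eq_mul, mul_one]
    rwa [h2] at h

variable {D H b} (hLT : D.IsLieTorus H b) (G : D.Grading H b)

-- The relations defining `M(N)` hold in the representation `W` of `𝔏` obtained by extending `N`. So
-- `M(N)` maps to `W`, and the composite from `N` is injective.
include hLT G in
theorem vermaIncl_injective : Function.Injective (D.vermaIncl H b N) := by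
  obtain ⟨W, _, _, σ, f, hf, hσ, hσ'⟩ :=
    exists_rep_of_grade_zero (G.gradeSum_univ hLT) (G.mem_L0_iff hLT) N
  let Φ : UniversalEnvelopingAlgebra ℂ D.L ⊗[ℂ] N →ₗ[ℂ] W :=
    TensorProduct.lift ((LinearMap.lcomp ℂ W f) ∘ₗ (lift ℂ σ).toLinearMap)
  have hΦ : ∀ u v, Φ (u ⊗ₜ v) = lift ℂ σ u (f v) := fun u v => rfl
  have hΦu : ∀ u w, Φ (u • w) = lift ℂ σ u (Φ w) := by
    intro u w
    induction w using TensorProduct.induction_on with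
    | zero => simp
    | add w w' hw hw' => rw [smul_add, map_add, hw, hw', map_add, map_add]
    | tmul u' v => rw [TensorProduct.smul_tmul', hΦ, hΦ, smul_eq_mul, map_mul,
        Module.End.mul_apply]
  have hrel : ∀ w ∈ D.vermaRel H b N, Φ w = 0 := by
    intro w hw
    induction hw using Submodule.span_induction with
    | zero => exact map_zero _
    | add w w' _ _ hw hw' => rw [map_add, hw, hw', add_zero]
    | smul u w _ hw => rw [hΦu, hw, map_zero]
    | mem w hw =>
      rcases hw with ⟨u, x, v, rfl⟩ | ⟨u, x, hx, v, rfl⟩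
      · rw [map_sub, hΦ, hΦ, map_mul, Module.End.mul_apply, lift_ι_apply, hσ, sub_self]
      · rw [G.Lplus_eq hLT] at hx
        rw [hΦ, map_mul, Module.End.mul_apply, lift_ι_apply, hσ' x hx, map_zero]
  rw [injective_iff_map_eq_zero]
  intro v hv
  have h1 : Φ (1 ⊗ₜ v) = 0 := hrel _ ((Submodule.Quotient.mk_eq_zero _).mp hv)
  rw [hΦ, map_one, Module.End.one_apply] at h1
  exact (map_eq_zero_iff f hf).mp h1

end MultiloopDatum
end

/-! ### The maximal proper submodule of `M(N)` and the quotient `V(N)`. -/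

section

attribute [local instance] LieRing.ofAssociativeRing

open scoped TensorProduct

namespace MultiloopDatum

open LieAlgebra.IsKilling LieModule RootPairing.Base LieAlgebra UniversalEnvelopingAlgebra

variable {n : ℕ} {𝔤 : Type*} [LieRing 𝔤] [LieAlgebra ℂ 𝔤] [FiniteDimensional ℂ 𝔤]
  [LieAlgebra.IsSimple ℂ 𝔤]
  {D : MultiloopDatum n 𝔤} [LieAlgebra.IsSimple ℂ D.gZero]
  {H : LieSubalgebra ℂ D.gZero} [H.IsCartanSubalgebra] {b : (rootSystem H).Base}
  (N : Type*) [AddCommGroup N] [Module ℂ N] [LieRingModule (D.L0 H) N]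
  [LieModule ℂ (D.L0 H) N] (hLT : D.IsLieTorus H b) (G : D.Grading H b)

namespace Grading

/-- The action of `𝔏` on `M(N)`. -/
noncomputable abbrev vermaRep (_ : D.Grading H b) : D.L →ₗ⁅ℂ⁆ Module.End ℂ (D.Verma H b N) :=
  toRep ℂ D.L (D.Verma H b N)

/-- The sum of the eigenspaces of the grading element in `M(N)` below the eigenvalue `c`. -/
noncomputable def low (c : ℂ) : Submodule ℂ (D.Verma H b N) :=
  ⨆ i : Set.Iio (0 : ℤ), (G.vermaRep N G.r).eigenspace (c + (i : ℤ))

theorem low_le (c : ℂ) : G.low N c ≤ ⨆ (e) (_ : e ≠ c), (G.vermaRep N G.r).eigenspace e := by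
  refine iSup_le fun i => le_iSup₂_of_le (c + (i : ℤ)) (fun h => ?_) le_rfl
  have h1 : ((i : ℤ) : ℂ) = 0 := by simpa using h
  have h2 := i.2
  rw [Int.cast_eq_zero] at h1
  rw [Set.mem_Iio, h1] at h2
  exact lt_irrefl _ h2

theorem smul_mem_low_of_mem_eigenspace {c : ℂ} {v : D.Verma H b N}
    (hv : v ∈ (G.vermaRep N G.r).eigenspace c) {x : D.L} (hx : x ∈ gradeSum G.r (Set.Iio 0)) :
    ι ℂ x • v ∈ G.low N c := by
  refine gradeSum_induction G.r (p := fun x => ι ℂ x • v ∈ G.low N c) (fun i hi x hx => ?_) ?_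
    (fun x y hx hy => ?_) hx
  · exact Submodule.mem_iSup_of_mem (⟨i, hi⟩ : Set.Iio (0 : ℤ))
      (LieHom.mem_eigenspace_of_mem_grade _ hx hv)
  · rw [map_zero, zero_smul]; exact zero_mem _
  · rw [map_add, add_smul]; exact add_mem hx hy

theorem smul_mem_low {c : ℂ} {v : D.Verma H b N} (hv : v ∈ G.low N c) {x : D.L}
    (hx : x ∈ gradeSum G.r (Set.Iio 0)) : ι ℂ x • v ∈ G.low N c := by
  suffices h : G.low N c ≤ (G.low N c).comap (G.vermaRep N x) from h hv
  refine iSup_le fun i v hv => ?_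
  suffices h : G.low N (c + (i : ℤ)) ≤ G.low N c from
    h (G.smul_mem_low_of_mem_eigenspace N hv hx)
  refine iSup_le fun j => le_iSup_of_le (⟨i + j, Set.mem_Iio.mpr
    (add_neg (Set.mem_Iio.mp i.2) (Set.mem_Iio.mp j.2))⟩ : Set.Iio (0 : ℤ)) ?_
  push_cast
  rw [add_assoc]

variable {N} {c : ℂ}
  (hc : ∀ x : D.L0 H, (x : D.L) = G.r → ∀ v : N, ⁅x, v⁆ = c • v)

include hLT in
theorem exists_eigenvalue [FiniteDimensional ℂ N] [LieModule.IsIrreducible ℂ (D.L0 H) N] :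
    ∃ c : ℂ, ∀ x : D.L0 H, (x : D.L) = G.r → ∀ v : N, ⁅x, v⁆ = c • v := by
  obtain ⟨χ, hχ⟩ := D.exists_weight H N
  refine ⟨χ ⟨G.r, G.mem_hTilde⟩, fun x hx v => ?_⟩
  rw [← hχ]
  congr 1
  exact Subtype.ext hx

include hc hLT in
theorem vermaIncl_mem_eigenspace (v : N) :
    D.vermaIncl H b N v ∈ (G.vermaRep N G.r).eigenspace c := by
  have hr : G.r ∈ D.L0 H := D.hTilde_le_L0 H G.mem_hTilde
  rw [Module.End.mem_eigenspace_iff, toRep_apply]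
  rw [D.ι_smul_vermaIncl H b N ⟨G.r, hr⟩ v, hc _ rfl, map_smul]

include hLT in
/-- A subspace of `M(N)` that contains `N` and is stable under the negative part is everything. -/
theorem eq_top_of_stable (S : Submodule ℂ (D.Verma H b N))
    (hN : ∀ v, D.vermaIncl H b N v ∈ S)
    (hS : ∀ x ∈ gradeSum G.r (Set.Iio 0), ∀ v ∈ S, ι ℂ x • v ∈ S) : S = ⊤ := by
  have hcompl : (Set.Iio (0 : ℤ))ᶜ = Set.Ici 0 := by ext; simp
  have hAB := (isCompl_gradeSum G.r (G.gradeSum_univ hLT) (Set.Iio 0)).sup_eq_top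
  rw [hcompl] at hAB
  refine (G.vermaRep N).eq_top_of_triangular hAB (N := LinearMap.range (D.vermaIncl H b N)) ?_ ?_ ?_
    hS
  · rintro x hx _ ⟨v, rfl⟩
    refine gradeSum_induction G.r (p := fun x => ι ℂ x • D.vermaIncl H b N v ∈
      LinearMap.range (D.vermaIncl H b N)) (fun i hi x hx => ?_) ?_ (fun x y hx hy => ?_) hx
    · rcases (Set.mem_Ici.mp hi).eq_or_lt with rfl | hi
      · rw [Int.cast_zero] at hx
        rw [D.ι_smul_vermaIncl H b N ⟨x, (G.mem_L0_iff hLT x).mpr hx⟩ v]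
        exact LinearMap.mem_range_self _ _
      · rw [D.ι_smul_vermaIncl_of_mem_Lplus H b N ?_ v]
        · exact zero_mem _
        · rw [G.Lplus_eq hLT]
          exact grade_le_gradeSum G.r hi hx
    · rw [map_zero, zero_smul]; exact zero_mem _
    · rw [map_add, add_smul]; exact add_mem hx hy
  · exact fun P hP h => D.eq_top_of_vermaIncl_mem H b N P
      (fun v => hP (LinearMap.mem_range_self _ v)) h
  · rintro _ ⟨v, rfl⟩
    exact hN v

-- The sum contains `N`, and the negative part carries it into the lower eigenspaces. Hence it is
-- everything, by triangular generation.
include hc hLT in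
theorem range_sup_low :
    LinearMap.range (D.vermaIncl H b N) ⊔ G.low N c = ⊤ := by
  refine G.eq_top_of_stable hLT _ (fun v => Submodule.mem_sup_left (LinearMap.mem_range_self _ v))
    fun x hx w hw => ?_
  obtain ⟨_, ⟨v, rfl⟩, y, hy, rfl⟩ := Submodule.mem_sup.mp hw
  rw [smul_add]
  exact Submodule.mem_sup_right (add_mem
    (G.smul_mem_low_of_mem_eigenspace N (G.vermaIncl_mem_eigenspace hLT hc v) hx)
    (G.smul_mem_low N hy hx))

include hc hLT in
theorem vermaIncl_eq_zero_of_mem_low {v : N} (hv : D.vermaIncl H b N v ∈ G.low N c) : v = 0 := by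
  have h1 := (Module.End.eigenspaces_iSupIndep (G.vermaRep N G.r) c).le_bot
    ⟨G.vermaIncl_mem_eigenspace hLT hc v, G.low_le N c hv⟩
  exact (map_eq_zero_iff _ (vermaIncl_injective N hLT G)).mp (by simpa using h1)

variable [LieModule.IsIrreducible ℂ (D.L0 H) N]

-- A submodule is stable under `r`, so it contains the component of `w` in `N`. If that is non-zero,
-- the submodule meets `N` in a non-zero `𝔏⁰`-submodule, hence contains `N` by irreducibility and is
-- not proper.
include hc hLT in
theorem le_low_of_ne_top (P : Submodule (UniversalEnvelopingAlgebra ℂ D.L) (D.Verma H b N))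
    (hP : P ≠ ⊤) {w : D.Verma H b N} (hw : w ∈ P) : w ∈ G.low N c := by
  have h1 : w ∈ LinearMap.range (D.vermaIncl H b N) ⊔ G.low N c := by
    rw [G.range_sup_low hLT hc]; trivial
  obtain ⟨_, ⟨v, rfl⟩, y, hy, rfl⟩ := Submodule.mem_sup.mp h1
  have hv : D.vermaIncl H b N v ∈ P.restrictScalars ℂ :=
    Module.End.mem_of_add_mem_of_invariant (G.vermaRep N G.r) (P.restrictScalars ℂ)
      (fun w hw => P.smul_mem _ hw) c (G.vermaIncl_mem_eigenspace hLT hc v) (G.low_le N c hy) hw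
  by_cases hv0 : v = 0
  · rw [hv0, map_zero, zero_add]; exact hy
  let Q : LieSubmodule ℂ (D.L0 H) N :=
    { (P.restrictScalars ℂ).comap (D.vermaIncl H b N) with
      lie_mem := fun {x w} (hw : D.vermaIncl H b N w ∈ P) => by
        change D.vermaIncl H b N ⁅x, w⁆ ∈ P
        rw [← ι_smul_vermaIncl]
        exact P.smul_mem _ hw }
  have hQ : Q = ⊤ := by
    refine (eq_bot_or_eq_top Q).resolve_left fun h => hv0 ?_
    have hvQ : v ∈ Q := hv
    rw [h] at hvQ
    simpa using hvQ
  refine absurd ?_ hP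
  have h2 := D.eq_top_of_vermaIncl_mem H b N (P.restrictScalars ℂ)
    (fun v => show v ∈ Q from hQ ▸ LieSubmodule.mem_top v) (fun x w hw => P.smul_mem _ hw)
  rw [eq_top_iff]
  intro w _
  have : w ∈ P.restrictScalars ℂ := h2 ▸ Submodule.mem_top
  exact this

include hc hLT in
theorem vermaRad_le_low {w : D.Verma H b N} (hw : w ∈ D.vermaRad H b N) : w ∈ G.low N c := by
  -- `low` is only a subspace; `K` is the largest submodule inside it, so it contains the sum of all
  -- proper submodules.
  let K : Submodule (UniversalEnvelopingAlgebra ℂ D.L) (D.Verma H b N) :=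
    { carrier := {v | ∀ u : UniversalEnvelopingAlgebra ℂ D.L, u • v ∈ G.low N c}
      zero_mem' := fun u => by rw [smul_zero]; exact zero_mem _
      add_mem' := fun hv hw u => by rw [smul_add]; exact add_mem (hv u) (hw u)
      smul_mem' := fun u' v hv u => by rw [smul_smul]; exact hv _ }
  have h : D.vermaRad H b N ≤ K := sSup_le fun P hP v hv u =>
    G.le_low_of_ne_top hLT hc P hP (P.smul_mem u hv)
  have := h hw 1
  rwa [one_smul] at this

-- Such a submodule contains no non-zero vector of `N`, hence is proper.
include hc hLT in
theorem le_vermaRad (P : Submodule (UniversalEnvelopingAlgebra ℂ D.L) (D.Verma H b N))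
    (hP : ∀ v ∈ P, v ∈ G.low N c) : P ≤ D.vermaRad H b N := by
  have : Nontrivial N := LieModule.nontrivial_of_isIrreducible ℂ (D.L0 H) N
  obtain ⟨v, hv⟩ := exists_ne (0 : N)
  refine le_sSup fun h => hv (G.vermaIncl_eq_zero_of_mem_low hLT hc (hP _ ?_))
  rw [h]
  trivial

end Grading

variable {N}

variable (D H b N) in
/-- The map `N → V(N)`. -/
noncomputable def incl : N →ₗ[ℂ] D.V H b N where
  toFun v := Submodule.Quotient.mk (D.vermaIncl H b N v)
  map_add' v w := by rw [map_add, Submodule.Quotient.mk_add]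
  map_smul' c v := by rw [map_smul, Submodule.Quotient.mk_smul]; rfl

theorem ι_smul_incl (x : D.L0 H) (v : N) :
    ι ℂ (x : D.L) • D.incl H b N v = D.incl H b N ⁅x, v⁆ := by
  change Submodule.Quotient.mk (ι ℂ (x : D.L) • D.vermaIncl H b N v) = _
  rw [ι_smul_vermaIncl]
  rfl

theorem ι_smul_incl_of_mem_Lplus {x : D.L} (hx : x ∈ D.Lplus H b) (v : N) :
    ι ℂ x • D.incl H b N v = 0 := by
  change Submodule.Quotient.mk (ι ℂ x • D.vermaIncl H b N v) = _
  rw [ι_smul_vermaIncl_of_mem_Lplus _ _ _ _ hx]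
  rfl

include hLT in
theorem incl_injective [FiniteDimensional ℂ N] [LieModule.IsIrreducible ℂ (D.L0 H) N] :
    Function.Injective (D.incl H b N) := by
  obtain ⟨G⟩ := D.nonempty_grading H b
  obtain ⟨c, hc⟩ := G.exists_eigenvalue hLT (N := N)
  rw [injective_iff_map_eq_zero]
  intro v hv
  exact G.vermaIncl_eq_zero_of_mem_low hLT hc
    (G.vermaRad_le_low hLT hc ((Submodule.Quotient.mk_eq_zero _).mp hv))

include hLT in
theorem eq_top_of_incl_mem (G : D.Grading H b) (S : Submodule ℂ (D.V H b N))
    (hN : ∀ v, D.incl H b N v ∈ S)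
    (hS : ∀ x ∈ gradeSum G.r (Set.Iio 0), ∀ v ∈ S, ι ℂ x • v ∈ S) : S = ⊤ := by
  have h := G.eq_top_of_stable hLT (S.comap ((D.vermaRad H b N).mkQ.restrictScalars ℂ)) hN
    fun x hx v hv => hS x hx _ hv
  rw [eq_top_iff]
  rintro w -
  obtain ⟨w, rfl⟩ := Submodule.Quotient.mk_surjective _ w
  have : w ∈ S.comap ((D.vermaRad H b N).mkQ.restrictScalars ℂ) := h ▸ Submodule.mem_top
  exact this

end MultiloopDatum
end

section

attribute [local instance] LieRing.ofAssociativeRing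

open scoped TensorProduct

/-! ### The ideal of `𝔏` attached to an ideal of `A(m)` -/

namespace MultiloopDatum

open LieAlgebra.IsKilling LieModule RootPairing.Base LieAlgebra UniversalEnvelopingAlgebra

variable {n : ℕ} {𝔤 : Type*} [LieRing 𝔤] [LieAlgebra ℂ 𝔤] [FiniteDimensional ℂ 𝔤]
  [LieAlgebra.IsSimple ℂ 𝔤]
  {D : MultiloopDatum n 𝔤}

variable (D) in
/-- `LT ⊗ I ⊕ K ⊗ I`. -/
noncomputable def idealL (I : Ideal D.Am) : Submodule ℂ D.L :=
  Submodule.span ℂ ({x | ∃ (a : ℤ × (Fin n → ℤ)) (X : D.piece a), ∃ p ∈ I, D.tensEl a X p = x} ∪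
    {x | ∃ p ∈ I, D.centEl p = x})

theorem tensEl_mem_idealL {I : Ideal D.Am} (a : ℤ × (Fin n → ℤ)) (X : D.piece a) {p : D.Am}
    (hp : p ∈ I) : D.tensEl a X p ∈ D.idealL I :=
  Submodule.subset_span (Or.inl ⟨a, X, p, hp, rfl⟩)

theorem centEl_mem_idealL {I : Ideal D.Am} {p : D.Am} (hp : p ∈ I) : D.centEl p ∈ D.idealL I :=
  Submodule.subset_span (Or.inr ⟨p, hp, rfl⟩)

variable [LieAlgebra.IsSimple ℂ D.gZero]
  {H : LieSubalgebra ℂ D.gZero} [H.IsCartanSubalgebra] {b : (rootSystem H).Base}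
  {N : Type*} [AddCommGroup N] [Module ℂ N] [LieRingModule (D.L0 H) N]
  [LieModule ℂ (D.L0 H) N] (hLT : D.IsLieTorus H b) (G : D.Grading H b)

include hLT in
theorem lie_mem_idealL {I : Ideal D.Am} (y : D.L) {x : D.L} (hx : x ∈ D.idealL I) :
    ⁅y, x⁆ ∈ D.idealL I := by
  have hy : y ∈ Submodule.span ℂ {x | D.IsHomogeneous H x} := by
    rw [D.span_isHomogeneous H (Grading.piece_le hLT)]; trivial
  induction hx using Submodule.span_induction with
  | zero => rw [lie_zero]; exact zero_mem _
  | add x x' _ _ hx hx' => rw [lie_add]; exact add_mem hx hx'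
  | smul c x _ hx => rw [lie_smul]; exact Submodule.smul_mem _ _ hx
  | mem x hx =>
    rcases hx with ⟨a, X, p, hp, rfl⟩ | ⟨p, hp, rfl⟩
    · induction hy using Submodule.span_induction with
      | zero => rw [zero_lie]; exact zero_mem _
      | add x x' _ _ hx hx' => rw [add_lie]; exact add_mem hx hx'
      | smul c x _ hx => rw [smul_lie]; exact Submodule.smul_mem _ _ hx
      | mem y hy =>
        cases hy with
        | tens χ c Y hY h0 =>
          rw [lie_tensEl, one_mul]
          exact add_mem (tensEl_mem_idealL _ _ hp) (centEl_mem_idealL (I.mul_mem_left _ hp))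
        | cent q => rw [← lie_skew, lie_centEl, neg_zero]; exact zero_mem _
        | der =>
          rw [lie_derEl_tensEl]
          exact Submodule.smul_mem _ _ (tensEl_mem_idealL _ _ hp)
    · rw [lie_centEl]; exact zero_mem _

include hLT in
theorem eq_top_of_rootPiece_le {a : ℤ × (Fin n → ℤ)} (T : Submodule ℂ (D.piece a))
    (hT : ∀ χ ∈ extendedRoots (rootSystem H), ∀ X : D.piece a, (X : 𝔤) ∈ D.rootPiece H χ a →
      X ∈ T) : T = ⊤ := by
  have h : D.piece a ≤ T.map (D.piece a).subtype :=
    (hLT.piece_le_iSup a).trans (iSup_le fun χ x hx => ⟨⟨x, hx.1⟩, hT χ.1 χ.2 _ hx, rfl⟩)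
  rw [eq_top_iff]
  intro X _
  obtain ⟨Y, hY, hXY⟩ := h X.2
  rwa [← Subtype.ext hXY]

theorem tensEl_mem_L0I {I : Ideal D.Am} {a : ℤ × (Fin n → ℤ)} (ha : a.1 = 0) (X : D.piece a)
    (hX : (X : 𝔤) ∈ D.rootPiece H 0 a) {p : D.Am} (hp : p ∈ I) :
    D.tensEl a X p ∈ D.L0I H I := by
  obtain ⟨a0, k⟩ := a
  subst ha
  exact Submodule.subset_span (Or.inl ⟨k, X, hX, p, hp, rfl⟩)

theorem centEl_mem_L0I {I : Ideal D.Am} {p : D.Am} (hp : p ∈ I) :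
    D.centEl p ∈ D.L0I H I :=
  Submodule.subset_span (Or.inr ⟨p, hp, rfl⟩)

namespace Grading

variable {c : ℂ} (hc : ∀ x : D.L0 H, (x : D.L) = G.r → ∀ v : N, ⁅x, v⁆ = c • v)
  {I : Ideal D.Am} (hI : ∀ x : D.L0 H, (x : D.L) ∈ D.L0I H I → ∀ v : N, ⁅x, v⁆ = 0)

-- By degrees: negative elements of the ideal lower the eigenvalue of `r`, positive ones lie in
-- `𝔏⁺`, and those of degree zero lie in `𝔏⁰(I)`; the latter two kinds kill `N`.
include hLT hc hI in
theorem idealL_smul_vermaIncl {x : D.L} (hx : x ∈ D.idealL I) (v : N) :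
    ι ℂ x • D.vermaIncl H b N v ∈ G.low N c := by
  induction hx using Submodule.span_induction with
  | zero => rw [map_zero, zero_smul]; exact zero_mem _
  | add x x' _ _ hx hx' => rw [map_add, add_smul]; exact add_mem hx hx'
  | smul r x _ hx => rw [map_smul, smul_assoc]; exact Submodule.smul_mem _ _ hx
  | mem x hx =>
    rcases hx with ⟨a, X, p, hp, rfl⟩ | ⟨p, hp, rfl⟩
    · let T : Submodule ℂ (D.piece a) := ((G.low N c).comap
        ((LinearMap.toSpanSingleton (UniversalEnvelopingAlgebra ℂ D.L) _
          (D.vermaIncl H b N v)).restrictScalars ℂ ∘ₗ ((ι ℂ : D.L →ₗ⁅ℂ⁆ UniversalEnvelopingAlgebra ℂ D.L) :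
          D.L →ₗ[ℂ] UniversalEnvelopingAlgebra ℂ D.L))).comap
        ((D.tensEl a).flip p)
      suffices h : T = ⊤ by
        have : X ∈ T := h ▸ Submodule.mem_top
        exact this
      refine eq_top_of_rootPiece_le hLT T fun χ hχ Y hY => ?_
      change ι ℂ (D.tensEl a Y p) • D.vermaIncl H b N v ∈ G.low N c
      have hg := G.mem_grade_tensEl hχ Y hY p
      rcases lt_trichotomy (G.deg χ + G.B * a.1) 0 with h | h | h
      · exact G.smul_mem_low_of_mem_eigenspace N (G.vermaIncl_mem_eigenspace hLT hc v)
          (grade_le_gradeSum G.r (Set.mem_Iio.mpr h) hg)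
      · obtain ⟨rfl, ha⟩ := G.eq_zero χ hχ _ h
        rw [h, Int.cast_zero, ← G.mem_L0_iff hLT] at hg
        rw [D.ι_smul_vermaIncl H b N ⟨_, hg⟩ v, hI ⟨_, hg⟩ (tensEl_mem_L0I ha Y hY hp), map_zero]
        exact zero_mem _
      · rw [D.ι_smul_vermaIncl_of_mem_Lplus H b N ?_ v]
        · exact zero_mem _
        · rw [G.Lplus_eq hLT]
          exact grade_le_gradeSum G.r h hg
    · have hg : D.centEl p ∈ D.L0 H := D.centEl_mem_rootSpaceL H p
      rw [D.ι_smul_vermaIncl H b N ⟨_, hg⟩ v, hI ⟨_, hg⟩ (centEl_mem_L0I hp), map_zero]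
      exact zero_mem _

-- The property spreads from `N` to `M(N)` through `x y w = y x w + [x, y] w`: with `y` of negative
-- degree `low` is preserved, and `[x, y]` is again in the ideal.
include hLT hc hI in
theorem idealL_smul_mem_low {x : D.L} (hx : x ∈ D.idealL I) (w : D.Verma H b N) :
    ι ℂ x • w ∈ G.low N c := by
  let S : Submodule ℂ (D.Verma H b N) :=
    { carrier := {w | ∀ x ∈ D.idealL I, ι ℂ x • w ∈ G.low N c}
      zero_mem' := fun x _ => by rw [smul_zero]; exact zero_mem _
      add_mem' := fun hv hw x hx => by rw [smul_add]; exact add_mem (hv x hx) (hw x hx)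
      smul_mem' := fun r w hw x hx => by
        rw [smul_algebra_smul_comm]; exact Submodule.smul_mem _ _ (hw x hx) }
  have hS : S = ⊤ := by
    refine G.eq_top_of_stable hLT S (fun v x hx => G.idealL_smul_vermaIncl hLT hc hI hx v)
      fun y hy w hw x hx => ?_
    have h1 : ι ℂ x • ι ℂ y • w = ι ℂ y • ι ℂ x • w + ι ℂ ⁅x, y⁆ • w := by
      rw [LieHom.map_lie, LieRing.of_associative_ring_bracket, sub_smul, mul_smul, mul_smul]
      abel
    rw [h1, ← lie_skew, map_neg, neg_smul]
    exact add_mem (G.smul_mem_low N (hw x hx) hy) (neg_mem (hw _ (lie_mem_idealL hLT y hx)))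
  have : w ∈ S := hS ▸ Submodule.mem_top
  exact this x hx

include hLT hc hI in
/-- If `𝔏⁰(I)` kills `N`, then `LT ⊗ I ⊕ K ⊗ I` kills `V(N)`. -/
theorem idealL_smul_eq_zero [LieModule.IsIrreducible ℂ (D.L0 H) N] {x : D.L} (hx : x ∈ D.idealL I)
    (w : D.V H b N) : ι ℂ x • w = 0 := by
  obtain ⟨w, rfl⟩ := Submodule.Quotient.mk_surjective _ w
  -- The image of `M(N)` under the ideal is a submodule contained in the lower part, hence in the
  -- radical.
  let Q : Submodule ℂ (D.Verma H b N) :=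
    Submodule.span ℂ {z | ∃ x ∈ D.idealL I, ∃ w : D.Verma H b N, z = ι ℂ x • w}
  have hQ : ∀ y : D.L, ∀ z ∈ Q, ι ℂ y • z ∈ Q := by
    intro y z hz
    induction hz using Submodule.span_induction with
    | zero => rw [smul_zero]; exact zero_mem _
    | add z z' _ _ hz hz' => rw [smul_add]; exact add_mem hz hz'
    | smul r z _ hz => rw [smul_algebra_smul_comm]; exact Submodule.smul_mem _ _ hz
    | mem z hz =>
      obtain ⟨x, hx, w, rfl⟩ := hz
      have h1 : ι ℂ y • ι ℂ x • w = ι ℂ x • ι ℂ y • w + ι ℂ ⁅y, x⁆ • w := by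
        rw [LieHom.map_lie, LieRing.of_associative_ring_bracket, sub_smul, mul_smul, mul_smul]
        abel
      rw [h1]
      exact add_mem (Submodule.subset_span ⟨x, hx, _, rfl⟩)
        (Submodule.subset_span ⟨_, lie_mem_idealL hLT y hx, _, rfl⟩)
  let P : Submodule (UniversalEnvelopingAlgebra ℂ D.L) (D.Verma H b N) :=
    { Q.toAddSubmonoid with
      smul_mem' := fun u z hz => smul_mem_of_forall_ι_smul_mem Q hQ u hz }
  have hP : P ≤ D.vermaRad H b N := by
    refine G.le_vermaRad hLT hc P fun z (hz : z ∈ Q) => ?_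
    suffices h : Q ≤ G.low N c from h hz
    refine Submodule.span_le.mpr ?_
    rintro _ ⟨x, hx, w, rfl⟩
    exact G.idealL_smul_mem_low hLT hc hI hx w
  refine (Submodule.Quotient.mk_eq_zero _).mpr (hP ?_)
  exact Submodule.subset_span (s := {z | ∃ x ∈ D.idealL I, ∃ w : D.Verma H b N, z = ι ℂ x • w})
    ⟨x, hx, w, rfl⟩

variable (I)

include hLT in
/-- Modulo `LT ⊗ I ⊕ K ⊗ I`, the homogeneous parts of `𝔏` are finite-dimensional. -/
theorem exists_finiteDimensional_grade_le [FiniteDimensional ℂ (D.Am ⧸ I)] {j : ℤ} (hj : j ≠ 0) :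
    ∃ F : Submodule ℂ D.L, FiniteDimensional ℂ F ∧ grade G.r (j : ℂ) ≤ F ⊔ D.idealL I := by
  obtain ⟨FA, hFA⟩ := (I.restrictScalars ℂ).exists_isCompl
  have hfd : FiniteDimensional ℂ FA := by
    have e1 := Submodule.quotientEquivOfIsCompl _ _ hFA
    have e2 := Submodule.Quotient.restrictScalarsEquiv ℂ I
    exact Module.Finite.equiv (e2.symm.trans e1)
  -- From `deg χ + B k₀ = j` and `|deg χ| < B` one gets `|k₀| ≤ |j| + B`; the other exponents run
  -- over residues modulo the `mᵢ`.
  let S : Finset (ℤ × (Fin n → ℤ)) := Finset.Icc (-(|j| + G.B)) (|j| + G.B) ×ˢ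
    Fintype.piFinset fun i : Fin n => Finset.Ico 0 (D.m i.succ : ℤ)
  refine ⟨S.sup fun s => Submodule.map₂ (D.tensEl s) ⊤ FA, ?_, ?_⟩
  · have : ∀ s, FiniteDimensional ℂ (Submodule.map₂ (D.tensEl s) ⊤ FA) := fun s =>
      Module.Finite.iff_fg.mpr (Submodule.FG.map₂ _ Module.Finite.fg_top (Module.Finite.iff_fg.mp hfd))
    exact Submodule.finiteDimensional_finset_sup S _
  rw [G.grade_eq_span hLT, Submodule.span_le]
  rintro x ⟨hx, hxj⟩
  by_cases hx0 : x = 0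
  · rw [hx0]; exact zero_mem _
  have hzero : x ∉ grade G.r 0 := fun h =>
    hj (G.eq_of_mem_grade hx0 hxj (by rwa [Int.cast_zero]))
  cases hx with
  | cent p => exact absurd (G.mem_grade_zero (D.centEl_mem_rootSpaceL H p)) hzero
  | der => exact absurd (G.mem_grade_zero (D.derEl_mem_rootSpaceL H)) hzero
  | tens χ a X hX h0 =>
    have hχ := hLT.mem_extendedRoots hX h0
    have h1 := G.eq_of_mem_grade hx0 (G.mem_grade_tensEl hχ X hX 1) hxj
    have h2 := abs_lt.mp (G.deg_lt χ hχ)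
    have hk : (fun i => a.2 i - a.2 i % (D.m i.succ : ℤ)) ∈ D.Γ := fun i => Int.dvd_self_sub_emod
    let k : D.Γ := ⟨_, hk⟩
    let c : ℤ × (Fin n → ℤ) := (a.1, fun i => a.2 i % (D.m i.succ : ℤ))
    have hpc : D.piece a = D.piece c := D.piece_congr (by simp [c]) hk
    have hcS : c ∈ S := by
      refine Finset.mem_product.mpr ⟨Finset.mem_Icc.mpr ?_, Fintype.mem_piFinset.mpr fun i =>
        Finset.mem_Ico.mpr ⟨Int.emod_nonneg _ ?_, Int.emod_lt_of_pos _ ?_⟩⟩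
      · have hB : (0 : ℤ) < G.B := by linarith [abs_nonneg (G.deg χ), G.deg_lt χ hχ]
        have h3 := neg_abs_le j
        have h4 := le_abs_self j
        constructor
        · change -(|j| + G.B) ≤ a.1
          by_contra! h
          nlinarith [abs_nonneg j]
        · change a.1 ≤ |j| + G.B
          by_contra! h
          nlinarith [abs_nonneg j]
      · exact_mod_cast (D.m_pos i.succ).ne'
      · exact_mod_cast D.m_pos i.succ
    rw [SetLike.mem_coe, D.tensEl_mon_eq (a := c) ⟨X, hpc ▸ X.2⟩ X k rfl (by
      funext i
      simp [c, k]) rfl]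
    -- After the reduction to residues the coefficient is a monomial of `A(m)`, split along `I` and
    -- the finite-dimensional complement `FA`.
    have hm : D.mon k ∈ I.restrictScalars ℂ ⊔ FA := by rw [hFA.sup_eq_top]; trivial
    obtain ⟨p, hp, q, hq, hpq⟩ := Submodule.mem_sup.mp hm
    rw [← hpq, map_add]
    refine add_mem (Submodule.mem_sup_right (tensEl_mem_idealL _ _ hp)) (Submodule.mem_sup_left ?_)
    exact Finset.le_sup (f := fun s => Submodule.map₂ (D.tensEl s) ⊤ FA) hcS
      (Submodule.apply_mem_map₂ _ Submodule.mem_top hq)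

end Grading

end MultiloopDatum
end

section

attribute [local instance] LieRing.ofAssociativeRing

open scoped TensorProduct

/-- The image of `E` modulo `J` is finite-dimensional, so finitely many elements of `E` itself span
it. In the layers this keeps the chosen subspaces inside single degrees. -/
theorem Submodule.exists_finiteDimensional_le_of_le_sup {K M : Type*} [Field K] [AddCommGroup M]
    [Module K M] {E F J : Submodule K M} [FiniteDimensional K F] (h : E ≤ F ⊔ J) :
    ∃ F' : Submodule K M, FiniteDimensional K F' ∧ F' ≤ E ∧ E ≤ F' ⊔ J := by
  classical
  have h1 : E.map J.mkQ ≤ F.map J.mkQ := by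
    refine (Submodule.map_mono h).trans ?_
    rw [Submodule.map_sup, Submodule.mkQ_map_self, sup_bot_eq]
  have h2 : FiniteDimensional K (E.map J.mkQ) := Submodule.finiteDimensional_of_le h1
  have h3 : (Submodule.span K (J.mkQ '' (E : Set M))).FG := by
    rw [← Submodule.map_coe, Submodule.span_eq]
    exact Module.Finite.iff_fg.mp h2
  obtain ⟨s, hs, hspan⟩ := (Submodule.fg_span_iff_fg_span_finset_subset _).mp h3
  obtain ⟨t, ht, rfl⟩ := Finset.subset_set_image_iff.mp hs
  refine ⟨Submodule.span K t, FiniteDimensional.span_finset K t, Submodule.span_le.mpr ht,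
    fun x hx => ?_⟩
  have h4 : J.mkQ x ∈ (Submodule.span K (t : Set M)).map J.mkQ := by
    rw [Submodule.map_span, ← Finset.coe_image, ← hspan]
    exact Submodule.subset_span ⟨x, hx, rfl⟩
  obtain ⟨y, hy, hxy⟩ := h4
  rw [← add_sub_cancel y x]
  refine add_mem (Submodule.mem_sup_left hy) (Submodule.mem_sup_right ?_)
  rw [← Submodule.ker_mkQ J, LinearMap.mem_ker, map_sub, hxy, sub_self]

/-! ### Layers of a representation -/

namespace LieHom

variable {L M : Type*} [LieRing L] [LieAlgebra ℂ L] [AddCommGroup M] [Module ℂ M]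
  (ρ : L →ₗ⁅ℂ⁆ Module.End ℂ M) (F : ℕ → Submodule ℂ L) (N : Submodule ℂ M)

/-- The `k`-th layer generated from `N` by the subspaces `F (j + 1)` in degree `j + 1`. -/
noncomputable def layer : ℕ → Submodule ℂ M
  | 0 => N
  | k + 1 => ⨆ j : Fin (k + 1), Submodule.map₂ (ρ : L →ₗ[ℂ] Module.End ℂ M) (F (j + 1))
      (layer (k - j))
  termination_by k => k
  decreasing_by omega

theorem layer_zero : layer ρ F N 0 = N := by rw [layer]

theorem layer_succ (k : ℕ) : layer ρ F N (k + 1) = ⨆ j : Fin (k + 1),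
    Submodule.map₂ (ρ : L →ₗ[ℂ] Module.End ℂ M) (F (j + 1)) (layer ρ F N (k - j)) := by
  rw [layer]

theorem finiteDimensional_layer (hF : ∀ j, FiniteDimensional ℂ (F j)) [FiniteDimensional ℂ N]
    (k : ℕ) : FiniteDimensional ℂ (layer ρ F N k) := by
  induction k using Nat.strong_induction_on with
  | _ k ih =>
    cases k with
    | zero => rw [layer_zero]; infer_instance
    | succ k =>
      rw [layer_succ]
      have (j : Fin (k + 1)) : FiniteDimensional ℂ (Submodule.map₂ (ρ : L →ₗ[ℂ] Module.End ℂ M)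
          (F (j + 1)) (layer ρ F N (k - j))) :=
        Module.Finite.iff_fg.mpr (Submodule.FG.map₂ _ (Module.Finite.iff_fg.mp (hF _))
          (Module.Finite.iff_fg.mp (ih _ (by omega))))
      exact Submodule.finiteDimensional_iSup _

theorem apply_mem_layer {i k : ℕ} {x : L} (hx : x ∈ F (i + 1)) {v : M}
    (hv : v ∈ layer ρ F N k) : ρ x v ∈ layer ρ F N (k + i + 1) := by
  rw [layer_succ]
  refine Submodule.mem_iSup_of_mem (⟨i, by omega⟩ : Fin (k + i + 1)) ?_
  have h : k + i - i = k := by omega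
  simp only [h]
  exact Submodule.apply_mem_map₂ (ρ : L →ₗ[ℂ] Module.End ℂ M) hx hv

theorem layer_le_eigenspace {r : L} {c : ℂ} (hN : N ≤ (ρ r).eigenspace c)
    (hF : ∀ j : ℕ, F (j + 1) ≤ LieAlgebra.grade r ((-(j + 1 : ℤ) : ℤ) : ℂ)) (k : ℕ) :
    layer ρ F N k ≤ (ρ r).eigenspace (c - k) := by
  induction k using Nat.strong_induction_on with
  | _ k ih =>
    cases k with
    | zero => simpa [layer_zero] using hN
    | succ k =>
      rw [layer_succ]
      refine iSup_le fun j => Submodule.map₂_le.mpr fun x hx v hv => ?_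
      have h := LieHom.mem_eigenspace_of_mem_grade ρ (hF _ hx) (ih _ (by omega) hv)
      have hj : (j : ℕ) ≤ k := by omega
      have he : c - ((k + 1 : ℕ) : ℂ) = c - ((k - (j : ℕ) : ℕ) : ℂ) +
          ((-((j : ℕ) + 1 : ℤ) : ℤ) : ℂ) := by
        rw [Nat.cast_sub hj]
        push_cast
        ring
      rw [he]
      exact h

/-- A representation that is generated from finite-dimensional data by the negative part of a graded
Lie algebra has finite-dimensional eigenspaces for the grading element. -/
theorem finiteDimensional_eigenspace {r : L} {c : ℂ} [FiniteDimensional ℂ N]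
    (hN : N ≤ (ρ r).eigenspace c)
    (hgen : ∀ S : Submodule ℂ M, N ≤ S →
      (∀ x ∈ LieAlgebra.gradeSum r (Set.Iio 0), ∀ v ∈ S, ρ x v ∈ S) → S = ⊤)
    {J : Submodule ℂ L} (hJ : ∀ x ∈ J, ρ x = 0)
    (hF : ∀ j : ℕ, j ≠ 0 → ∃ F : Submodule ℂ L, FiniteDimensional ℂ F ∧
      LieAlgebra.grade r ((-(j : ℤ) : ℤ) : ℂ) ≤ F ⊔ J) (e : ℂ) :
    FiniteDimensional ℂ ((ρ r).eigenspace e) := by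
  have hF' : ∀ j : ℕ, ∃ F : Submodule ℂ L, FiniteDimensional ℂ F ∧
      F ≤ LieAlgebra.grade r ((-(j : ℤ) : ℤ) : ℂ) ∧
      (j ≠ 0 → LieAlgebra.grade r ((-(j : ℤ) : ℤ) : ℂ) ≤ F ⊔ J) := by
    intro j
    by_cases hj : j = 0
    -- A filler: the layers never use `F 0`.
    · exact ⟨⊥, inferInstance, bot_le, fun h => absurd hj h⟩
    obtain ⟨F, hF, hle⟩ := hF j hj
    obtain ⟨F', hF', hF'E, hle'⟩ := Submodule.exists_finiteDimensional_le_of_le_sup hle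
    exact ⟨F', hF', hF'E, fun _ => hle'⟩
  choose F hFfd hFle hF using hF'
  have hle := layer_le_eigenspace ρ F N hN (fun j => by
    have := hFle (j + 1)
    push_cast at this ⊢
    exact this)
  -- Since `J` acts by zero, an element of degree `-(j + 1)` acts like some element of `F (j + 1)`.
  -- So the sum of the layers is stable under the negative part.
  have htop : ⨆ k, layer ρ F N k = ⊤ := by
    refine hgen _ ?_ fun x hx v hv => ?_
    · refine le_iSup_of_le 0 ?_
      rw [layer_zero]
    · suffices h : ⨆ k, layer ρ F N k ≤ (⨆ k, layer ρ F N k).comap (ρ x) from h hv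
      refine iSup_le fun k v hv => ?_
      refine LieAlgebra.gradeSum_induction r (p := fun x => ρ x v ∈ ⨆ k, layer ρ F N k)
        (fun i hi x hx => ?_) ?_ (fun x y hx hy => ?_) hx
      · obtain ⟨j, rfl⟩ : ∃ j : ℕ, i = -((j + 1 : ℕ) : ℤ) :=
          ⟨(-i).toNat - 1, by rw [Set.mem_Iio] at hi; omega⟩
        obtain ⟨y, hy, z, hz, rfl⟩ := Submodule.mem_sup.mp (hF (j + 1) (by omega) hx)
        rw [map_add, hJ z hz, add_zero]
        exact Submodule.mem_iSup_of_mem _ (apply_mem_layer ρ F N hy hv)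
      · rw [map_zero, LinearMap.zero_apply]; exact zero_mem _
      · rw [map_add, LinearMap.add_apply]; exact add_mem hx hy
  have hind := Module.End.eigenspaces_iSupIndep (ρ r)
  by_cases he : ∃ k : ℕ, c - k = e
  · obtain ⟨k, hk⟩ := he
    have hinj : Function.Injective fun k : ℕ => c - (k : ℂ) := fun i j h => by simpa using h
    have := (hind.comp hinj).eq_of_le_of_iSup_eq_top hle htop k
    -- The layers lie in independent eigenspaces and add up to `M`, so the `k`-th layer is the whole
    -- eigenspace of `c - k`.
    simp only [Function.comp_apply] at this
    rw [← hk, ← this]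
    exact finiteDimensional_layer ρ F N hFfd k
  · have h1 : ⨆ (e') (_ : e' ≠ e), (ρ r).eigenspace e' = ⊤ := by
      rw [eq_top_iff, ← htop]
      exact iSup_le fun k => (hle k).trans (le_iSup₂_of_le _ (fun h => he ⟨k, h⟩) le_rfl)
    have h2 := (hind e).eq_bot
    rw [h1, inf_top_eq] at h2
    rw [h2]
    infer_instance

end LieHom

/-! ### From an ideal of finite codimension to finite-dimensional weight spaces. -/

namespace MultiloopDatum

open LieAlgebra.IsKilling LieModule RootPairing.Base LieAlgebra UniversalEnvelopingAlgebra

variable {n : ℕ} {𝔤 : Type*} [LieRing 𝔤] [LieAlgebra ℂ 𝔤] [FiniteDimensional ℂ 𝔤]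
  [LieAlgebra.IsSimple ℂ 𝔤]
  {D : MultiloopDatum n 𝔤} [LieAlgebra.IsSimple ℂ D.gZero]
  {H : LieSubalgebra ℂ D.gZero} [H.IsCartanSubalgebra] {b : (rootSystem H).Base}
  {N : Type*} [AddCommGroup N] [Module ℂ N] [LieRingModule (D.L0 H) N]
  [LieModule ℂ (D.L0 H) N] (hLT : D.IsLieTorus H b) [FiniteDimensional ℂ N]
  [LieModule.IsIrreducible ℂ (D.L0 H) N]

-- A weight space lies in a single eigenspace of the grading element, and those are
-- finite-dimensional already.
include hLT in
theorem finiteDimensional_weightSpace {I : Ideal D.Am} [FiniteDimensional ℂ (D.Am ⧸ I)]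
    (hI : ∀ x : D.L0 H, (x : D.L) ∈ D.L0I H I → ∀ v : N, ⁅x, v⁆ = 0)
    (χ : Module.Dual ℂ (D.hTilde H)) : FiniteDimensional ℂ (D.weightSpace H b N χ) := by
  obtain ⟨G⟩ := D.nonempty_grading H b
  obtain ⟨c, hc⟩ := G.exists_eigenvalue hLT (N := N)
  have hr := D.hTilde_le_L0 H G.mem_hTilde
  have h := LieHom.finiteDimensional_eigenspace (toRep ℂ D.L (D.V H b N))
    (LinearMap.range (D.incl H b N)) (r := G.r) (c := c) ?_ ?_ (J := D.idealL I) ?_ ?_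
    (χ ⟨G.r, G.mem_hTilde⟩)
  · exact Submodule.finiteDimensional_of_le (S₂ := (toRep ℂ D.L (D.V H b N) G.r).eigenspace
      (χ ⟨G.r, G.mem_hTilde⟩)) fun v hv =>
      Module.End.mem_eigenspace_iff.mpr (hv ⟨G.r, G.mem_hTilde⟩)
  · rintro _ ⟨v, rfl⟩
    rw [Module.End.mem_eigenspace_iff, toRep_apply, ι_smul_incl ⟨G.r, hr⟩ v, hc _ rfl, map_smul]
  · exact fun S hN hS => eq_top_of_incl_mem hLT G S (fun v => hN (LinearMap.mem_range_self _ v)) hS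
  · exact fun x hx => LinearMap.ext fun v => G.idealL_smul_eq_zero hLT hc hI hx v
  · exact fun j hj => G.exists_finiteDimensional_grade_le hLT I (j := -j) (by omega)

end MultiloopDatum
end

section

/-! ### Root vectors of a multiloop datum -/

namespace MultiloopDatum

open LieAlgebra.IsKilling LieModule RootPairing.Base LieAlgebra

variable {n : ℕ} {𝔤 : Type*} [LieRing 𝔤] [LieAlgebra ℂ 𝔤] (D : MultiloopDatum n 𝔤)

/-- The automorphism `σᵢ` as an endomorphism. -/
def σEnd (i : Fin (n + 1)) : Module.End ℂ 𝔤 := (D.σ i).toLinearEquiv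

@[simp] theorem σEnd_apply (i : Fin (n + 1)) (x : 𝔤) : D.σEnd i x = D.σ i x := rfl

theorem σEnd_pow (i : Fin (n + 1)) : D.σEnd i ^ D.m i = 1 := by
  have h1 : (D.σ i).toLinearEquiv ^ D.m i = 1 := by
    rw [← D.σ_order i]; exact pow_orderOf_eq_one _
  have h2 : ∀ k : ℕ, D.σEnd i ^ k = ((D.σ i).toLinearEquiv ^ k : 𝔤 ≃ₗ[ℂ] 𝔤) := by
    intro k
    induction k with
    | zero => rfl
    | succ k ih => rw [pow_succ, pow_succ, ih]; rfl
  rw [h2, h1]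
  rfl

theorem σEnd_commute (i j : Fin (n + 1)) : Commute (D.σEnd i) (D.σEnd j) :=
  LinearMap.ext fun x => D.σ_comm i j x

theorem mem_piece_iff {a : ℤ × (Fin n → ℤ)} {x : 𝔤} : x ∈ D.piece a ↔
    ∀ i : Fin (n + 1), D.σ i x = D.ξ i ^ (Fin.cons a.1 a.2 : Fin (n + 1) → ℤ) i • x := by
  rw [Fin.forall_fin_succ]
  rfl

variable [FiniteDimensional ℂ 𝔤]

theorem σEnd_isSemisimple (i : Fin (n + 1)) : (D.σEnd i).IsSemisimple := by
  have h0 : (D.m i : ℂ) ≠ 0 := Nat.cast_ne_zero.mpr (D.m_pos i).ne'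
  refine Module.End.isSemisimple_of_squarefree_aeval_eq_zero
    (p := (Polynomial.X ^ D.m i - Polynomial.C 1 : Polynomial ℂ))
    (Polynomial.separable_X_pow_sub_C 1 h0 one_ne_zero).squarefree ?_
  simp [D.σEnd_pow i]

/-- Commuting automorphisms of finite order are simultaneously diagonalizable, and the eigenvalues
of `σᵢ` are powers of the primitive root `ξᵢ`. -/
theorem iSup_piece : ⨆ a, D.piece a = ⊤ := by
  have h1 := Module.End.iSup_iInf_maxGenEigenspace_eq_top_of_iSup_maxGenEigenspace_eq_top_of_commute
    D.σEnd (fun i j _ => D.σEnd_commute i j) fun i => Module.End.iSup_maxGenEigenspace_eq_top _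
  rw [eq_top_iff, ← h1]
  refine iSup_le fun χ => ?_
  intro x hx
  by_cases hx0 : x = 0
  · rw [hx0]; exact zero_mem _
  rw [Submodule.mem_iInf] at hx
  have h2 : ∀ i, D.σ i x = χ i • x := fun i => by
    have := hx i
    rw [(D.σEnd_isSemisimple i).isFinitelySemisimple.maxGenEigenspace_eq_eigenspace,
      Module.End.mem_eigenspace_iff] at this
    exact this
  have h3 : ∀ i, ∃ k : ℤ, D.ξ i ^ k = χ i := by
    intro i
    have h4 : ∀ k : ℕ, (D.σEnd i ^ k) x = χ i ^ k • x := by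
      intro k
      induction k with
      | zero => simp
      | succ k ih => rw [pow_succ', Module.End.mul_apply, ih, map_smul, σEnd_apply, h2, smul_smul,
          pow_succ]
    have h5 := h4 (D.m i)
    rw [D.σEnd_pow, Module.End.one_apply] at h5
    have h6 : χ i ^ D.m i = 1 := smul_left_injective ℂ hx0 (h5.symm.trans (one_smul ℂ x).symm)
    have : NeZero (D.m i) := ⟨(D.m_pos i).ne'⟩
    obtain ⟨k, -, hk⟩ := (D.ξ_primitive i).eq_pow_of_pow_eq_one h6
    exact ⟨k, by rw [zpow_natCast, hk]⟩
  choose k hk using h3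
  refine Submodule.mem_iSup_of_mem (k 0, fun i => k i.succ) (D.mem_piece_iff.mpr fun i => ?_)
  rw [h2, ← hk]
  congr 2
  refine Fin.cases rfl (fun i => rfl) i

/-- The operators whose joint eigenspaces are the spaces of root vectors. -/
noncomputable def rootOps (H : LieSubalgebra ℂ D.gZero) : Fin (n + 1) ⊕ H → Module.End ℂ 𝔤 :=
  Sum.elim D.σEnd fun h => LieAlgebra.ad ℂ 𝔤 ((h : D.gZero) : 𝔤)

/-- The joint eigenvalues on a space of root vectors. -/
noncomputable def rootChar (H : LieSubalgebra ℂ D.gZero) (χ : Module.Dual ℂ H)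
    (a : ℤ × (Fin n → ℤ)) : Fin (n + 1) ⊕ H → ℂ :=
  Sum.elim (fun i => D.ξ i ^ (Fin.cons a.1 a.2 : Fin (n + 1) → ℤ) i) χ

theorem mem_iInf_rootOps {H : LieSubalgebra ℂ D.gZero} {χ : Module.Dual ℂ H}
    {a : ℤ × (Fin n → ℤ)} {x : 𝔤} :
    x ∈ ⨅ i, (D.rootOps H i).eigenspace (D.rootChar H χ a i) ↔ x ∈ D.rootPiece H χ a := by
  simp only [Submodule.mem_iInf, Sum.forall, Module.End.mem_eigenspace_iff]
  exact and_congr D.mem_piece_iff.symm Iff.rfl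

theorem σ_coe_gZero (i : Fin (n + 1)) (y : D.gZero) : D.σ i (y : 𝔤) = y := by
  have := D.mem_piece_iff.mp y.2 i
  rw [this]
  have h : (Fin.cons (0 : ℤ × (Fin n → ℤ)).1 (0 : ℤ × (Fin n → ℤ)).2 : Fin (n + 1) → ℤ) i = 0 :=
    Fin.cases rfl (fun i => rfl) i
  rw [h, zpow_zero, one_smul]

variable [LieAlgebra.IsSimple ℂ D.gZero]
  (H : LieSubalgebra ℂ D.gZero) [H.IsCartanSubalgebra] {b : (rootSystem H).Base}

theorem rootOps_commute (i j : Fin (n + 1) ⊕ H) : Commute (D.rootOps H i) (D.rootOps H j) := by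
  have h1 : ∀ (i : Fin (n + 1)) (h : H), Commute (D.rootOps H (.inl i)) (D.rootOps H (.inr h)) := by
    refine fun i h => LinearMap.ext fun x => ?_
    change D.σ i ⁅((h : D.gZero) : 𝔤), x⁆ = ⁅((h : D.gZero) : 𝔤), D.σ i x⁆
    rw [LieEquiv.map_lie, σ_coe_gZero]
  rcases i with i | h <;> rcases j with j | h'
  · exact D.σEnd_commute i j
  · exact h1 i h'
  · exact (h1 j h).symm
  · refine LinearMap.ext fun x => ?_
    change ⁅((h : D.gZero) : 𝔤), ⁅((h' : D.gZero) : 𝔤), x⁆⁆ =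
      ⁅((h' : D.gZero) : 𝔤), ⁅((h : D.gZero) : 𝔤), x⁆⁆
    have h2 : ⁅((h : D.gZero) : 𝔤), ((h' : D.gZero) : 𝔤)⁆ = 0 :=
      congrArg (fun y : H => ((y : D.gZero) : 𝔤)) (trivial_lie_zero H H h h')
    rw [leibniz_lie, h2, zero_lie, zero_add]

theorem iSupIndep_rootOps : iSupIndep fun χ : Fin (n + 1) ⊕ H → ℂ =>
    ⨅ i, (D.rootOps H i).eigenspace (χ i) :=
  Module.End.iSupIndep_iInf_eigenspace _ (D.rootOps_commute H)

/-- Two spaces of root vectors with a common non-zero element have the same residues. -/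
theorem dvd_of_mem_piece {a c : ℤ × (Fin n → ℤ)} {x : 𝔤} (hx : x ∈ D.piece a)
    (hx' : x ∈ D.piece c) (hx0 : x ≠ 0) : (D.m 0 : ℤ) ∣ a.1 - c.1 ∧ a.2 - c.2 ∈ D.Γ := by
  have key : ∀ (i : Fin (n + 1)) (k l : ℤ), D.ξ i ^ k • x = D.ξ i ^ l • x → (D.m i : ℤ) ∣ k - l := by
    intro i k l h
    have h1 := smul_left_injective ℂ hx0 h
    rw [← (D.ξ_primitive i).zpow_eq_one_iff_dvd, zpow_sub₀ (D.ξ_ne_zero i), h1,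
      div_self (zpow_ne_zero _ (D.ξ_ne_zero i))]
  exact ⟨key 0 _ _ (hx.1.symm.trans hx'.1), fun i => key i.succ _ _ ((hx.2 i).symm.trans (hx'.2 i))⟩

variable {D H} [LieAlgebra.IsSimple ℂ 𝔤] (hLT : D.IsLieTorus H b)

include hLT in
theorem span_rootVectors : Submodule.span ℂ {x | ∃ χ a, x ∈ D.rootPiece H χ a} = ⊤ := by
  rw [eq_top_iff, ← D.iSup_piece]
  refine iSup_le fun a => (Grading.piece_le hLT a).trans (iSup_le fun χ x hx => ?_)
  exact Submodule.subset_span ⟨χ, a, hx⟩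

-- Otherwise `𝔥(0)` would act by zero on `𝔤`, hence lie in its centre and vanish. But a zero
-- subalgebra of the non-zero algebra `𝔤(0̄,0̄)` is not self-normalizing.
include hLT in
theorem exists_rootVector_ne_zero : ∃ (χ : Module.Dual ℂ H) (a : ℤ × (Fin n → ℤ)) (x : 𝔤),
    χ ≠ 0 ∧ x ∈ D.rootPiece H χ a ∧ x ≠ 0 := by
  by_contra! hcon
  have h1 : ∀ (h : H) (x : 𝔤), ⁅((h : D.gZero) : 𝔤), x⁆ = 0 := by
    intro h x
    have hx : x ∈ Submodule.span ℂ {x | ∃ χ a, x ∈ D.rootPiece H χ a} := by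
      rw [span_rootVectors hLT]; trivial
    induction hx using Submodule.span_induction with
    | zero => exact lie_zero _
    | add x y _ _ hx hy => rw [lie_add, hx, hy, add_zero]
    | smul r x _ hx => rw [lie_smul, hx, smul_zero]
    | mem x hx =>
      obtain ⟨χ, a, hx⟩ := hx
      by_cases hχ : χ = 0
      · rw [hx.2, hχ, LinearMap.zero_apply, zero_smul]
      · rw [hcon χ a x hχ hx, lie_zero]
  have h2 : H = ⊥ := by
    rw [LieSubalgebra.eq_bot_iff]
    intro h hh
    have h3 : (h : 𝔤) ∈ LieAlgebra.center ℂ 𝔤 := by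
      rw [LieModule.mem_maxTrivSubmodule]
      intro x
      rw [← lie_skew, h1 ⟨h, hh⟩ x, neg_zero]
    rw [LieAlgebra.center_eq_bot] at h3
    exact Subtype.ext (by simpa using h3)
  have h4 := LieSubalgebra.IsCartanSubalgebra.self_normalizing (H := H)
  have : Nontrivial D.gZero := LieModule.nontrivial_of_isIrreducible ℂ D.gZero D.gZero
  obtain ⟨y, hy⟩ := exists_ne (0 : D.gZero)
  have h5 : y ∈ H.normalizer := by
    rw [LieSubalgebra.mem_normalizer_iff]
    intro z hz
    rw [h2, LieSubalgebra.mem_bot] at hz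
    rw [hz, lie_zero]
    exact zero_mem _
  rw [h4, h2, LieSubalgebra.mem_bot] at h5
  exact hy h5

variable (D H) in
/-- Root vectors of non-zero weight, and brackets of root vectors of opposite non-zero weights. -/
inductive IsCoreVector : 𝔤 → Prop
  | root (χ : Module.Dual ℂ H) (a : ℤ × (Fin n → ℤ)) (x : 𝔤) (hχ : χ ≠ 0)
    (hx : x ∈ D.rootPiece H χ a) : IsCoreVector x
  | lie (χ : Module.Dual ℂ H) (a c : ℤ × (Fin n → ℤ)) (x y : 𝔤) (hχ : χ ≠ 0)
    (hx : x ∈ D.rootPiece H χ a) (hy : y ∈ D.rootPiece H (-χ) c) : IsCoreVector ⁅x, y⁆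

-- The span is an ideal, and it is non-zero because a root vector of non-zero weight exists; `𝔤` is
-- simple. That it is an ideal is checked on root vectors, the delicate case being a vector of
-- weight zero acting on a bracket, where the Leibniz rule applies.
include hLT in
theorem span_isCoreVector : Submodule.span ℂ {x | D.IsCoreVector H x} = ⊤ := by
  set S := Submodule.span ℂ {x | D.IsCoreVector H x} with hS
  have key : ∀ (χ : Module.Dual ℂ H) a, ∀ z ∈ D.rootPiece H χ a, ∀ q, D.IsCoreVector H q →
      ⁅z, q⁆ ∈ S := by
    intro γ e z hz q hq
    cases hq with
    | root χ a x hχ hx =>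
      by_cases h : γ + χ = 0
      · have hγ : γ ≠ 0 := by
          rintro rfl
          exact hχ (by simpa using h)
        have hχ' : χ = -γ := (neg_eq_of_add_eq_zero_right h).symm
        exact Submodule.subset_span (.lie γ e a z q hγ hz (hχ' ▸ hx))
      · exact Submodule.subset_span (.root _ _ _ h (D.lie_mem_rootPiece hz hx))
    | lie χ a c x y hχ hx hy =>
      by_cases h : γ = 0
      · subst h
        have h1 := D.lie_mem_rootPiece hz hx
        have h2 := D.lie_mem_rootPiece hz hy
        rw [zero_add] at h1 h2
        rw [leibniz_lie]
        exact add_mem (Submodule.subset_span (.lie χ _ _ _ _ hχ h1 hy))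
          (Submodule.subset_span (.lie χ _ _ _ _ hχ hx h2))
      · have h1 := D.lie_mem_rootPiece hz (D.lie_mem_rootPiece hx hy)
        rw [add_neg_cancel, add_zero] at h1
        exact Submodule.subset_span (.root _ _ _ h h1)
  let I : LieIdeal ℂ 𝔤 :=
    { S with
      lie_mem := by
        intro z q (hq : q ∈ S)
        change ⁅z, q⁆ ∈ S
        have hz : z ∈ Submodule.span ℂ {x | ∃ χ a, x ∈ D.rootPiece H χ a} := by
          rw [span_rootVectors hLT]; trivial
        induction hz using Submodule.span_induction with
        | zero => rw [zero_lie]; exact zero_mem _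
        | add x y _ _ hx hy => rw [add_lie]; exact add_mem hx hy
        | smul r x _ hx => rw [smul_lie]; exact Submodule.smul_mem _ _ hx
        | mem z hz =>
          obtain ⟨χ, a, hz⟩ := hz
          induction hq using Submodule.span_induction with
          | zero => rw [lie_zero]; exact zero_mem _
          | add x y _ _ hx hy => rw [lie_add]; exact add_mem hx hy
          | smul r x _ hx => rw [lie_smul]; exact Submodule.smul_mem _ _ hx
          | mem q hq => exact key χ a z hz q hq }
  have hI : I = ⊤ := by
    refine (LieAlgebra.IsSimple.eq_bot_or_eq_top (R := ℂ) I).resolve_left fun h => ?_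
    obtain ⟨χ, a, x, hχ, hx, hx0⟩ := exists_rootVector_ne_zero hLT
    have hxI : x ∈ I := Submodule.subset_span (s := {x | D.IsCoreVector H x}) (.root χ a x hχ hx)
    rw [h] at hxI
    exact hx0 (by simpa using hxI)
  rw [eq_top_iff]
  intro x _
  have : x ∈ I := hI ▸ LieSubmodule.mem_top x
  exact this

include hLT in
/-- Vectors of weight zero are sums of brackets of root vectors of opposite non-zero weights. -/
theorem rootPiece_zero_le_span (k : Fin n → ℤ) : D.rootPiece H 0 (0, k) ≤
    Submodule.span ℂ {z | ∃ (χ : Module.Dual ℂ H) (k₀ : ℤ) (l : Fin n → ℤ) (x y : 𝔤), χ ≠ 0 ∧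
      0 < k₀ ∧ k₀ ≤ D.m 0 ∧ x ∈ D.rootPiece H χ (k₀, l) ∧ y ∈ D.rootPiece H (-χ) (-k₀, k - l) ∧
      z = ⁅x, y⁆} := by
  intro z hz
  -- Core vectors are joint eigenvectors of the `σᵢ` and of `𝔥(0)`, so those with the right
  -- eigenvalues span this space. Only the brackets among them can be non-zero of weight zero.
  rw [← mem_iInf_rootOps, (D.iSupIndep_rootOps H).eq_span_of_span_eq_top (span_isCoreVector hLT)
    ?_ (D.rootChar H 0 (0, k))] at hz
  · refine Submodule.span_le.mpr ?_ hz
    rintro q ⟨hq, hqE⟩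
    rw [mem_iInf_rootOps] at hqE
    by_cases hq0 : q = 0
    · rw [hq0]; exact zero_mem _
    cases hq with
    | root χ a x hχ hx =>
      refine absurd (LinearMap.ext fun h => ?_) hχ
      have h1 := hx.2 h
      rw [hqE.2 h] at h1
      exact (smul_left_injective ℂ hq0 h1).symm
    | lie χ a c x y hχ hx hy =>
      obtain ⟨h1, h2⟩ := D.dvd_of_mem_piece (D.lie_mem_piece hx.1 hy.1) hqE.1 hq0
      have hm : (0 : ℤ) < D.m 0 := by exact_mod_cast D.m_pos 0
      have hk1 := Int.emod_nonneg (a.1 - 1) hm.ne'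
      have hk2 := Int.emod_lt_of_pos (a.1 - 1) hm
      have hk3 : (D.m 0 : ℤ) ∣ (a.1 - 1) - (a.1 - 1) % D.m 0 := Int.dvd_self_sub_emod
      -- The representative of `a.1` modulo `m₀` in the range from 1 to `m₀`; it must be positive so
      -- that the first factor comes from `𝔏⁺`.
      refine Submodule.subset_span ⟨χ, (a.1 - 1) % D.m 0 + 1, a.2, x, y, hχ, by omega, by omega,
        ?_, ?_, rfl⟩
      · rwa [D.rootPiece_congr H χ (c := a)]
        · change (D.m 0 : ℤ) ∣ (a.1 - 1) % D.m 0 + 1 - a.1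
          have : (a.1 - 1) % D.m 0 + 1 - a.1 = -((a.1 - 1) - (a.1 - 1) % D.m 0) := by ring
          rw [this, dvd_neg]
          exact hk3
        · rw [sub_self]; exact zero_mem _
      · rwa [D.rootPiece_congr H (-χ) (c := c)]
        · change (D.m 0 : ℤ) ∣ -((a.1 - 1) % D.m 0 + 1) - c.1
          have : -((a.1 - 1) % D.m 0 + 1) - c.1 =
              ((a.1 - 1) - (a.1 - 1) % D.m 0) - (a.1 + c.1 - 0) := by ring
          rw [this]
          exact dvd_sub hk3 h1
        · change k - a.2 - c.2 ∈ D.Γ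
          have : k - a.2 - c.2 = -(a.2 + c.2 - k) := by abel
          rw [this]
          exact neg_mem h2
  · rintro q hq
    cases hq with
    | root χ a x hχ hx => exact ⟨_, D.mem_iInf_rootOps.mpr hx⟩
    | lie χ a c x y hχ hx hy => exact ⟨_, D.mem_iInf_rootOps.mpr (D.lie_mem_rootPiece hx hy)⟩

theorem dvd_add_of_form_ne_zero {a c : ℤ × (Fin n → ℤ)} {x y : 𝔤} (hx : x ∈ D.piece a)
    (hy : y ∈ D.piece c) (h : D.form x y ≠ 0) : (D.m 0 : ℤ) ∣ a.1 + c.1 := by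
  have h1 := D.form_σ 0 x y
  rw [hx.1, hy.1, map_smul, map_smul, LinearMap.smul_apply, smul_smul, smul_eq_mul,
    ← zpow_add₀ (D.ξ_ne_zero 0)] at h1
  have h2 : D.ξ 0 ^ (c.1 + a.1) = 1 := mul_right_cancel₀ h (by rw [h1, one_mul])
  have h3 := ((D.ξ_primitive 0).zpow_eq_one_iff_dvd _).mp h2
  rwa [add_comm c.1] at h3

-- By non-degeneracy a root vector of non-zero weight pairs non-trivially with some root vector.
-- Invariance under `𝔥(0)` and under the `σᵢ` forces opposite weights and opposite residues. The
-- pair gives access to the centre `K ⊗ A(m)`.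
include hLT in
theorem exists_form_ne_zero : ∃ (χ : Module.Dual ℂ H) (k₀ : ℤ) (l : Fin n → ℤ) (x y : 𝔤), χ ≠ 0 ∧
    0 < k₀ ∧ k₀ ≤ D.m 0 ∧ x ∈ D.rootPiece H χ (k₀, l) ∧ y ∈ D.rootPiece H (-χ) (-k₀, -l) ∧
    D.form x y ≠ 0 := by
  obtain ⟨χ, a, x, hχ, hx, hx0⟩ := exists_rootVector_ne_zero hLT
  obtain ⟨ψ, c, y, hy, hxy⟩ : ∃ ψ c y, y ∈ D.rootPiece H ψ c ∧ D.form x y ≠ 0 := by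
    by_contra! hcon
    refine hx0 (D.form_nondegenerate.1 x fun y => ?_)
    have hy : y ∈ Submodule.span ℂ {x | ∃ χ a, x ∈ D.rootPiece H χ a} := by
      rw [span_rootVectors hLT]; trivial
    induction hy using Submodule.span_induction with
    | zero => rw [map_zero]
    | add x y _ _ hx hy => rw [map_add, hx, hy, add_zero]
    | smul r x _ hx => rw [map_smul, hx, smul_zero]
    | mem y hy =>
      obtain ⟨ψ, c, hy⟩ := hy
      exact hcon ψ c y hy
  have hψ : ψ = -χ := by
    ext h
    have h1 := D.form_invariant x ((h : D.gZero) : 𝔤) y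
    rw [← lie_skew, hx.2, hy.2, map_neg, LinearMap.neg_apply, map_smul, map_smul,
      LinearMap.smul_apply] at h1
    simp only [smul_eq_mul] at h1
    have h2 : -χ h = ψ h := mul_right_cancel₀ hxy (by rw [← h1]; ring)
    rw [← h2, LinearMap.neg_apply]
  subst hψ
  have h1 := dvd_add_of_form_ne_zero hx.1 hy.1 hxy
  have h2 := D.add_mem_Γ_of_form_ne_zero hx.1 hy.1 hxy
  have hm : (0 : ℤ) < D.m 0 := by exact_mod_cast D.m_pos 0
  have hk1 := Int.emod_nonneg (a.1 - 1) hm.ne'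
  have hk2 := Int.emod_lt_of_pos (a.1 - 1) hm
  have hk3 : (D.m 0 : ℤ) ∣ (a.1 - 1) - (a.1 - 1) % D.m 0 := Int.dvd_self_sub_emod
  refine ⟨χ, (a.1 - 1) % D.m 0 + 1, a.2, x, y, hχ, by omega, by omega, ?_, ?_, hxy⟩
  · rwa [D.rootPiece_congr H χ (c := a)]
    · change (D.m 0 : ℤ) ∣ (a.1 - 1) % D.m 0 + 1 - a.1
      have : (a.1 - 1) % D.m 0 + 1 - a.1 = -((a.1 - 1) - (a.1 - 1) % D.m 0) := by ring
      rw [this, dvd_neg]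
      exact hk3
    · rw [sub_self]; exact zero_mem _
  · rwa [D.rootPiece_congr H (-χ) (c := c)]
    · change (D.m 0 : ℤ) ∣ -((a.1 - 1) % D.m 0 + 1) - c.1
      have : -((a.1 - 1) % D.m 0 + 1) - c.1 =
          ((a.1 - 1) - (a.1 - 1) % D.m 0) - (a.1 + c.1) := by ring
      rw [this]
      exact dvd_sub hk3 h1
    · change -a.2 - c.2 ∈ D.Γ
      have : -a.2 - c.2 = -(a.2 + c.2) := by abel
      rw [this]
      exact neg_mem h2

end MultiloopDatum
end

section

open scoped TensorProduct

theorem Ideal.finiteDimensional_quotient_of_ker_le {K A W : Type*} [Field K] [CommRing A]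
    [Algebra K A] [AddCommGroup W] [Module K W] [FiniteDimensional K W] (J : Ideal A)
    (f : A →ₗ[K] W) (h : ∀ p, f p = 0 → p ∈ J) : FiniteDimensional K (A ⧸ J) := by
  let g : A →ₗ[K] A ⧸ J := (Ideal.Quotient.mkₐ K J).toLinearMap
  have hg : Function.Surjective g := Ideal.Quotient.mk_surjective
  have hle : LinearMap.ker f ≤ LinearMap.ker g := fun p hp =>
    Ideal.Quotient.eq_zero_iff_mem.mpr (h p hp)
  have : FiniteDimensional K (A ⧸ LinearMap.ker f) :=
    Module.Finite.equiv f.quotKerEquivRange.symm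
  refine Module.Finite.of_surjective ((LinearMap.ker f).liftQ g hle) fun y => ?_
  obtain ⟨p, rfl⟩ := hg y
  exact ⟨Submodule.Quotient.mk p, rfl⟩

theorem Ideal.finiteDimensional_quotient_iInf {κ K A : Type*} [Finite κ] [Field K] [CommRing A]
    [Algebra K A] (I : κ → Ideal A) (hI : ∀ s, FiniteDimensional K (A ⧸ I s)) :
    FiniteDimensional K (A ⧸ ⨅ s, I s) := by
  refine Ideal.finiteDimensional_quotient_of_ker_le (W := ∀ s, A ⧸ I s) _
    (LinearMap.pi fun s => (Ideal.Quotient.mkₐ K (I s)).toLinearMap) fun p hp => ?_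
  rw [Ideal.mem_iInf]
  exact fun s => Ideal.Quotient.eq_zero_iff_mem.mp (congrFun hp s)

/-- The ideal contains the kernel of `p ↦ f p`, viewed as a map into the finite-dimensional space of
bilinear maps from `R` and `N` to `Ω`. -/
theorem Ideal.finiteDimensional_quotient_of_forall_mem {K A R N M : Type*} [Field K] [CommRing A]
    [Algebra K A] [AddCommGroup R] [Module K R] [FiniteDimensional K R] [AddCommGroup N]
    [Module K N] [FiniteDimensional K N] [AddCommGroup M] [Module K M] (J : Ideal A)
    (f : A →ₗ[K] R →ₗ[K] N →ₗ[K] M) (Ω : Submodule K M) [FiniteDimensional K Ω]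
    (hΩ : ∀ p Y v, f p Y v ∈ Ω) (h : ∀ p, (∀ Y v, f p Y v = 0) → p ∈ J) :
    FiniteDimensional K (A ⧸ J) := by
  let g : A →ₗ[K] R →ₗ[K] N →ₗ[K] Ω := LinearMap.mk₂ K (fun p Y => (f p Y).codRestrict Ω (hΩ p Y))
    (fun p q Y => by ext; simp) (fun r p Y => by ext; simp) (fun p X Y => by ext; simp)
    (fun r p Y => by ext; simp)
  refine J.finiteDimensional_quotient_of_ker_le (W := R →ₗ[K] N →ₗ[K] Ω) g fun p hp => h p fun Y v => ?_
  exact congrArg (fun g : R →ₗ[K] N →ₗ[K] Ω => (g Y v : M)) hp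

attribute [local instance] LieRing.ofAssociativeRing

/-! ### Modules with finite-dimensional weight spaces -/

namespace MultiloopDatum

open LieAlgebra.IsKilling LieModule RootPairing.Base LieAlgebra UniversalEnvelopingAlgebra

variable {n : ℕ} {𝔤 : Type*} [LieRing 𝔤] [LieAlgebra ℂ 𝔤] [FiniteDimensional ℂ 𝔤]
  [LieAlgebra.IsSimple ℂ 𝔤]
  {D : MultiloopDatum n 𝔤}

theorem tensEl_congr {a c : ℤ × (Fin n → ℤ)} (h : a = c) {X : D.piece a} {Y : D.piece c}
    (hXY : (X : 𝔤) = Y) (p : D.Am) : D.tensEl a X p = D.tensEl c Y p := by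
  subst h
  rw [Subtype.ext hXY]

theorem tensEl_mon_mul {a c : ℤ × (Fin n → ℤ)} (X : D.piece a) (Y : D.piece c) (k : D.Γ)
    (h1 : a.1 = c.1) (h2 : a.2 + k = c.2) (hXY : (X : 𝔤) = Y) (p : D.Am) :
    D.tensEl c Y p = D.tensEl a X (D.mon k * p) := by
  apply Subtype.ext
  rw [coe_tensEl, coe_tensEl]
  ext1
  · obtain ⟨p, hp⟩ := p
    change tens c (Y : 𝔤) p = tens a (X : 𝔤) (AddMonoidAlgebra.single (k : Fin n → ℤ) 1 * p)
    clear hp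
    induction p using AddMonoidAlgebra.induction_linear with
    | zero => simp
    | add p q hp hq => rw [tens_add, hp, hq, mul_add, tens_add]
    | single l r =>
      rw [AddMonoidAlgebra.single_mul_single, tens_single, tens_single, one_mul, hXY, h1, ← h2,
        add_assoc]
  · rfl
  · rfl

variable [LieAlgebra.IsSimple ℂ D.gZero]
  {H : LieSubalgebra ℂ D.gZero} [H.IsCartanSubalgebra] {b : (rootSystem H).Base}

variable {N : Type*} [AddCommGroup N] [Module ℂ N] [LieRingModule (D.L0 H) N]
  [LieModule ℂ (D.L0 H) N]

theorem lie_smul_eq {M : Type*} [AddCommGroup M] [Module ℂ M]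
    [Module (UniversalEnvelopingAlgebra ℂ D.L) M] (x y : D.L) (w : M) :
    ι ℂ ⁅x, y⁆ • w = ι ℂ x • ι ℂ y • w - ι ℂ y • ι ℂ x • w := by
  rw [LieHom.map_lie, LieRing.of_associative_ring_bracket, sub_smul, mul_smul, mul_smul]

theorem ι_smul_incl_mem_weightSpace {χ : Module.Dual ℂ (D.hTilde H)}
    (hχ : ∀ (h : D.hTilde H) (v : N), ⁅(⟨h, D.hTilde_le_L0 H h.2⟩ : D.L0 H), v⁆ = χ h • v)
    {β : Module.Dual ℂ H} {k₀ : ℤ} {x : D.L} (hx : x ∈ D.rootSpaceL H β k₀) (v : N) :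
    ι ℂ x • D.incl H b N v ∈ D.weightSpace H b N (χ + D.affineWeight H β k₀) := by
  intro h
  have h1 := lie_smul_eq (h : D.L) x (D.incl H b N v)
  have h2 := ι_smul_incl (b := b) ⟨h, D.hTilde_le_L0 H h.2⟩ v
  rw [D.lie_of_mem_rootSpaceL H h hx, h2, hχ, map_smul, map_smul, smul_algebra_smul_comm,
    smul_assoc] at h1
  rw [LinearMap.add_apply, add_smul, h1]
  abel

variable (D H b N) in
/-- The ideal of all `p` such that `Y t₀^{k₀} t^k p` kills `N ⊆ V(N)` for all root vectors `Y` of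
weight `β ≠ 0`. -/
noncomputable def killIdeal (β : Module.Dual ℂ H) (hβ : β ≠ 0) (a : ℤ × (Fin n → ℤ)) :
    Ideal D.Am where
  carrier := {p | ∀ Y : D.piece a, (Y : 𝔤) ∈ D.rootPiece H β a → ∀ v : N,
    ι ℂ (D.tensEl a Y p) • D.incl H b N v = 0}
  zero_mem' := fun Y _ v => by rw [map_zero, map_zero, zero_smul]
  add_mem' := fun hp hq Y hY v => by
    rw [map_add, map_add, add_smul, hp Y hY v, hq Y hY v, add_zero]
  smul_mem' := fun q p hp Y hY v => by
    obtain ⟨h, hh⟩ : ∃ h : H, β h ≠ 0 := by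
      by_contra! h0
      exact hβ (LinearMap.ext h0)
    -- The element `h ⊗ q` lies in `𝔏⁰` and preserves `N`, while its bracket with `Y ⊗ p` is `β(h) Y
    -- ⊗ qp` without central term. Since `β(h) ≠ 0`, `qp` kills whenever `p` does.
    let h' : D.piece 0 := ⟨((h : D.gZero) : 𝔤), (h : D.gZero).2⟩
    have hmem : D.tensEl 0 h' q ∈ D.L0 H := by
      refine D.tensEl_mem_rootSpaceL (a := 0) (χ := 0) h' ⟨h'.2, fun h₁ => ?_⟩ q
      rw [LinearMap.zero_apply, zero_smul]
      exact congrArg (fun y : H => ((y : D.gZero) : 𝔤)) (trivial_lie_zero H H h₁ h)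
    have h1 : ⁅D.tensEl 0 h' q, D.tensEl a Y p⁆ = β h • D.tensEl a Y (q * p) := by
      have h2 : D.centTerm 0 a h' Y = 0 := by
        apply Subtype.ext
        simp [centTerm]
      rw [lie_tensEl, h2, zero_mul, map_zero, add_zero, ← LinearMap.smul_apply, ← map_smul]
      exact tensEl_congr (zero_add a) (hY.2 h) _
    have h3 := lie_smul_eq (D.tensEl 0 h' q) (D.tensEl a Y p) (D.incl H b N v)
    rw [h1, hp Y hY, smul_zero, ι_smul_incl (b := b) ⟨_, hmem⟩ v, hp Y hY, sub_zero, map_smul,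
      smul_assoc] at h3
    exact (smul_eq_zero.mp h3).resolve_left hh

/-- The weight for `𝔥̃(0)` does not see `t₁, …, tₙ`, so all the vectors `(Y ⊗ p) v` lie in the same
finite-dimensional weight space, independently of `p`. -/
theorem finiteDimensional_quotient_killIdeal [FiniteDimensional ℂ N]
    (hfin : ∀ χ : Module.Dual ℂ (D.hTilde H), FiniteDimensional ℂ (D.weightSpace H b N χ))
    {χ : Module.Dual ℂ (D.hTilde H)}
    (hχ : ∀ (h : D.hTilde H) (v : N), ⁅(⟨h, D.hTilde_le_L0 H h.2⟩ : D.L0 H), v⁆ = χ h • v)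
    (β : Module.Dual ℂ H) (hβ : β ≠ 0) (a : ℤ × (Fin n → ℤ)) :
    FiniteDimensional ℂ (D.Am ⧸ D.killIdeal H b N β hβ a) := by
  have := hfin (χ + D.affineWeight H β a.1)
  let R : Submodule ℂ (D.piece a) := (D.rootPiece H β a).comap (D.piece a).subtype
  let act : D.L →ₗ[ℂ] N →ₗ[ℂ] D.V H b N := LinearMap.lcomp ℂ _ (D.incl H b N) ∘ₗ
    (Algebra.lsmul ℂ ℂ (D.V H b N) :
      UniversalEnvelopingAlgebra ℂ D.L →ₐ[ℂ] Module.End ℂ (D.V H b N)).toLinearMap ∘ₗ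
    ((ι ℂ : D.L →ₗ⁅ℂ⁆ UniversalEnvelopingAlgebra ℂ D.L) : D.L →ₗ[ℂ] UniversalEnvelopingAlgebra ℂ D.L)
  refine Ideal.finiteDimensional_quotient_of_forall_mem _
    (((D.tensEl a ∘ₗ R.subtype).compr₂ act).flip) (D.weightSpace H b N (χ + D.affineWeight H β a.1))
    (fun p Y v => ι_smul_incl_mem_weightSpace hχ (D.tensEl_mem_rootSpaceL Y.1 Y.2 p) v)
    fun p hp Y hY v => hp ⟨Y, hY⟩ v

/-- There is an ideal of finite codimension which annihilates `N` in all degrees `-k₀` with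
`0 < k₀ ≤ B`. -/
theorem exists_ideal_le_killIdeal (hLT : D.IsLieTorus H b) [FiniteDimensional ℂ N]
    [LieModule.IsIrreducible ℂ (D.L0 H) N]
    (hfin : ∀ χ : Module.Dual ℂ (D.hTilde H), FiniteDimensional ℂ (D.weightSpace H b N χ))
    (B : ℤ) : ∃ J : Ideal D.Am, FiniteDimensional ℂ (D.Am ⧸ J) ∧
      ∀ (β : Module.Dual ℂ H) (hβ : β ≠ 0) (k₀ : ℤ) (l : Fin n → ℤ), 0 < k₀ → k₀ ≤ B →
        J ≤ D.killIdeal H b N β hβ (-k₀, l) := by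
  obtain ⟨χ, hχ⟩ := D.exists_weight H N
  let S : Finset (ℤ × (Fin n → ℤ)) := Finset.Icc 1 B ×ˢ
    Fintype.piFinset fun i : Fin n => Finset.Ico 0 (D.m i.succ : ℤ)
  let E : Set (Module.Dual ℂ H) := {β | β ∈ extendedRoots (rootSystem H) ∧ β ≠ 0}
  have : Finite E := (finite_extendedRoots.subset fun β hβ => hβ.1).to_subtype
  -- Finitely many ideals suffice: only extended roots occur as weights, and other exponents are
  -- reduced to their residues by multiplying with a monomial, which an ideal tolerates.
  let I : E × S → Ideal D.Am := fun s => D.killIdeal H b N s.1.1 s.1.2.2 (-s.2.1.1, s.2.1.2)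
  have hI : ∀ s, FiniteDimensional ℂ (D.Am ⧸ I s) := fun s =>
    finiteDimensional_quotient_killIdeal hfin hχ _ _ _
  refine ⟨⨅ s, I s, ?_, fun β hβ k₀ l hk hkB p hp Y hY v => ?_⟩
  · exact Ideal.finiteDimensional_quotient_iInf I hI
  · by_cases hY0 : (Y : 𝔤) = 0
    · have hz : D.tensEl (-k₀, l) Y p = 0 := by
        rw [show Y = 0 from Subtype.ext hY0, LinearMap.map_zero, LinearMap.zero_apply]
      rw [hz, map_zero (ι ℂ), zero_smul]
    have hβE : β ∈ E := ⟨hLT.mem_extendedRoots hY hY0, hβ⟩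
    have hk' : (fun i => l i - l i % (D.m i.succ : ℤ)) ∈ D.Γ := fun i => Int.dvd_self_sub_emod
    let k : D.Γ := ⟨_, hk'⟩
    let l' : Fin n → ℤ := fun i => l i % (D.m i.succ : ℤ)
    have hlS : (k₀, l') ∈ S := by
      refine Finset.mem_product.mpr ⟨Finset.mem_Icc.mpr ⟨hk, hkB⟩, Fintype.mem_piFinset.mpr
        fun i => Finset.mem_Ico.mpr ⟨Int.emod_nonneg _ ?_, Int.emod_lt_of_pos _ ?_⟩⟩
      · exact_mod_cast (D.m_pos i.succ).ne'
      · exact_mod_cast D.m_pos i.succ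
    have hroot : D.rootPiece H β (-k₀, l) = D.rootPiece H β (-k₀, l') :=
      D.rootPiece_congr H β (by simp) hk'
    have hY' : (Y : 𝔤) ∈ D.rootPiece H β (-k₀, l') := hroot ▸ hY
    have hpI : p ∈ D.killIdeal H b N β hβ (-k₀, l') :=
      Ideal.mem_iInf.mp hp (⟨β, hβE⟩, ⟨(k₀, l'), hlS⟩)
    have hmul := (D.killIdeal H b N β hβ (-k₀, l')).mul_mem_left (D.mon k) hpI
    have heq : D.tensEl (-k₀, l) Y p =
        D.tensEl (-k₀, l') (⟨(Y : 𝔤), hY'.1⟩ : D.piece (-k₀, l')) (D.mon k * p) := by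
      have hl : l' + (k : Fin n → ℤ) = l := by
        funext i
        simp [l', k]
      exact tensEl_mon_mul (a := (-k₀, l')) (c := (-k₀, l)) (⟨(Y : 𝔤), hY'.1⟩ : D.piece (-k₀, l')) Y
        k (Eq.refl (-k₀)) hl (Eq.refl (Y : 𝔤)) p
    rw [heq]
    exact hmul ⟨(Y : 𝔤), hY'.1⟩ hY' v

/-! ### The annihilation of `N` by `𝔏⁰(J)`. -/

section Kill

variable {J : Ideal D.Am} (hJ : ∀ (β : Module.Dual ℂ H) (hβ : β ≠ 0) (k₀ : ℤ) (l : Fin n → ℤ),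
    0 < k₀ → k₀ ≤ 2 * D.m 0 → J ≤ D.killIdeal H b N β hβ (-k₀, l))

-- Both factors of the bracket kill `N` inside `V(N)`: the first is in `𝔏⁺`, the second has its
-- coefficient in `J`.
include hJ in
theorem lie_smul_incl_eq_zero {χ : Module.Dual ℂ H} (hχ : χ ≠ 0) {k₀ : ℤ} (h0 : 0 < k₀)
    (h1 : k₀ ≤ 2 * D.m 0) {k l : Fin n → ℤ} {x y : 𝔤} (hx : x ∈ D.rootPiece H χ (k₀, l))
    (hy : y ∈ D.rootPiece H (-χ) (-k₀, k - l)) {p : D.Am} (hp : p ∈ J) (z : D.piece (0, k))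
    (hz : (z : 𝔤) = ⁅x, y⁆) (v : N) :
    ι ℂ (D.tensEl (0, k) z p +
      D.centEl (D.centTerm (k₀, l) (-k₀, k - l) ⟨x, hx.1⟩ ⟨y, hy.1⟩ * p)) • D.incl H b N v = 0 := by
  have hX : D.tensEl (k₀, l) ⟨x, hx.1⟩ 1 ∈ D.Lplus H b :=
    Submodule.mem_iSup_of_mem χ (Submodule.mem_iSup_of_mem k₀ (Submodule.mem_iSup_of_mem (Or.inl h0)
      (D.tensEl_mem_rootSpaceL _ hx 1)))
  have h2 := lie_smul_eq (D.tensEl (k₀, l) ⟨x, hx.1⟩ 1) (D.tensEl (-k₀, k - l) ⟨y, hy.1⟩ p)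
    (D.incl H b N v)
  rw [ι_smul_incl_of_mem_Lplus hX, hJ (-χ) (neg_ne_zero.mpr hχ) k₀ (k - l) h0 h1 hp ⟨y, hy.1⟩ hy v,
    smul_zero, smul_zero, sub_zero, lie_tensEl, one_mul] at h2
  rw [← h2]
  congr 3
  exact tensEl_congr (by simp) hz p

-- The same `x` and `y` also live in the `t₀`-degrees `±(k₀ + m₀)`. Passing to them leaves the loop
-- term unchanged and multiplies the central term by `(k₀ + m₀)/k₀ ≠ 1`, so subtracting the two
-- relations kills each term separately. This is why `J` has to serve all degrees up to `2m₀`.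
include hJ in
theorem tensEl_and_centEl_smul_incl_eq_zero {χ : Module.Dual ℂ H} (hχ : χ ≠ 0) {k₀ : ℤ}
    (h0 : 0 < k₀) (h1 : k₀ ≤ D.m 0) {k l : Fin n → ℤ} {x y : 𝔤}
    (hx : x ∈ D.rootPiece H χ (k₀, l)) (hy : y ∈ D.rootPiece H (-χ) (-k₀, k - l)) {p : D.Am}
    (hp : p ∈ J) (z : D.piece (0, k)) (hz : (z : 𝔤) = ⁅x, y⁆) (v : N) :
    ι ℂ (D.tensEl (0, k) z p) • D.incl H b N v = 0 ∧
    ι ℂ (D.centEl (D.centTerm (k₀, l) (-k₀, k - l) ⟨x, hx.1⟩ ⟨y, hy.1⟩ * p)) •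
      D.incl H b N v = 0 := by
  have hm : (0 : ℤ) < D.m 0 := by exact_mod_cast D.m_pos 0
  have hx' : x ∈ D.rootPiece H χ (k₀ + D.m 0, l) := by
    rwa [D.rootPiece_congr H χ (c := (k₀, l)) (by simp) (by simp [D.Γ.zero_mem])]
  have hy' : y ∈ D.rootPiece H (-χ) (-(k₀ + D.m 0), k - l) := by
    rwa [D.rootPiece_congr H (-χ) (c := (-k₀, k - l)) (by simp) (by simp [D.Γ.zero_mem])]
  have e1 := lie_smul_incl_eq_zero hJ hχ h0 (by omega) hx hy hp z hz v
  have e2 := lie_smul_incl_eq_zero hJ hχ (k₀ := k₀ + D.m 0) (by omega) (by omega) hx' hy' hp z hz v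
  have hk0 : (k₀ : ℂ) ≠ 0 := by exact_mod_cast h0.ne'
  have hm0 : (D.m 0 : ℂ) ≠ 0 := by exact_mod_cast (D.m_pos 0).ne'
  have hcent : D.centTerm (k₀ + D.m 0, l) (-(k₀ + D.m 0), k - l) ⟨x, hx'.1⟩ ⟨y, hy'.1⟩ =
      (((k₀ : ℂ) + D.m 0) / k₀) • D.centTerm (k₀, l) (-k₀, k - l) ⟨x, hx.1⟩ ⟨y, hy.1⟩ := by
    apply Subtype.ext
    change _ = (((k₀ : ℂ) + D.m 0) / k₀) •
      (D.centTerm (k₀, l) (-k₀, k - l) ⟨x, hx.1⟩ ⟨y, hy.1⟩ : AddMonoidAlgebra ℂ (Fin n → ℤ))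
    simp only [centTerm, add_neg_cancel, if_true, AddMonoidAlgebra.smul_single, smul_eq_mul]
    congr 1
    push_cast
    field_simp
  rw [hcent, smul_mul_assoc, map_smul] at e2
  generalize D.centEl (D.centTerm (k₀, l) (-k₀, k - l) ⟨x, hx.1⟩ ⟨y, hy.1⟩ * p) = C at e1 e2 ⊢
  rw [map_add, add_smul] at e1 e2
  rw [map_smul, smul_assoc] at e2
  have e3 : ((D.m 0 : ℂ) / k₀) • ι ℂ C • D.incl H b N v = 0 := by
    have : (D.m 0 : ℂ) / k₀ = ((k₀ : ℂ) + D.m 0) / k₀ - 1 := by field_simp; ring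
    rw [this, sub_smul, one_smul, ← add_sub_add_left_eq_sub _ _
      (ι ℂ (D.tensEl (0, k) z p) • D.incl H b N v), e1, e2, sub_zero]
  have e4 := (smul_eq_zero.mp e3).resolve_left (div_ne_zero hm0 hk0)
  rw [e4, add_zero] at e1
  exact ⟨e1, e4⟩

-- For loop elements, weight-zero vectors are sums of the brackets just treated. For `K ⊗ p`, a pair
-- with `(y, z) ≠ 0` has central term a non-zero multiple of `p`.
include hJ in
theorem L0I_smul_incl_eq_zero (hLT : D.IsLieTorus H b) {x : D.L} (hx : x ∈ D.L0I H J) (v : N) :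
    ι ℂ x • D.incl H b N v = 0 := by
  induction hx using Submodule.span_induction with
  | zero => rw [map_zero, zero_smul]
  | add x y _ _ hx hy => rw [map_add, add_smul, hx, hy, add_zero]
  | smul r x _ hx => rw [map_smul, smul_assoc, hx, smul_zero]
  | mem x hx =>
    rcases hx with ⟨k, X, hX, p, hp, hxe⟩ | ⟨p, hp, hxe⟩
    · let T : Submodule ℂ 𝔤 := ((LinearMap.ker (((LinearMap.toSpanSingleton
        (UniversalEnvelopingAlgebra ℂ D.L) _ (D.incl H b N v)).restrictScalars ℂ ∘ₗ
        ((ι ℂ : D.L →ₗ⁅ℂ⁆ UniversalEnvelopingAlgebra ℂ D.L) :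
          D.L →ₗ[ℂ] UniversalEnvelopingAlgebra ℂ D.L)) ∘ₗ ((D.tensEl (0, k)).flip p)))).map
        (D.piece (0, k)).subtype
      have hT : X ∈ T := by
        suffices h : D.rootPiece H 0 (0, k) ≤ T from h hX
        refine (rootPiece_zero_le_span hLT k).trans (Submodule.span_le.mpr ?_)
        rintro _ ⟨χ, k₀, l, y, z, hχ, h0, h1, hy, hz, rfl⟩
        have hmem : ⁅y, z⁆ ∈ D.piece (0, k) := by
          have := D.lie_mem_piece hy.1 hz.1
          simpa using this
        exact ⟨⟨_, hmem⟩, (tensEl_and_centEl_smul_incl_eq_zero hJ hχ h0 h1 hy hz hp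
          ⟨_, hmem⟩ rfl v).1, rfl⟩
      obtain ⟨X', hX', rfl⟩ := hT
      have : x = D.tensEl (0, k) X' p := Subtype.ext hxe
      rw [this]
      exact hX'
    · have hxp : x = D.centEl p := Subtype.ext hxe
      obtain ⟨χ, k₀, l, y, z, hχ, h0, h1, hy, hz, hyz⟩ := exists_form_ne_zero hLT
      have hz' : z ∈ D.rootPiece H (-χ) (-k₀, 0 - l) := by rwa [zero_sub]
      have hmem : ⁅y, z⁆ ∈ D.piece (0, 0) := by
        have := D.lie_mem_piece hy.1 hz.1
        simpa using this
      have h2 := (tensEl_and_centEl_smul_incl_eq_zero hJ hχ h0 h1 hy hz' hp ⟨_, hmem⟩ rfl v).2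
      have h3 : D.centTerm (k₀, l) (-k₀, 0 - l) ⟨y, hy.1⟩ ⟨z, hz'.1⟩ * p =
          ((k₀ : ℂ) * D.form y z) • p := by
        have : D.centTerm (k₀, l) (-k₀, 0 - l) ⟨y, hy.1⟩ ⟨z, hz'.1⟩ =
            algebraMap ℂ D.Am ((k₀ : ℂ) * D.form y z) := by
          apply Subtype.ext
          rw [Subalgebra.coe_algebraMap, AddMonoidAlgebra.coe_algebraMap]
          simp [centTerm]
        rw [this, Algebra.smul_def]
      rw [h3, map_smul, map_smul, smul_assoc] at h2
      rw [hxp]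
      refine (smul_eq_zero.mp h2).resolve_left (mul_ne_zero ?_ hyz)
      exact_mod_cast h0.ne'

end Kill

end MultiloopDatum
end

/-! ### The equivalence. -/

theorem mainTheorem2 {n : ℕ} (hn : 0 < n)
    {𝔤 : Type*} [LieRing 𝔤] [LieAlgebra ℂ 𝔤] [FiniteDimensional ℂ 𝔤] [LieAlgebra.IsSimple ℂ 𝔤]
    (D : MultiloopDatum n 𝔤) [LieAlgebra.IsSimple ℂ D.gZero]
    (H : LieSubalgebra ℂ D.gZero) [H.IsCartanSubalgebra]
    (b : (LieAlgebra.IsKilling.rootSystem H).Base) (hLT : D.IsLieTorus H b)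
    (N : Type*) [AddCommGroup N] [Module ℂ N] [LieRingModule (D.L0 H) N]
    [LieModule ℂ (D.L0 H) N] [FiniteDimensional ℂ N] [LieModule.IsIrreducible ℂ (D.L0 H) N] :
    (∀ χ : Module.Dual ℂ (D.hTilde H), FiniteDimensional ℂ (D.weightSpace H b N χ)) ↔
      ∃ I : Ideal D.Am, FiniteDimensional ℂ (D.Am ⧸ I) ∧
        ∀ x : D.L0 H, (x : D.L) ∈ D.L0I H I → ∀ v : N, ⁅x, v⁆ = 0 := by
  constructor
  · intro hfin
    obtain ⟨J, hJfin, hJ⟩ := MultiloopDatum.exists_ideal_le_killIdeal hLT hfin (2 * D.m 0)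
    -- The finiteness hypothesis only speaks of `V(N)`; injectivity of `N → V(N)` carries the
    -- annihilation back to `N`.
    refine ⟨J, hJfin, fun x hx v => MultiloopDatum.incl_injective hLT (b := b) ?_⟩
    rw [← MultiloopDatum.ι_smul_incl, map_zero]
    exact MultiloopDatum.L0I_smul_incl_eq_zero hJ hLT hx v
  · rintro ⟨I, hIfin, hI⟩ χ
    exact MultiloopDatum.finiteDimensional_weightSpace hLT hI χ
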